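/- Let $\mathbb K$ be an algebraically closed field of arbitrary characteristic, let $n\ge 1$, let $R=\mathbb K[X_0,\dots,X_n]$ be the coordinate ring of $\mathbb P^n=\mathbb P(V)$ and $S=\mathbb K[Y_0,\dots,Y_n]$ that of the dual space $\mathbb P(W)$. Let $Z\subseteq\mathbb P^n$ be a nonempty finite set of points. *Splitting type.* Let $\mathcal A_Z$ be the arrangement of the hyperplanes of $\mathbb P(W)$ dual to the points of $Z$, let $D(\mathcal A_Z)=\{\theta\in\mathrm{Der}_{\mathbb K}(S): \theta(I(H))\subseteq I(H)\text{ for all }H\in\mathcal A_Z\}$, graded by the degree of $\theta(\ell)$ for linear forms $\ell$, and let $D_0(\mathcal A_Z)=D(\mathcal A_Z)/S\theta_e$, where $\theta_e=\sum_i Y_i\,\partial/\partial Y_i$. The splitting type of $D_0(\mathcal A_Z)$ is the tuple of integers $0\le a_1\le\dots\le a_n$ such that, for a general line $L\subseteq\mathbb P(W)$, the restriction to $L$ of the sheaf associated to $D_0(\mathcal A_Z)$ is isomorphic to $\bigoplus_{i=1}^n\mathcal O_L(-a_i)$. *Unexpected hypersurfaces.* Let $d$ be an integer, put $m=d-1$,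 and let $Q\subseteq\mathbb P^n$ denote a general linear subspace of codimension $2$ (with the conventions $I(Q)^m=R$ for $m\le 0$ and $[M]_d=0$ for $d<0$). We say that $Z$ admits unexpected hypersurfaces in degree $d$ if $$\dim[I(Z)\cap I(Q)^{m}]_d>\max\{0,\ \dim[I(Q)^{m}]_d-\dim[R/I(Z)]_d\}.$$ We say that $Z$ admits very unexpected hypersurfaces in degree $d$ if there is a subset $T\subseteq Z$ such that 1. $[I(Z)\cap I(Q)^m]_d=[I(T)\cap I(Q)^m]_d$ for general $Q$; 2. for every irreducible subvariety $X\subseteq\mathbb P^n$ one has, for general $Q$ (depending on $X$), $|T\cap X|\le\dim[I(Q)^m/(I(X)\cap I(Q)^m)]_d$; 3. $\dim[R/I(T)]_d>\dim[I(Q)^m/(I(T)\cap I(Q)^m)]_d$ for general $Q$. **Theorem.** Let $(a_1,\dots,a_n)$, with $a_i\le a_{i+1}$, be the splitting type of $D_0(\mathcal A_Z)$. Suppose that for all positive-dimensional linear subspaces $H\subseteq\mathbb P^n$, $$\frac{|Z\cap H|-1}{\dim H}\le\frac{|Z|-1}{n}.$$ Then for every integer $d$ the following are equivalent: (a) $Z$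 admits very unexpected hypersurfaces in degree $d$; (b) $Z$ admits unexpected hypersurfaces in degree $d$; (c) $a_1<d<a_n$. -/

import Mathlib

open MvPolynomial
open scoped LinearAlgebra.Projectivization

namespace UnexpectedHypersurfaces

/-! Coordinates are fixed throughout: `V = W = K ^ (n + 1)`, dual to each other through the dot
product. `Poly K n` is used both as the coordinate ring `R = Sym(V*)` of `ℙ(V)` and as the
coordinate ring `S = Sym(W*)` of the dual space `ℙ(W)`. -/

/-- The vector space `K ^ (n + 1)`. -/
abbrev Vec (K : Type*) (n : ℕ) : Type _ := Fin (n + 1) → K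

/-- The homogeneous coordinate ring `K[X_0, …, X_n]`. -/
abbrev Poly (K : Type*) [Field K] (n : ℕ) : Type _ := MvPolynomial (Fin (n + 1)) K

noncomputable section

variable {K : Type*} [Field K] {n : ℕ}

/-! ### General linear subspaces -/

/-- `P u` holds for a general `k`-tuple `u` of linearly independent vectors of `K ^ (n + 1)`:
there is a nonzero polynomial `G` in the entries of `u` such that `P u` holds for every linearly
independent `u` with `G u ≠ 0`. When `P u` depends only on the span of `u`, this says (over an
infinite field) that `P` holds on a nonempty Zariski open subset of the Grassmannian. -/
def ForGeneral (k : ℕ) (P : (Fin k → Vec K n) → Prop) : Prop :=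
  ∃ G : MvPolynomial (Fin k × Fin (n + 1)) K, G ≠ 0 ∧
    ∀ u : Fin k → Vec K n, LinearIndependent K u →
      MvPolynomial.eval (fun p => u p.1 p.2) G ≠ 0 → P u

/-- The linear subspace `Q` of `V` cut out by the linear forms with coefficient vectors `u i`.
If `u` is linearly independent, it has codimension `c`; it is the annihilator of the span of `u`. -/
def cutOut {c : ℕ} (u : Fin c → Vec K n) : Submodule K (Vec K n) :=
  LinearMap.ker (Matrix.of u).mulVecLin

/-! ### Homogeneous ideals and dimensions of graded pieces -/

/-- The homogeneous ideal `I(X)` of a subset `X` of projective space. -/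
def projIdeal (X : Set (ℙ K (Vec K n))) : Ideal (Poly K n) :=
  MvPolynomial.vanishingIdeal K {v : Vec K n | ∃ hv : v ≠ 0, Projectivization.mk K v hv ∈ X}

/-- The ideal `I(H)` of a linear subspace, generated by the linear forms that vanish on it. -/
def linIdeal (H : Submodule K (Vec K n)) : Ideal (Poly K n) :=
  MvPolynomial.vanishingIdeal K (H : Set (Vec K n))

/-- The graded piece `[I]_d` of a homogeneous ideal, for an integer `d`; it is `0` for `d < 0`. -/
def gradedPiece (I : Ideal (Poly K n)) : ℤ → Submodule K (Poly K n)
  | Int.ofNat d => I.restrictScalars K ⊓ MvPolynomial.homogeneousSubmodule (Fin (n + 1)) K d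
  | Int.negSucc _ => ⊥

/-- `dim [I]_d`. -/
def hdim (I : Ideal (Poly K n)) (d : ℤ) : ℕ := Module.finrank K (gradedPiece I d)

/-- `dim [I / J]_d`, for homogeneous ideals `J ≤ I`. -/
def quotDim (I J : Ideal (Poly K n)) (d : ℤ) : ℕ :=
  Module.finrank K (gradedPiece I d ⧸ (gradedPiece J d).submoduleOf (gradedPiece I d))

/-! ### Subvarieties of projective space -/

/-- The points of projective space that lie on the linear subspace given by `H`. -/
def projSet (H : Submodule K (Vec K n)) : Set (ℙ K (Vec K n)) := {P | P.submodule ≤ H}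

/-- Zariski closed subsets of projective space: common zero loci of homogeneous polynomials. -/
def IsProjClosed (X : Set (ℙ K (Vec K n))) : Prop :=
  ∃ F : Set (Poly K n), (∀ f ∈ F, ∃ k : ℕ, f.IsHomogeneous k) ∧
    X = {P | ∀ f ∈ F, MvPolynomial.eval P.rep f = 0}

/-- Irreducible (closed) subvarieties of projective space. -/
def IsIrredSubvariety (X : Set (ℙ K (Vec K n))) : Prop :=
  IsProjClosed X ∧ X.Nonempty ∧
    ∀ A B : Set (ℙ K (Vec K n)), IsProjClosed A → IsProjClosed B → X ⊆ A ∪ B → X ⊆ A ∨ X ⊆ B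

/-! ### Unexpected and very unexpected hypersurfaces -/

/-- `Z` admits unexpected `mQ`-hypersurfaces in degree `d`, where `Q` is a general linear
subspace of codimension `c`:
`dim [I(Z) ∩ I(Q)^m]_d > max {0, dim [I(Q)^m]_d - dim [R / I(Z)]_d}`. -/
def AdmitsUnexpectedGen (Z : Finset (ℙ K (Vec K n))) (c m : ℕ) (d : ℤ) : Prop :=
  ForGeneral c fun u : Fin c → Vec K n =>
    (hdim (projIdeal (Z : Set (ℙ K (Vec K n))) ⊓ linIdeal (cutOut u) ^ m) d : ℤ) >
      max 0 ((hdim (linIdeal (cutOut u) ^ m) d : ℤ) -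
        (quotDim ⊤ (projIdeal (Z : Set (ℙ K (Vec K n)))) d : ℤ))

/-- `Z` admits very unexpected `mQ`-hypersurfaces in degree `d`, where `Q` is a generic linear
subspace of codimension `c`: some subset `T` of `Z` satisfies
(I) `[I(Z) ∩ I(Q)^m]_d = [I(T) ∩ I(Q)^m]_d`,
(II) `|T ∩ X| ≤ dim [I(Q)^m / (I(X) ∩ I(Q)^m)]_d` for all irreducible subvarieties `X`,
(III) `dim [R / I(T)]_d > dim [I(Q)^m / (I(T) ∩ I(Q)^m)]_d`.
The subspace `Q` is generic with respect to the data `Z`, `T`, `X` of each condition. -/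
def AdmitsVeryUnexpectedGen (Z : Finset (ℙ K (Vec K n))) (c m : ℕ) (d : ℤ) : Prop :=
  ∃ T : Finset (ℙ K (Vec K n)), T ⊆ Z ∧
    (ForGeneral c fun u : Fin c → Vec K n =>
      gradedPiece (projIdeal (Z : Set (ℙ K (Vec K n))) ⊓ linIdeal (cutOut u) ^ m) d =
        gradedPiece (projIdeal (T : Set (ℙ K (Vec K n))) ⊓ linIdeal (cutOut u) ^ m) d) ∧
    (∀ X : Set (ℙ K (Vec K n)), IsIrredSubvariety X →
      ForGeneral c fun u : Fin c → Vec K n =>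
        ((T : Set (ℙ K (Vec K n))) ∩ X).ncard ≤
          quotDim (linIdeal (cutOut u) ^ m) (projIdeal X ⊓ linIdeal (cutOut u) ^ m) d) ∧
    (ForGeneral c fun u : Fin c → Vec K n =>
      quotDim ⊤ (projIdeal (T : Set (ℙ K (Vec K n)))) d >
        quotDim (linIdeal (cutOut u) ^ m)
          (projIdeal (T : Set (ℙ K (Vec K n))) ⊓ linIdeal (cutOut u) ^ m) d)

/-- Unexpected hypersurfaces in degree `d` in the case `codim Q = 2`, `m = d - 1`
(with `I(Q)^m = R` for `m ≤ 0`). -/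
def AdmitsUnexpected (Z : Finset (ℙ K (Vec K n))) (d : ℤ) : Prop :=
  AdmitsUnexpectedGen Z 2 (d - 1).toNat d

/-- Very unexpected hypersurfaces in degree `d` in the case `codim Q = 2`, `m = d - 1`
(with `I(Q)^m = R` for `m ≤ 0`). -/
def AdmitsVeryUnexpected (Z : Finset (ℙ K (Vec K n))) (d : ℤ) : Prop :=
  AdmitsVeryUnexpectedGen Z 2 (d - 1).toNat d

/-! ### Derivations of the dual hyperplane arrangement and the splitting type -/

/-- The ideal in `S` of the hyperplane `{w | ⟨P, w⟩ = 0}` of `W` dual to the point `P`. -/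
def hyperplaneIdeal (P : ℙ K (Vec K n)) : Ideal (Poly K n) :=
  MvPolynomial.vanishingIdeal K {w : Vec K n | P.rep ⬝ᵥ w = 0}

/-- The module `Der(S)` of `K`-derivations of `S`, in coordinates: `f` stands for the derivation
`∑ f_i ∂/∂Y_i`. -/
abbrev Der (K : Type*) [Field K] (n : ℕ) : Type _ := Fin (n + 1) → Poly K n

/-- The derivation `∑ f_i ∂/∂Y_i` of `S`. -/
def toDer (f : Der K n) : Derivation K (Poly K n) (Poly K n) := MvPolynomial.mkDerivation K f

/-- Every derivation of `S` is `∑ f_i ∂/∂Y_i` for exactly one `f`. -/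
theorem toDer_bijective : Function.Bijective (toDer : Der K n → _) :=
  (MvPolynomial.mkDerivationEquiv K).bijective

theorem toDer_add (f g : Der K n) : toDer (f + g) = toDer f + toDer g := by
  refine MvPolynomial.derivation_ext fun i => ?_
  simp [toDer, MvPolynomial.mkDerivation_X]

theorem toDer_smul (c : Poly K n) (f : Der K n) : toDer (c • f) = c • toDer f := by
  refine MvPolynomial.derivation_ext fun i => ?_
  simp [toDer, MvPolynomial.mkDerivation_X]

/-- The module `D(A_Z)` of derivations of the hyperplane arrangement `A_Z` dual to `Z`:
the `θ ∈ Der(S)` with `θ(I(H)) ⊆ I(H)` for all `H ∈ A_Z`. -/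
def arrDer (Z : Finset (ℙ K (Vec K n))) : Submodule (Poly K n) (Der K n) where
  carrier := {θ | ∀ P ∈ Z, ∀ f ∈ hyperplaneIdeal P, toDer θ f ∈ hyperplaneIdeal P}
  zero_mem' := fun P _ f _ => by
    have h : toDer (0 : Der K n) = 0 := by simpa using toDer_smul 0 (0 : Der K n)
    simp [h]
  add_mem' := fun {a b} ha hb P hP f hf => by
    rw [toDer_add]
    exact Ideal.add_mem _ (ha P hP f hf) (hb P hP f hf)
  smul_mem' := fun c θ hθ P hP f hf => by
    rw [toDer_smul]
    exact Ideal.mul_mem_left _ c (hθ P hP f hf)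

/-- The Euler derivation `∑ Y_i ∂/∂Y_i`. -/
def eulerDer (K : Type*) [Field K] (n : ℕ) : Der K n := fun i => MvPolynomial.X i

/-- The reduced module of derivations `D₀(A_Z) = D(A_Z) / S θ_e`. -/
abbrev RedDer (Z : Finset (ℙ K (Vec K n))) : Type _ :=
  arrDer Z ⧸ (Submodule.span (Poly K n) {eulerDer K n}).submoduleOf (arrDer Z)

/-- `θ` is homogeneous of polynomial degree `d`: it maps linear forms to forms of degree `d`. -/
def IsHomogDer (θ : Der K n) (d : ℕ) : Prop := ∀ i, (θ i).IsHomogeneous d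

/-- The irrelevant ideal `(Y_0, …, Y_n)`. -/
def irrelevant (K : Type*) [Field K] (n : ℕ) : Ideal (Poly K n) :=
  Ideal.span (Set.range fun i : Fin (n + 1) => (MvPolynomial.X i : Poly K n))

/-- For the line `L ⊆ ℙ(W)` given by a two-dimensional subspace of `W`, the restriction to `L` of
the sheaf on `ℙ(W)` associated to `D₀(A_Z)` is isomorphic to `⨁ i, 𝒪_L(-a i)`.

Write `B = S / I(L)`. An isomorphism of these sheaves on `L = Proj B` is the same as a
degree-preserving homomorphism from `D₀(A_Z) ⊗ B = D₀(A_Z) / I(L) D₀(A_Z)` to `⨁ i, B(-a i)` whose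
kernel and cokernel are annihilated by a power of the irrelevant ideal; here the homomorphism is
given by its composite `φ` with the projection from `D₀(A_Z)`. -/
def RestrictsTo (Z : Finset (ℙ K (Vec K n))) (a : Fin n → ℕ) (L : Submodule K (Vec K n)) : Prop :=
  ∃ φ : RedDer Z →ₗ[Poly K n] (Fin n → Poly K n ⧸ linIdeal L),
    (∀ (d : ℕ) (θ : arrDer Z), IsHomogDer (θ : Der K n) d →
      ∀ i, ∃ g ∈ gradedPiece (⊤ : Ideal (Poly K n)) ((d : ℤ) - (a i : ℤ)),
        φ (Submodule.Quotient.mk θ) i = Ideal.Quotient.mk (linIdeal L) g) ∧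
    ∃ k : ℕ,
      (∀ x : RedDer Z, φ x = 0 → ∀ f ∈ irrelevant K n ^ k,
        f • x ∈ linIdeal L • (⊤ : Submodule (Poly K n) (RedDer Z))) ∧
      (∀ y : Fin n → Poly K n ⧸ linIdeal L, ∀ f ∈ irrelevant K n ^ k, f • y ∈ LinearMap.range φ)

/-- `(a_1, …, a_n)` (indexed from `0` here), with `a_i ≤ a_{i+1}`, is the splitting type of
`D₀(A_Z)`: on a general line `L ⊆ ℙ(W)` the restriction of `D₀(A_Z)` is `⨁ i, 𝒪_L(-a i)`. -/
def IsSplittingType (Z : Finset (ℙ K (Vec K n))) (a : Fin n → ℕ) : Prop :=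
  Monotone a ∧ ForGeneral 2 fun u : Fin 2 → Vec K n =>
    RestrictsTo Z a (Submodule.span K (Set.range u))

end

end UnexpectedHypersurfaces

open UnexpectedHypersurfaces

/-! Put d = m + 1 and let L be the line of the dual space spanned by a general pair u, so that Q is
the common zero locus of the linear forms u₀·X and u₁·X. The proof compares three numbers: dim [I(Z)
∩ I(Q)^m]_d, dim [I(Q)^m]_d = nd + 1, and the rank r of the conditions that Z imposes on [I(Q)^m]_d.

Duality. A point x off Q determines the point of L where the hyperplane dual to x meets L; its
coordinates on L are (u₁·x, -u₀·x). A vector field g of degree m along L therefore defines the form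
F(x) = g(that point)·x, which has degree m + 1 and multiplicity m along Q (`dualForm`). Every such
form arises this way, F = 0 exactly for multiples of the Euler field, and F vanishes on Z exactly
when g is tangent to the arrangement. Since a general L is transverse to the arrangement, tangent
fields modulo Euler are the sections of D₀ restricted to L. Hence dim [I(Z) ∩ I(Q)^m]_d = Σ (d -
a_i)⁺ (`hdim_eq_sum_of_restrictsTo`), and taking d large gives Σ a_i = |Z| - 1
(`sum_splitting_add_one`).

Numerical part. It follows that nd + 1 - |Z| = Σ (d - a_i)⁺ - Σ (a_i - d)⁺. If the hypersurfaces are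
unexpected, both sums are positive, which is (c). Conversely (c) gives r ≤ nd and r < |Z|. That (a)
implies (b) is condition 2 for X = ℙⁿ combined with condition 3.

From (c) to (a). A set T ⊆ Z is wanted with the same rank r, with |T| > r, and sparse: |A| ≤ d (rk A
- 1) + 1 for every nonempty A ⊆ T, where rk A is the dimension of the span. Start from a subset B of
Z whose conditions on [I(Q)^m]_d form a basis. It is sparse because a linear space of vector
dimension s ≥ 2 imposes only d (s - 1) + 1 conditions (`finrank_span_powVec_submodule`). The
balancing hypothesis allows one more point to be added without losing sparsity
(`exists_insert_sparse`); if |Z| ≤ nd, then Z itself is sparse.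

Sparsity gives the remaining conditions. By the Rado–Horn theorem, a sparse T imposes independent
conditions on all forms of degree d (`exists_separating_forms`), which is condition 3. For condition
2, an irreducible X imposes, for general Q, at least d (s - 1) + 1 conditions, s being the dimension
of its span: if s ≥ 2, as many as the span itself. This holds in any characteristic because a
polynomial vector field tangent to the hyperplanes dual to the points of X must be proportional to
the Euler field on the span of X (`tangent_field_aligned`). -/

namespace UnexpectedHypersurfaces

/-! ### Matroid combinatorics: Rado, Rado–Horn, and adding a point to a sparse set. -/

section Transversals

variable {K V ι : Type*} [Field K] [AddCommGroup V] [Module K V] [FiniteDimensional K V]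

/-- Rado's theorem for vector spaces: a finite family of finite sets of vectors has a linearly
independent transversal as soon as the union of any `k` of the sets has rank at least `k`. -/
theorem exists_linearIndependent_transversal [DecidableEq ι] [DecidableEq V] (S : Finset ι)
    (A : ι → Finset V)
    (h : ∀ J ⊆ S, J.card ≤ Module.finrank K (Submodule.span K (⋃ i ∈ J, (A i : Set V)))) :
    ∃ c : ι → V, (∀ i ∈ S, c i ∈ A i) ∧ LinearIndepOn K c (S : Set ι) := by
  -- Induction on the total size of the sets. While some set has two elements, one of them can be
  -- discarded without violating the rank condition; once all sets are singletons, the condition for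
  -- J = S is linear independence.
  induction hN : ∑ i ∈ S, (A i).card using Nat.strong_induction_on generalizing A with
  | _ N ih =>
  subst hN
  by_cases hbig : ∃ i ∈ S, 2 ≤ (A i).card
  · obtain ⟨i, hi, hcard⟩ := hbig
    obtain ⟨y, hy, z, hz, hyz⟩ := Finset.one_lt_card.1 hcard
    have key : ∀ y ∈ A i,
        (∀ J ⊆ S, J.card ≤ Module.finrank K (Submodule.span K
          (⋃ k ∈ J, (Function.update A i ((A i).erase y) k : Set V)))) →
        ∃ c : ι → V, (∀ i ∈ S, c i ∈ A i) ∧ LinearIndepOn K c (S : Set ι) := by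
      intro y hy hJ
      obtain ⟨c, hc, hc'⟩ := ih _ (by
        refine Finset.sum_lt_sum (fun k _ => ?_) ⟨i, hi, ?_⟩
        · by_cases hk : k = i
          · subst hk; simp [Finset.card_erase_le]
          · simp [hk]
        · simpa using Finset.card_erase_lt_of_mem hy) _ hJ rfl
      refine ⟨c, fun k hk => ?_, hc'⟩
      have := hc k hk
      by_cases hki : k = i
      · subst hki; simp at this; exact this.2
      · simpa [hki] using this
    by_contra hcon
    -- Only a subfamily that contains i can be spoiled by discarding y; J is that subfamily with i
    -- removed, so that its violated inequality reads rank ≤ |J|.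
    have hfail : ∀ y ∈ A i, ∃ J ⊆ S, i ∉ J ∧ Module.finrank K (Submodule.span K
        (((A i).erase y : Set V) ∪ ⋃ k ∈ J, (A k : Set V))) ≤ J.card := by
      intro y hy
      have := mt (key y hy) hcon
      push Not at this
      obtain ⟨J, hJS, hlt⟩ := this
      have hiJ : i ∈ J := by
        by_contra hiJ
        have : (⋃ k ∈ J, (Function.update A i ((A i).erase y) k : Set V))
            = ⋃ k ∈ J, (A k : Set V) := by
          refine Set.iUnion₂_congr fun k hk => ?_
          have : k ≠ i := fun h => hiJ (h ▸ hk)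
          simp [this]
        rw [this] at hlt
        exact absurd (h J hJS) (not_le.2 hlt)
      refine ⟨J.erase i, (Finset.erase_subset _ _).trans hJS, by simp, ?_⟩
      have hset : (⋃ k ∈ J, (Function.update A i ((A i).erase y) k : Set V))
          = ((A i).erase y : Set V) ∪ ⋃ k ∈ J.erase i, (A k : Set V) := by
        conv_lhs => rw [← Finset.insert_erase hiJ]
        rw [Finset.set_biUnion_insert, Function.update_self, Finset.coe_erase]
        congr 1
        refine Set.iUnion₂_congr fun k hk => ?_
        simp [(Finset.mem_erase.1 hk).1]
      rw [hset] at hlt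
      rw [Finset.card_erase_of_mem hiJ]
      omega
    obtain ⟨J, hJS, hiJ, hJ⟩ := hfail y hy
    obtain ⟨J', hJS', hiJ', hJ'⟩ := hfail z hz
    set P := Submodule.span K (((A i).erase y : Set V) ∪ ⋃ k ∈ J, (A k : Set V)) with hP
    set P' := Submodule.span K (((A i).erase z : Set V) ∪ ⋃ k ∈ J', (A k : Set V)) with hP'
    -- Since y ≠ z, the sum of P and P' contains all of `A i`, while their intersection still
    -- contains the sets indexed by J ∩ J'. The dimension formula then yields |J| + |J'| ≥ |J ∪ J'|
    -- + 1 + |J ∩ J'|, which is absurd.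
    have hsup : (insert i (J ∪ J')).card ≤ Module.finrank K (P ⊔ P' : Submodule K V) := by
      refine (h _ ?_).trans (Submodule.finrank_mono ?_)
      · exact Finset.insert_subset hi (Finset.union_subset hJS hJS')
      · rw [Submodule.span_le]
        intro v hv
        simp only [Finset.mem_insert, Finset.mem_union, Set.mem_iUnion, exists_prop] at hv
        obtain ⟨k, (rfl | hk | hk), hvk⟩ := hv
        · by_cases hvy : v = y
          · subst hvy
            exact Submodule.mem_sup_right (Submodule.subset_span (Or.inl (by simp [hyz, hy])))
          · exact Submodule.mem_sup_left (Submodule.subset_span (Or.inl (by simp_all)))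
        · exact Submodule.mem_sup_left (Submodule.subset_span (Or.inr (by
            simp only [Set.mem_iUnion]; exact ⟨k, hk, hvk⟩)))
        · exact Submodule.mem_sup_right (Submodule.subset_span (Or.inr (by
            simp only [Set.mem_iUnion]; exact ⟨k, hk, hvk⟩)))
    have hinf : (J ∩ J').card ≤ Module.finrank K (P ⊓ P' : Submodule K V) := by
      refine (h _ (Finset.inter_subset_left.trans hJS)).trans (Submodule.finrank_mono ?_)
      rw [Submodule.span_le]
      intro v hv
      simp only [Finset.mem_inter, Set.mem_iUnion, exists_prop] at hv
      obtain ⟨k, ⟨hk, hk'⟩, hvk⟩ := hv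
      exact ⟨Submodule.subset_span (Or.inr (by
            simp only [Set.mem_iUnion]; exact ⟨k, hk, hvk⟩)),
          Submodule.subset_span (Or.inr (by
            simp only [Set.mem_iUnion]; exact ⟨k, hk', hvk⟩))⟩
    have h1 := Submodule.finrank_sup_add_finrank_inf_eq P P'
    have h2 := Finset.card_union_add_card_inter J J'
    rw [Finset.card_insert_of_notMem (by simp [hiJ, hiJ'])] at hsup
    omega
  · push Not at hbig
    have hone : ∀ i ∈ S, ∃ v, A i = {v} := by
      intro i hi
      have h1 := h {i} (by simpa using hi)
      have h2 := hbig i hi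
      rw [← Finset.card_eq_one]
      by_contra hne
      have : A i = ∅ := by
        rw [← Finset.card_eq_zero]; omega
      simp [this] at h1
    choose! c hc using hone
    refine ⟨c, fun i hi => by simp [hc i hi], ?_⟩
    rw [LinearIndepOn, linearIndependent_iff_card_le_finrank_span]
    have := h S subset_rfl
    have hset : (⋃ i ∈ S, (A i : Set V)) = Set.range fun x : (S : Set ι) => c x := by
      ext v
      simp only [Set.mem_iUnion, Set.mem_range, Subtype.exists, exists_prop]
      exact exists_congr fun i => and_congr_right fun hi => by
        simp [hc i hi, eq_comm]
    rw [hset] at this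
    simpa [Set.finrank] using this

/-- The Rado–Horn theorem: a finite family of vectors in which any `k` vectors have rank at least
`k / d` can be partitioned into `d` linearly independent families. -/
theorem exists_coloring_linearIndepOn [DecidableEq ι] {d : ℕ} (hd : 0 < d) (S : Finset ι) (v : ι → V)
    (h : ∀ J ⊆ S, J.card ≤ d * Module.finrank K (Submodule.span K (v '' J))) :
    ∃ c : ι → Fin d, ∀ k, LinearIndepOn K v {i | i ∈ S ∧ c i = k} := by
  classical
  -- Offer d copies of each vector, one in each summand of V^d. A transversal chooses a copy, that
  -- is a colour, and independence in V^d restricts to independence within each colour. The copies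
  -- indexed by J span the d-th power of the span of J, whence the factor d.
  let e : Fin d → V →ₗ[K] (Fin d → V) := fun k => LinearMap.single K (fun _ => V) k
  let A : ι → Finset (Fin d → V) := fun i => Finset.univ.image fun k => e k (v i)
  have hspan : ∀ J : Finset ι, Submodule.span K (⋃ i ∈ J, (A i : Set (Fin d → V)))
      = Submodule.pi Set.univ fun _ => Submodule.span K (v '' J) := by
    intro J
    apply le_antisymm
    · rw [Submodule.span_le]
      intro w hw
      simp only [Set.mem_iUnion, exists_prop] at hw
      obtain ⟨i, hi, hw⟩ := hw
      simp only [A, Finset.coe_image, Finset.coe_univ, Set.image_univ, Set.mem_range] at hw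
      obtain ⟨k, rfl⟩ := hw
      intro l _
      by_cases hl : l = k
      · subst hl
        simpa [e] using Submodule.subset_span (Set.mem_image_of_mem v (by simpa using hi))
      · simp [e, hl]
    · intro w hw
      have : w = ∑ k, e k (w k) := by
        ext k; simp [e, Finset.sum_apply, Pi.single_apply]
      rw [this]
      refine Submodule.sum_mem _ fun k _ => ?_
      have hwk := hw k (Set.mem_univ _)
      have : Submodule.map (e k) (Submodule.span K (v '' J)) ≤
          Submodule.span K (⋃ i ∈ J, (A i : Set (Fin d → V))) := by
        rw [Submodule.map_span, Submodule.span_le]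
        rintro _ ⟨_, ⟨i, hi, rfl⟩, rfl⟩
        refine Submodule.subset_span ?_
        simp only [Set.mem_iUnion]
        exact ⟨i, hi, by simp [A]⟩
      exact this (Submodule.mem_map_of_mem hwk)
  have hpi : ∀ J : Finset ι, Module.finrank K (Submodule.pi Set.univ
      fun _ : Fin d => Submodule.span K (v '' J)) =
      d * Module.finrank K (Submodule.span K (v '' J)) := by
    intro J
    let f : (Fin d → Submodule.span K (v '' (J : Set ι))) →ₗ[K] (Fin d → V) :=
      LinearMap.pi fun k => (Submodule.subtype _) ∘ₗ LinearMap.proj k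
    have hf : Function.Injective f := fun a b hab => by
      ext k; exact congrFun hab k
    have hr : LinearMap.range f = Submodule.pi Set.univ
        fun _ : Fin d => Submodule.span K (v '' J) := by
      ext w; constructor
      · rintro ⟨a, rfl⟩ k _; exact (a k).2
      · intro hw; exact ⟨fun k => ⟨w k, hw k (Set.mem_univ _)⟩, rfl⟩
    rw [← hr, LinearMap.finrank_range_of_inj hf, Module.finrank_pi_fintype]
    simp
  obtain ⟨c, hcA, hc⟩ := exists_linearIndependent_transversal (K := K) S A (by
    intro J hJ
    rw [hspan, hpi]
    exact h J hJ)
  have hex : ∀ i ∈ S, ∃ k, e k (v i) = c i := by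
    intro i hi
    simpa [A] using hcA i hi
  have : Nonempty (Fin d) := ⟨⟨0, hd⟩⟩
  choose! col hcol using hex
  refine ⟨col, fun k => ?_⟩
  have h1 : LinearIndepOn K c {i | i ∈ S ∧ col i = k} := hc.mono fun i hi => hi.1
  have h2 : LinearIndepOn K (fun i => e k (v i)) {i | i ∈ S ∧ col i = k} := by
    refine (linearIndepOn_congr fun i hi => ?_).1 h1
    rw [← hcol i hi.1, hi.2]
  exact LinearIndependent.of_comp (e k) h2

/-- If any `k` of the points of `T` span a space of dimension at least `(k - 1) / d`, then the points
of `T` other than `p` are covered by `d` hyperplanes that avoid `p`. -/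
theorem exists_separating_forms [DecidableEq ι] {d : ℕ} (hd : 0 < d) (T : Finset ι) (v : ι → V)
    (h : ∀ A ⊆ T, A.Nonempty →
      A.card ≤ d * (Module.finrank K (Submodule.span K (v '' A)) - 1) + 1)
    {p : ι} (hp : p ∈ T) (hvp : v p ≠ 0) :
    ∃ f : Fin d → Module.Dual K V, (∀ k, f k (v p) ≠ 0) ∧
      ∀ i ∈ T, i ≠ p → ∃ k, f k (v i) = 0 := by
  let π := (Submodule.span K {v p}).mkQ
  have hπ : π (v p) = 0 := by
    simp [π, Submodule.mem_span_singleton_self]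
  -- Project from `v p`. Counting p uses up the summand + 1 in the hypothesis, and the projection
  -- lowers the rank by at most one, so the Rado–Horn condition holds for the images. A colour class
  -- that stays independent after the projection does not have `v p` in its span, so a linear form
  -- separates them.
  obtain ⟨c, hc⟩ := exists_coloring_linearIndepOn (K := K) hd (T.erase p) (fun i => π (v i)) (by
    intro J hJ
    have hpJ : p ∉ J := fun hpJ => absurd (hJ hpJ) (by simp)
    have h1 := h (insert p J) (Finset.insert_subset hp (hJ.trans (Finset.erase_subset _ _)))
      (by simp)
    rw [Finset.card_insert_of_notMem hpJ] at h1
    set W := Submodule.span K (v '' (insert p J : Finset ι)) with hW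
    have h2 := LinearMap.finrank_range_add_finrank_ker (π.domRestrict W)
    have h3 : LinearMap.range (π.domRestrict W) =
        Submodule.span K ((fun i => π (v i)) '' (J : Set ι)) := by
      rw [LinearMap.range_domRestrict, hW, Submodule.map_span, ← Set.image_comp, Finset.coe_insert,
        Set.image_insert_eq]
      simp only [Function.comp_apply, hπ, Submodule.span_insert_zero]
    have h4 : Module.finrank K (LinearMap.ker (π.domRestrict W)) ≤ 1 := by
      rw [LinearMap.ker_domRestrict, Submodule.ker_mkQ]
      refine le_trans ?_ (finrank_span_singleton (K := K) hvp).le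
      refine LinearMap.finrank_le_finrank_of_injective
        (f := LinearMap.codRestrict (Submodule.span K {v p})
          (W.subtype ∘ₗ Submodule.subtype _) fun x => x.2) ?_
      intro x y hxy
      have := congrArg Subtype.val hxy
      exact Subtype.ext (Subtype.ext this)
    rw [h3] at h2
    have h5 : J.card ≤ d * (Module.finrank K W - 1) := by omega
    exact h5.trans (Nat.mul_le_mul_left _ (by omega)))
  have hsep : ∀ k, v p ∉ Submodule.span K (v '' {i | i ∈ T.erase p ∧ c i = k}) := by
    intro k hmem
    have hk := hc k
    have hk' : LinearIndepOn K v {i | i ∈ T.erase p ∧ c i = k} := LinearIndependent.of_comp π hk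
    rw [Set.image_eq_range] at hmem
    rw [Finsupp.mem_span_range_iff_exists_finsupp] at hmem
    obtain ⟨a, ha⟩ := hmem
    have h0 : a = 0 := by
      refine linearIndependent_iff.1 hk a ?_
      rw [Finsupp.linearCombination_apply]
      have := congrArg π ha
      rw [map_finsuppSum, hπ] at this
      simpa using this
    subst h0
    exact hvp (by simpa using ha.symm)
  choose f hf hf' using fun k => Submodule.exists_le_ker_of_notMem (hsep k)
  refine ⟨f, hf, fun i hi hip => ⟨c i, ?_⟩⟩
  exact hf' (c i) (Submodule.subset_span ⟨i, ⟨Finset.mem_erase.2 ⟨hip, hi⟩, rfl⟩, rfl⟩)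

/-- Submodularity of the rank: the span of the intersection is contained in the intersection of the
spans, possibly strictly. -/
theorem finrank_span_union_add_inter_le [DecidableEq ι] (v : ι → V) (A B : Finset ι) :
    Module.finrank K (Submodule.span K (v '' ↑(A ∪ B))) +
      Module.finrank K (Submodule.span K (v '' ↑(A ∩ B))) ≤
    Module.finrank K (Submodule.span K (v '' A)) + Module.finrank K (Submodule.span K (v '' B)) := by
  rw [← Submodule.finrank_sup_add_finrank_inf_eq (Submodule.span K (v '' (A : Set ι))),
    Finset.coe_union, Set.image_union, Submodule.span_union]
  have : Submodule.span K (v '' ↑(A ∩ B)) ≤ Submodule.span K (v '' A) ⊓ Submodule.span K (v '' B) :=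
    le_inf (Submodule.span_mono (Set.image_mono (by simp)))
      (Submodule.span_mono (Set.image_mono (by simp)))
  exact Nat.add_le_add_left (Submodule.finrank_mono this) _

/-- The combinatorial core of `exists_insert_sparse`, for an abstract rank function and closure
operator. -/
theorem exists_insert_sparse_of_submodular [DecidableEq ι] {d n : ℕ} (hd : 0 < d) (Z : Finset ι)
    (rk : Finset ι → ℕ) (cl : Finset ι → Finset ι)
    (hrk_mono : ∀ {A A' : Finset ι}, A ⊆ A' → rk A ≤ rk A')
    (hrk_sub : ∀ A A' : Finset ι, rk (A ∪ A') + rk (A ∩ A') ≤ rk A + rk A')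
    (hrk_one : ∀ i ∈ Z, rk {i} = 1)
    (hcl_mono : ∀ {A A' : Finset ι}, A ⊆ A' → cl A ⊆ cl A')
    (hcl : ∀ A ⊆ Z, A ⊆ cl A)
    (hcl_rk : ∀ A ⊆ Z, ∀ p ∈ A, rk (A.erase p) = rk A → p ∈ cl (A.erase p))
    (hZ : n * d + 1 ≤ Z.card)
    (hflat : ∀ A ⊆ Z, A.Nonempty → n * ((cl A).card - 1) ≤ (rk A - 1) * (Z.card - 1))
    {B : Finset ι} (hBZ : B ⊆ Z) (hBcard : B.card ≤ n * d)
    (hB : ∀ A ⊆ B, A.Nonempty → A.card ≤ d * (rk A - 1) + 1) :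
    ∃ p ∈ Z, p ∉ B ∧ ∀ A ⊆ insert p B, A.Nonempty → A.card ≤ d * (rk A - 1) + 1 := by
  classical
  have hrk_pos : ∀ A ⊆ Z, A.Nonempty → 1 ≤ rk A := by
    rintro A hA ⟨i, hi⟩
    rw [← hrk_one i (hA hi)]
    exact hrk_mono (by simpa using hi)
  -- Tight sets attain the sparsity bound. By submodularity, two tight subsets of B that meet have a
  -- tight union, so every point of B lies in a largest tight set; singletons are tight, and these
  -- largest sets partition B.
  let Tight : Finset ι → Prop := fun A => A.card = d * (rk A - 1) + 1
  have hunion : ∀ A ⊆ B, ∀ A' ⊆ B, (A ∩ A').Nonempty → Tight A → Tight A' → Tight (A ∪ A') := by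
    intro A hA A' hA' hne h1 h2
    have hneA : A.Nonempty := hne.mono Finset.inter_subset_left
    have hneA' : A'.Nonempty := hne.mono Finset.inter_subset_right
    have e1 := hB _ (Finset.union_subset hA hA') (hneA.mono Finset.subset_union_left)
    have e2 := hB _ (Finset.inter_subset_left.trans hA) hne
    have e3 := hrk_sub A A'
    have e4 := Finset.card_union_add_card_inter A A'
    have p1 := hrk_pos A (hA.trans hBZ) hneA
    have p2 := hrk_pos A' (hA'.trans hBZ) hneA'
    have p3 := hrk_pos (A ∩ A') (Finset.inter_subset_left.trans (hA.trans hBZ)) hne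
    have p4 := hrk_pos (A ∪ A') ((Finset.union_subset hA hA').trans hBZ)
      (hneA.mono Finset.subset_union_left)
    simp only [Tight] at h1 h2 ⊢
    obtain ⟨a, ha⟩ := Nat.exists_eq_add_of_le' p1
    obtain ⟨b, hb⟩ := Nat.exists_eq_add_of_le' p2
    obtain ⟨c, hc⟩ := Nat.exists_eq_add_of_le' p3
    obtain ⟨e, he⟩ := Nat.exists_eq_add_of_le' p4
    rw [ha] at h1 e3
    rw [hb] at h2 e3
    rw [hc] at e2 e3
    rw [he] at e1 e3 ⊢
    simp only [Nat.add_sub_cancel] at *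
    have : d * (e + c) ≤ d * (a + b) := Nat.mul_le_mul_left _ (by omega)
    rw [mul_add, mul_add] at this
    omega
  have hmax : ∀ b ∈ B, ∃ M ⊆ B, b ∈ M ∧ Tight M ∧ ∀ A ⊆ B, b ∈ A → Tight A → A ⊆ M := by
    intro b hb
    obtain ⟨M, hM, hMmax⟩ := Finset.exists_max_image
      (B.powerset.filter fun A => b ∈ A ∧ Tight A) Finset.card ⟨{b}, by
        simp [hb, Tight, hrk_one b (hBZ hb)]⟩
    simp only [Finset.mem_filter, Finset.mem_powerset] at hM hMmax
    refine ⟨M, hM.1, hM.2.1, hM.2.2, fun A hA hbA hAt => ?_⟩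
    have := hMmax (A ∪ M) ⟨Finset.union_subset hA hM.1, by simp [hbA],
      hunion A hA M hM.1 ⟨b, by simp [hbA, hM.2.1]⟩ hAt hM.2.2⟩
    have heq := Finset.eq_of_subset_of_card_le Finset.subset_union_right this
    rw [heq]
    exact Finset.subset_union_left
  choose! M hMB hbM hMt hMmax using hmax
  by_contra hcon
  push Not at hcon
  set 𝒞 := B.image M with h𝒞
  have hdisj : (𝒞 : Set (Finset ι)).PairwiseDisjoint id := by
    intro C hC C' hC' hne
    simp only [h𝒞, Finset.coe_image, Set.mem_image, Finset.mem_coe] at hC hC'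
    obtain ⟨b, hb, rfl⟩ := hC
    obtain ⟨b', hb', rfl⟩ := hC'
    by_contra hnd
    apply hne
    have hmeet : (M b ∩ M b').Nonempty := by
      rwa [Function.onFun, id, id, Finset.disjoint_iff_inter_eq_empty, ← ne_eq,
        ← Finset.nonempty_iff_ne_empty] at hnd
    have ht := hunion _ (hMB b hb) _ (hMB b' hb') hmeet (hMt b hb) (hMt b' hb')
    have hs := Finset.union_subset (hMB b hb) (hMB b' hb')
    refine subset_antisymm ?_ ?_
    · exact Finset.subset_union_left.trans
        (hMmax b' hb' _ hs (Finset.mem_union_right _ (hbM b' hb')) ht)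
    · exact Finset.subset_union_right.trans
        (hMmax b hb _ hs (Finset.mem_union_left _ (hbM b hb)) ht)
  have hcover : B = 𝒞.biUnion id := by
    ext b
    simp only [Finset.mem_biUnion, h𝒞, Finset.mem_image, id]
    constructor
    · intro hb; exact ⟨_, ⟨b, hb, rfl⟩, hbM b hb⟩
    · rintro ⟨_, ⟨b', hb', rfl⟩, hb⟩; exact hMB b' hb' hb
  have hcard : B.card = ∑ C ∈ 𝒞, (d * (rk C - 1) + 1) := by
    conv_lhs => rw [hcover, Finset.card_biUnion hdisj]
    refine Finset.sum_congr rfl fun C hC => ?_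
    obtain ⟨b, hb, rfl⟩ := Finset.mem_image.1 hC
    exact hMt b hb
  -- If p cannot be added, some A containing p violates the bound. Then A without p is tight and has
  -- the same rank as A, so p lies in its closure, hence in the closure of a largest tight set.
  have hZcover : ∀ p ∈ Z, ∃ C ∈ 𝒞, p ∈ cl C := by
    intro p hp
    by_cases hpB : p ∈ B
    · exact ⟨M p, Finset.mem_image_of_mem _ hpB, hcl _ ((hMB p hpB).trans hBZ) (hbM p hpB)⟩
    · obtain ⟨A, hAs, hAne, hA⟩ := hcon p hp hpB
      have hAZ : A ⊆ Z := hAs.trans (Finset.insert_subset hp hBZ)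
      have hpA : p ∈ A := by
        by_contra hpA
        exact absurd (hB A ((Finset.subset_insert_iff_of_notMem hpA).1 hAs) hAne) (not_le.2 hA)
      have hA'B : A.erase p ⊆ B := by rwa [← Finset.subset_insert_iff]
      have hcA := Finset.card_erase_add_one hpA
      have hA'ne : (A.erase p).Nonempty := by
        rw [Finset.nonempty_iff_ne_empty]
        intro h0
        rw [h0] at hcA
        simp only [Finset.card_empty] at hcA
        omega
      have h1 := hB _ hA'B hA'ne
      have h2 := hrk_mono (Finset.erase_subset p A)
      have h3 : d * (rk (A.erase p) - 1) ≤ d * (rk A - 1) :=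
        Nat.mul_le_mul_left _ (by omega)
      have h4 : d * (rk (A.erase p) - 1) = d * (rk A - 1) := by omega
      have h5 := Nat.eq_of_mul_eq_mul_left hd h4
      have p1 := hrk_pos _ (hA'B.trans hBZ) hA'ne
      have h6 : rk (A.erase p) = rk A := by omega
      have ht : Tight (A.erase p) := by simp only [Tight]; omega
      obtain ⟨b, hb⟩ := hA'ne
      refine ⟨M b, Finset.mem_image_of_mem _ (hA'B hb), ?_⟩
      exact hcl_mono (hMmax b (hA'B hb) _ hA'B hb ht) (hcl_rk A hAZ p hpA h6)
  have hZle : Z.card ≤ ∑ C ∈ 𝒞, (cl C).card := by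
    refine le_trans (Finset.card_le_card fun p hp => ?_) Finset.card_biUnion_le
    obtain ⟨C, hC, hpC⟩ := hZcover p hp
    exact Finset.mem_biUnion.2 ⟨C, hC, hpC⟩
  have hstep : ∀ C ∈ 𝒞, n * (cl C).card ≤
      (rk C - 1) * (Z.card - 1) + n := by
    intro C hC
    obtain ⟨b, hb, rfl⟩ := Finset.mem_image.1 hC
    have := hflat (M b) ((hMB b hb).trans hBZ) ⟨b, hbM b hb⟩
    rw [Nat.mul_sub, mul_one] at this
    omega
  have hsum : n * Z.card ≤ (∑ C ∈ 𝒞, (rk C - 1)) * (Z.card - 1) + 𝒞.card * n := by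
    refine (Nat.mul_le_mul_left n hZle).trans ?_
    rw [Finset.mul_sum]
    refine (Finset.sum_le_sum hstep).trans ?_
    rw [Finset.sum_add_distrib, Finset.sum_mul]
    simp
  rw [Finset.sum_add_distrib, ← Finset.mul_sum] at hcard
  simp only [Finset.sum_const, smul_eq_mul, mul_one] at hcard
  set D := ∑ C ∈ 𝒞, (rk C - 1)
  set k := 𝒞.card
  obtain ⟨z, hz⟩ : ∃ z, Z.card = z + 1 := ⟨Z.card - 1, by omega⟩
  rw [hz] at hsum hZ
  simp only [Nat.add_sub_cancel] at hsum
  rw [hcard] at hBcard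
  have hk : 1 ≤ k := by
    obtain ⟨p, hp⟩ : Z.Nonempty := Finset.card_pos.1 (by omega)
    obtain ⟨C, hC, -⟩ := hZcover p hp
    exact Finset.card_pos.2 ⟨C, hC⟩
  -- Here |B| = dD + k with k ≥ 1 blocks, and |B| ≤ nd.
  have hDn : D < n := by
    by_contra hge
    have := Nat.mul_le_mul_right d (not_lt.1 hge)
    rw [mul_comm D d] at this
    omega
  -- Write n = D + c + 1 and z = |Z| - 1. The bound on |B| gives k ≤ (c + 1)d, the covering of Z by
  -- flats gives (c + 1)z + n ≤ kn, and z ≥ nd gives kn ≤ (c + 1)z. Since n > 0, this is a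
  -- contradiction.
  obtain ⟨c, rfl⟩ := Nat.exists_eq_add_of_lt hDn
  have hzc : (D + c + 1) * d ≤ z := by omega
  have h1 : k ≤ (c + 1) * d := by
    have : (D + c + 1) * d = d * D + (c + 1) * d := by ring
    omega
  have h2 : (c + 1) * z + (D + c + 1) ≤ k * (D + c + 1) := by
    have e1 : (D + c + 1) * (z + 1) = D * z + ((c + 1) * z + (D + c + 1)) := by ring
    omega
  have h3 : k * (D + c + 1) ≤ (c + 1) * z := by
    calc k * (D + c + 1) ≤ (c + 1) * d * (D + c + 1) := Nat.mul_le_mul_right _ h1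
      _ = (c + 1) * ((D + c + 1) * d) := by ring
      _ ≤ (c + 1) * z := Nat.mul_le_mul_left _ hzc
  omega

open Classical in
/-- Let `Z` be a finite family of vectors such that every flat of rank `r` contains at most
`1 + (r - 1) (|Z| - 1) / n` members of `Z`, and let `B ⊆ Z` have at most `n d ≤ |Z| - 1` elements.
If the subsets `A` of `B` satisfy `|A| ≤ d (rk A - 1) + 1`, then this remains true after adding a
suitable element of `Z` to `B`. -/
theorem exists_insert_sparse {d n : ℕ} (hd : 0 < d) (Z : Finset ι) (v : ι → V)
    (hv : ∀ i ∈ Z, v i ≠ 0) (hZ : n * d + 1 ≤ Z.card)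
    (hflat : ∀ A ⊆ Z, A.Nonempty → n * ({i ∈ Z | v i ∈ Submodule.span K (v '' A)}.card - 1) ≤
      (Module.finrank K (Submodule.span K (v '' A)) - 1) * (Z.card - 1))
    {B : Finset ι} (hBZ : B ⊆ Z) (hBcard : B.card ≤ n * d)
    (hB : ∀ A ⊆ B, A.Nonempty →
      A.card ≤ d * (Module.finrank K (Submodule.span K (v '' A)) - 1) + 1) :
    ∃ p ∈ Z, p ∉ B ∧ ∀ A ⊆ insert p B, A.Nonempty →
      A.card ≤ d * (Module.finrank K (Submodule.span K (v '' A)) - 1) + 1 := by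
  have hmono : ∀ {A A' : Finset ι}, A ⊆ A' →
      Submodule.span K (v '' (A : Set ι)) ≤ Submodule.span K (v '' A') := fun h =>
    Submodule.span_mono (Set.image_mono (by exact_mod_cast h))
  refine exists_insert_sparse_of_submodular hd Z
    (fun A => Module.finrank K (Submodule.span K (v '' A)))
    (fun A => {i ∈ Z | v i ∈ Submodule.span K (v '' A)})
    (fun h => Submodule.finrank_mono (hmono h)) (finrank_span_union_add_inter_le v) ?_ ?_ ?_ ?_
    hZ hflat hBZ hBcard hB
  · intro i hi
    rw [Finset.coe_singleton, Set.image_singleton]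
    exact finrank_span_singleton (hv i hi)
  · intro A A' h i hi
    rw [Finset.mem_filter] at hi ⊢
    exact ⟨hi.1, hmono h hi.2⟩
  · intro A hA i hi
    exact Finset.mem_filter.2 ⟨hA hi, Submodule.subset_span ⟨i, hi, rfl⟩⟩
  · intro A hA p hp h
    have := Submodule.eq_of_le_of_finrank_eq (hmono (Finset.erase_subset p A)) h
    refine Finset.mem_filter.2 ⟨hA hp, ?_⟩
    rw [this]
    exact Submodule.subset_span ⟨p, hp, rfl⟩

end Transversals
end UnexpectedHypersurfaces

namespace UnexpectedHypersurfaces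

/-! ### Power vectors: evaluation of the forms of degree m + 1 with multiplicity m along Q. -/

section PowerVectors

/-- The vector with entries `(u₀·x) ^ j * (u₁·x) ^ (m - j) * x_i`. -/
def powVec {A : Type*} [CommRing A] {n : ℕ} (m : ℕ) (u : Fin 2 → Fin (n + 1) → A)
    (x : Fin (n + 1) → A) : Fin (m + 1) × Fin (n + 1) → A :=
  fun p => (u 0 ⬝ᵥ x) ^ (p.1 : ℕ) * (u 1 ⬝ᵥ x) ^ (m - p.1) * x p.2

variable {K : Type*} [Field K] {n : ℕ}

/-- The linear form with coefficient vector `w`. -/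
noncomputable def linForm (w : Vec K n) : Poly K n := ∑ i, C (w i) * X i

@[simp] theorem eval_linForm (w x : Vec K n) : eval x (linForm w) = w ⬝ᵥ x := by
  simp [linForm, dotProduct]

theorem linForm_isHomogeneous (w : Vec K n) : (linForm w).IsHomogeneous 1 :=
  IsHomogeneous.sum _ _ _ fun i _ => by simpa using isHomogeneous_C_mul_X (w i) i

/-- The form `∑ g_{j i} (u₀·X) ^ j (u₁·X) ^ (m - j) X_i`. -/
noncomputable def powForm (m : ℕ) (u : Fin 2 → Vec K n) :
    (Fin (m + 1) × Fin (n + 1) → K) →ₗ[K] Poly K n :=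
  Fintype.linearCombination K fun p =>
    linForm (u 0) ^ (p.1 : ℕ) * linForm (u 1) ^ (m - p.1) * X p.2

theorem eval_powForm (m : ℕ) (u : Fin 2 → Vec K n) (g) (x : Vec K n) :
    eval x (powForm m u g) = g ⬝ᵥ powVec m u x := by
  simp [powForm, Fintype.linearCombination_apply, powVec, dotProduct, smul_eval]

theorem powForm_isHomogeneous (m : ℕ) (u : Fin 2 → Vec K n) (g) :
    (powForm m u g).IsHomogeneous (m + 1) := by
  rw [powForm, Fintype.linearCombination_apply]
  refine IsHomogeneous.sum _ _ _ fun p _ => ?_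
  rw [smul_eq_C_mul]
  refine IsHomogeneous.C_mul ?_ _
  have h1 := (linForm_isHomogeneous (u 0)).pow (p.1 : ℕ)
  have h2 := (linForm_isHomogeneous (u 1)).pow (m - p.1 : ℕ)
  have := (h1.mul h2).mul (isHomogeneous_X K p.2)
  convert this using 1
  have := p.1.2
  omega

/-- A linear subspace is irreducible. -/
theorem eval_eq_zero_or_of_mul_on_submodule [Infinite K] (H : Submodule K (Vec K n)) (f g : Poly K n)
    (h : ∀ x ∈ H, eval x f * eval x g = 0) :
    (∀ x ∈ H, eval x f = 0) ∨ ∀ x ∈ H, eval x g = 0 := by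
  -- Parametrising H by a basis reduces the claim to the absence of zero divisors in a polynomial
  -- ring, where over an infinite field a polynomial is determined by its values.
  let b := Module.finBasis K H
  let φ : Poly K n →ₐ[K] MvPolynomial (Fin (Module.finrank K H)) K :=
    aeval fun i => ∑ k, C ((b k : Vec K n) i) * X k
  have hφ : ∀ c f, eval c (φ f) = eval ((∑ k, c k • b k : H) : Vec K n) f := by
    intro c f
    have : (eval c : _ →+* K).comp (φ : _ →+* _) =
        (eval ((∑ k, c k • b k : H) : Vec K n) : Poly K n →+* K) := by
      refine MvPolynomial.ringHom_ext (fun r => ?_) fun i => ?_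
      · simp [φ]
      · simp [φ, Finset.sum_apply, mul_comm]
    exact RingHom.congr_fun this f
  have hx : ∀ x ∈ H, ∃ c : Fin (Module.finrank K H) → K, ((∑ k, c k • b k : H) : Vec K n) = x :=
    fun x hx => ⟨b.repr ⟨x, hx⟩, by rw [b.sum_repr]⟩
  have hmul : φ f * φ g = 0 := by
    refine MvPolynomial.funext fun c => ?_
    rw [map_mul, hφ, hφ, map_zero]
    exact h _ (Submodule.coe_mem _)
  rcases mul_eq_zero.1 hmul with h0 | h0
  · left; intro x hxH
    obtain ⟨c, rfl⟩ := hx x hxH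
    rw [← hφ, h0, map_zero]
  · right; intro x hxH
    obtain ⟨c, rfl⟩ := hx x hxH
    rw [← hφ, h0, map_zero]

theorem dual_eq_dotProduct {ι : Type*} [Fintype ι] [DecidableEq ι] (f : Module.Dual K (ι → K)) :
    ∃ g : ι → K, ∀ x, f x = g ⬝ᵥ x := by
  refine ⟨fun i => f (Pi.single i 1), fun x => ?_⟩
  conv_lhs => rw [pi_eq_sum_univ' x]
  rw [map_sum, dotProduct]
  exact Finset.sum_congr rfl fun i _ => by
    rw [map_smul, smul_eq_mul, mul_comm]

/-- Membership in a span is tested by the functionals that vanish on the generators. -/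
theorem mem_span_of_forall_dotProduct {ι : Type*} [Fintype ι] [DecidableEq ι] {S : Set (ι → K)}
    {y : ι → K} (h : ∀ g : ι → K, (∀ x ∈ S, g ⬝ᵥ x = 0) → g ⬝ᵥ y = 0) : y ∈ Submodule.span K S := by
  by_contra hy
  obtain ⟨f, hf, hS⟩ := Submodule.exists_le_ker_of_notMem hy
  obtain ⟨g, hg⟩ := dual_eq_dotProduct f
  exact hf (by
    rw [hg]
    exact h g fun x hx => by rw [← hg]; exact hS (Submodule.subset_span hx))

/-- The linear form `x ↦ w·x`. -/
def dotForm (w : Vec K n) : Module.Dual K (Vec K n) := dotProductBilin K K w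

@[simp] theorem dotForm_apply (w x : Vec K n) : dotForm w x = w ⬝ᵥ x := rfl

theorem finrank_map_add_finrank_inf_ker {V V' : Type*} [AddCommGroup V] [Module K V]
    [AddCommGroup V'] [Module K V'] (W : Submodule K V) [FiniteDimensional K W] (f : V →ₗ[K] V') :
    Module.finrank K (W.map f) + Module.finrank K (W ⊓ LinearMap.ker f : Submodule K V) =
      Module.finrank K W := by
  rw [← LinearMap.finrank_range_add_finrank_ker (f.domRestrict W), LinearMap.range_domRestrict,
    LinearMap.ker_domRestrict, ← Submodule.map_comap_subtype, Submodule.finrank_map_subtype_eq]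

theorem finrank_inf_ker_add_one (H : Submodule K (Vec K n)) (f : Module.Dual K (Vec K n))
    {b : Vec K n} (hb : b ∈ H) (hfb : f b ≠ 0) :
    Module.finrank K (H ⊓ LinearMap.ker f : Submodule K (Vec K n)) + 1 = Module.finrank K H := by
  have h1 := finrank_map_add_finrank_inf_ker H f
  have h2 : H.map f = ⊤ := by
    rw [← LinearMap.range_domRestrict]
    refine LinearMap.range_eq_top.2 (LinearMap.surjective ?_)
    intro h0
    exact hfb (by simpa using LinearMap.congr_fun h0 ⟨b, hb⟩)
  rw [h2, finrank_top, Module.finrank_self] at h1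
  omega

/-- The power vectors of the points of a linear subspace of dimension `r` on which `u₀` and `u₁` are
independent span a space of dimension `(m + 1) r - m`. -/
theorem finrank_span_powVec_submodule [Infinite K] (m : ℕ) (u : Fin 2 → Vec K n)
    (H : Submodule K (Vec K n)) {b₀ b₁ : Vec K n} (hb₀ : b₀ ∈ H) (hb₁ : b₁ ∈ H)
    (h00 : u 0 ⬝ᵥ b₀ = 1) (h10 : u 1 ⬝ᵥ b₀ = 0) (h11 : u 1 ⬝ᵥ b₁ = 1) :
    Module.finrank K (Submodule.span K (powVec m u '' (H : Set (Vec K n)))) + m =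
      (m + 1) * Module.finrank K H := by
  induction m with
  | zero =>
    let f : Vec K n →ₗ[K] (Fin (0 + 1) × Fin (n + 1) → K) :=
      LinearMap.pi fun p => LinearMap.proj p.2
    have hf : Function.Injective f := fun x y hxy => by
      ext i; exact congrFun hxy (0, i)
    have : powVec 0 u = f := by
      ext x p
      simp [powVec, f]
    rw [this, ← Submodule.map_span, Submodule.span_eq, ← finrank_map_add_finrank_inf_ker H f,
      LinearMap.ker_eq_bot.2 hf]
    simp
  | succ m ih =>
    -- Dropping the last block turns a power vector for m + 1 into u₁·x times the one for m; the
    -- factor does not change the span, because H is irreducible and u₁ is nonzero on it. The kernel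
    -- of the projection is a copy of H ∩ ker u₁ in the last block, so the rank grows by dim H - 1.
    let pr : (Fin (m + 1 + 1) × Fin (n + 1) → K) →ₗ[K] (Fin (m + 1) × Fin (n + 1) → K) :=
      LinearMap.pi fun p => LinearMap.proj (p.1.castSucc, p.2)
    let last : Vec K n →ₗ[K] (Fin (m + 1 + 1) × Fin (n + 1) → K) :=
      LinearMap.pi fun p => if p.1 = Fin.last _ then LinearMap.proj p.2 else 0
    have hlast : Function.Injective last := fun x y hxy => by
      ext i; simpa [last] using congrFun hxy (Fin.last _, i)
    set Y := Submodule.span K (powVec (m + 1) u '' (H : Set (Vec K n))) with hY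
    have hpr : ∀ x, pr (powVec (m + 1) u x) = (u 1 ⬝ᵥ x) • powVec m u x := by
      intro x
      ext p
      simp only [pr, LinearMap.pi_apply, LinearMap.proj_apply, powVec, Fin.val_castSucc,
        Pi.smul_apply, smul_eq_mul]
      have : m + 1 - (p.1 : ℕ) = (m - p.1) + 1 := by omega
      rw [this, pow_succ]
      ring
    have hvlast : ∀ x, u 1 ⬝ᵥ x = 0 → powVec (m + 1) u x = last ((u 0 ⬝ᵥ x) ^ (m + 1) • x) := by
      intro x hx
      ext p
      by_cases hp : p.1 = Fin.last _
      · simp [powVec, last, hp]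
      · have : m + 1 - (p.1 : ℕ) ≠ 0 := by
          have := Fin.val_lt_last hp
          omega
        simp [powVec, last, hp, hx, this]
    have hmap : Submodule.map pr Y = Submodule.span K (powVec m u '' (H : Set (Vec K n))) := by
      rw [hY, Submodule.map_span]
      apply le_antisymm
      · rw [Submodule.span_le]
        rintro _ ⟨_, ⟨x, hx, rfl⟩, rfl⟩
        rw [hpr]
        exact Submodule.smul_mem _ _ (Submodule.subset_span ⟨x, hx, rfl⟩)
      · rw [Submodule.span_le]
        rintro _ ⟨x, hx, rfl⟩
        refine mem_span_of_forall_dotProduct fun g hg => ?_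
        rw [← eval_powForm]
        refine (eval_eq_zero_or_of_mul_on_submodule H (powForm m u g) (linForm (u 1))
          fun z hz => ?_).resolve_right (fun h => ?_) x hx
        · have := hg _ ⟨_, ⟨z, hz, rfl⟩, rfl⟩
          rw [hpr, dotProduct_smul, smul_eq_mul] at this
          rw [eval_powForm, eval_linForm, mul_comm]
          exact this
        · have := h b₁ hb₁
          rw [eval_linForm, h11] at this
          exact one_ne_zero this
    have hker : Y ⊓ LinearMap.ker pr = Submodule.map last (H ⊓ LinearMap.ker (dotForm (u 1))) := by
      apply le_antisymm
      · rintro y ⟨hy, hy0⟩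
        -- A linear relation shared by all power vectors: u₁ applied to the last block equals u₀
        -- applied to the block before it. If the earlier blocks vanish, the last one is killed by
        -- u₁.
        have hyH : ∀ j, (fun i => y (j, i)) ∈ H ∧ u 1 ⬝ᵥ (fun i => y (Fin.last _, i)) =
            u 0 ⬝ᵥ (fun i => y ((Fin.last m).castSucc, i)) := by
          intro j
          clear hy0
          induction hy using Submodule.span_induction with
          | mem y hy =>
            obtain ⟨x, hx, rfl⟩ := hy
            refine ⟨H.smul_mem ((u 0 ⬝ᵥ x) ^ (j : ℕ) * (u 1 ⬝ᵥ x) ^ (m + 1 - j)) hx, ?_⟩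
            have e : ∀ j, (fun i => powVec (m + 1) u x (j, i)) =
                ((u 0 ⬝ᵥ x) ^ (j : ℕ) * (u 1 ⬝ᵥ x) ^ (m + 1 - j)) • x := fun j => rfl
            rw [e, e, dotProduct_smul, dotProduct_smul]
            simp [pow_succ]
            ring
          | zero => exact ⟨H.zero_mem, by simp [dotProduct]⟩
          | add y z _ _ hy hz =>
            refine ⟨H.add_mem hy.1 hz.1, ?_⟩
            have := congrArg₂ (· + ·) hy.2 hz.2
            simpa only [← dotProduct_add] using! this
          | smul c y _ hy =>
            refine ⟨H.smul_mem c hy.1, ?_⟩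
            have := congrArg (c • ·) hy.2
            simpa only [← dotProduct_smul] using! this
        have hy0' : ∀ (j : Fin (m + 1)) i, y (j.castSucc, i) = 0 := fun j i =>
          congrFun (LinearMap.mem_ker.1 hy0) (j, i)
        refine ⟨fun i => y (Fin.last _, i), ⟨(hyH _).1, ?_⟩, ?_⟩
        · have := (hyH 0).2
          simpa [hy0', dotProduct] using this
        · ext ⟨j, i⟩
          refine Fin.lastCases ?_ (fun j => ?_) j
          · simp [last]
          · simp [last, hy0', (Fin.castSucc_lt_last j).ne]
      · rintro _ ⟨z, ⟨hz, hz0⟩, rfl⟩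
        have hz0' : u 1 ⬝ᵥ z = 0 := hz0
        have hin : ∀ z ∈ H, u 1 ⬝ᵥ z = 0 → u 0 ⬝ᵥ z ≠ 0 → last z ∈ Y := by
          intro z hz h1 h0
          have : powVec (m + 1) u z ∈ Y := Submodule.subset_span ⟨z, hz, rfl⟩
          rw [hvlast z h1, map_smul] at this
          exact (Submodule.smul_mem_iff _ (pow_ne_zero _ h0)).1 this
        refine ⟨?_, ?_⟩
        · by_cases h0 : u 0 ⬝ᵥ z = 0
          · have e1 := hin (z + b₀) (H.add_mem hz hb₀) (by simp [hz0', h10]) (by simp [h0, h00])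
            have e2 := hin b₀ hb₀ h10 (by simp [h00])
            have := Y.sub_mem e1 e2
            simpa using this
          · exact hin z hz hz0' h0
        · rw [SetLike.mem_coe, LinearMap.mem_ker]
          ext p
          simp [pr, last, (Fin.castSucc_lt_last p.1).ne]
    have h1 := finrank_map_add_finrank_inf_ker Y pr
    have h2 := finrank_map_add_finrank_inf_ker (H ⊓ LinearMap.ker (dotForm (u 1))) last
    have h3 := finrank_inf_ker_add_one H (dotForm (u 1)) hb₁ (by simp [h11])
    rw [LinearMap.ker_eq_bot.2 hlast, inf_bot_eq, finrank_bot] at h2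
    rw [hmap, hker] at h1
    rw [add_mul, ← ih]
    omega

end PowerVectors
end UnexpectedHypersurfaces

namespace UnexpectedHypersurfaces

/-! ### Rank over the function field versus rank at a general point. -/

section GenericRank

/-- A right inverse witnesses independence by a matrix identity, and such an identity survives
clearing denominators and specialisation. -/
theorem LinearIndependent.exists_dual_family {E : Type*} [Field E] {κ ι : Type*} [Fintype κ]
    [DecidableEq κ] [Fintype ι] [DecidableEq ι] {f : κ → ι → E} (hf : LinearIndependent E f) :
    ∃ B : Matrix ι κ E, Matrix.of f * B = 1 := by
  let φ : (κ → E) →ₗ[E] (ι → E) := Fintype.linearCombination E f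
  have hφ : LinearMap.ker φ = ⊥ := by
    rw [LinearMap.ker_eq_bot]
    exact linearIndependent_iff_injective_fintypeLinearCombination.1 hf
  obtain ⟨g, hg⟩ := φ.exists_leftInverse_of_injective hφ
  refine ⟨Matrix.of fun p j => g (Pi.single p 1) j, ?_⟩
  ext i j
  have h1 : g (f i) = Pi.single i 1 := by
    have := LinearMap.congr_fun hg (Pi.single i 1)
    simpa [φ, Fintype.linearCombination_apply] using this
  have h2 : f i = ∑ p, f i p • (Pi.single p 1 : ι → E) := by
    ext q; simp [Finset.sum_apply, Pi.single_apply]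
  rw [Matrix.mul_apply, Matrix.one_apply]
  have h3 := congrFun h1 j
  rw [h2, map_sum] at h3
  simp only [map_smul, Finset.sum_apply, Pi.smul_apply, smul_eq_mul] at h3
  simp only [Matrix.of_apply]
  rw [h3, Pi.single_apply]
  simp [eq_comm]

theorem linearIndependent_of_mul_eq {E : Type*} [CommRing E] [IsDomain E] {κ ι : Type*} [Fintype κ]
    [DecidableEq κ] [Fintype ι] (f : κ → ι → E) (B : Matrix ι κ E)
    (h : (Matrix.of f * B).det ≠ 0) : LinearIndependent E f := by
  rw [Fintype.linearIndependent_iff]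
  intro c hc
  have h1 : Matrix.vecMul c (Matrix.of f) = 0 := by
    ext p
    simpa [Matrix.vecMul, dotProduct, Finset.sum_apply] using congrFun hc p
  have h2 : Matrix.vecMul c (Matrix.of f * B) = 0 := by
    rw [← Matrix.vecMul_vecMul, h1, Matrix.zero_vecMul]
  exact congrFun (Matrix.eq_zero_of_vecMul_eq_zero h h2)

variable {K : Type*} [Field K] {σ : Type*} {ι : Type*} [Fintype ι] [DecidableEq ι]

/-- Vectors of polynomials that are independent at one point are generically independent. -/
theorem linearIndependent_fractionRing_of_eval {k : ℕ} (f : Fin k → ι → MvPolynomial σ K) (u : σ → K)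
    (h : LinearIndependent K fun i p => eval u (f i p)) :
    LinearIndependent (FractionRing (MvPolynomial σ K))
      fun i p => algebraMap (MvPolynomial σ K) (FractionRing (MvPolynomial σ K)) (f i p) := by
  obtain ⟨B, hB⟩ := h.exists_dual_family
  -- With the right inverse taken at the point u as a constant matrix, the determinant of the
  -- product is a polynomial whose value at u is 1.
  refine linearIndependent_of_mul_eq _ (B.map fun b =>
    algebraMap (MvPolynomial σ K) (FractionRing (MvPolynomial σ K)) (C b)) ?_
  let P : Matrix (Fin k) ι (MvPolynomial σ K) := Matrix.of f
  let Q : Matrix ι (Fin k) (MvPolynomial σ K) := B.map C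
  have h1 : (P * Q).det ≠ 0 := by
    intro h0
    have := congrArg (eval u) h0
    rw [RingHom.map_det, map_zero, RingHom.mapMatrix_apply, Matrix.map_mul] at this
    have e1 : P.map (eval u) = Matrix.of fun i p => eval u (f i p) := rfl
    have e2 : Q.map (eval u) = B := by ext; simp [Q]
    rw [e1, e2, hB, Matrix.det_one] at this
    exact one_ne_zero this
  intro h0
  apply h1
  apply IsFractionRing.injective (MvPolynomial σ K) (FractionRing (MvPolynomial σ K))
  rw [RingHom.map_det, map_zero, RingHom.mapMatrix_apply, Matrix.map_mul]
  exact h0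

/-- Generically independent vectors of polynomials are independent at a general point. -/
theorem exists_forall_eval_linearIndependent {k : ℕ} (f : Fin k → ι → MvPolynomial σ K)
    (h : LinearIndependent (FractionRing (MvPolynomial σ K))
      fun i p => algebraMap (MvPolynomial σ K) (FractionRing (MvPolynomial σ K)) (f i p)) :
    ∃ G : MvPolynomial σ K, G ≠ 0 ∧ ∀ u, eval u G ≠ 0 →
      LinearIndependent K fun i p => eval u (f i p) := by
  obtain ⟨B, hB⟩ := h.exists_dual_family
  obtain ⟨b, hb⟩ := IsLocalization.exist_integer_multiples_of_finite
    (nonZeroDivisors (MvPolynomial σ K)) fun p : ι × Fin k => B p.1 p.2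
  choose B' hB' using hb
  have hmul : Matrix.of f * Matrix.of (fun p j => B' (p, j)) = (b : MvPolynomial σ K) • 1 := by
    ext1 i j
    apply IsFractionRing.injective (MvPolynomial σ K) (FractionRing (MvPolynomial σ K))
    have := congrFun (congrFun hB i) j
    rw [Matrix.mul_apply] at this ⊢
    rw [map_sum, Matrix.smul_apply, smul_eq_mul, map_mul]
    have e : algebraMap (MvPolynomial σ K) (FractionRing (MvPolynomial σ K))
        ((1 : Matrix (Fin k) (Fin k) (MvPolynomial σ K)) i j) =
        (1 : Matrix (Fin k) (Fin k) (FractionRing (MvPolynomial σ K))) i j := by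
      rw [Matrix.one_apply, Matrix.one_apply]; split_ifs <;> simp
    rw [e, ← this, Finset.mul_sum]
    refine Finset.sum_congr rfl fun p _ => ?_
    have := hB' (p, j)
    rw [Algebra.smul_def] at this
    rw [map_mul, Matrix.of_apply, Matrix.of_apply, Matrix.of_apply, this]
    ring
  -- The common denominator b of a generic right inverse is the required polynomial: after
  -- specialisation the product of the two matrices is b(u) times the identity.
  refine ⟨b, nonZeroDivisors.coe_ne_zero b, fun u hu => ?_⟩
  refine linearIndependent_of_mul_eq _ ((Matrix.of (fun p j => B' (p, j))).map (eval u)) ?_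
  have e1 : (Matrix.of f).map (eval u) = Matrix.of fun i p => eval u (f i p) := rfl
  rw [← e1, ← Matrix.map_mul, hmul]
  have e2 : (((b : MvPolynomial σ K) • (1 : Matrix (Fin k) (Fin k) (MvPolynomial σ K))).map
      (eval u)) = eval u (b : MvPolynomial σ K) • (1 : Matrix (Fin k) (Fin k) K) := by
    ext i j
    rw [Matrix.map_apply, Matrix.smul_apply, Matrix.smul_apply, smul_eq_mul, map_mul, smul_eq_mul,
      Matrix.one_apply, Matrix.one_apply]
    split_ifs <;> simp
  rw [e2, Matrix.det_smul, Matrix.det_one, mul_one]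
  exact pow_ne_zero _ hu

/-- The rank of a family of vectors of polynomials at a general point is the generic rank. -/
theorem exists_forall_eval_finrank_eq {I : Type*} (f : I → ι → MvPolynomial σ K) (S : Set I) :
    ∃ G : MvPolynomial σ K, G ≠ 0 ∧ ∀ u, eval u G ≠ 0 →
      Module.finrank K (Submodule.span K ((fun i p => eval u (f i p)) '' S)) =
      Module.finrank (FractionRing (MvPolynomial σ K))
        (Submodule.span (FractionRing (MvPolynomial σ K)) ((fun i p =>
          algebraMap (MvPolynomial σ K) (FractionRing (MvPolynomial σ K)) (f i p)) '' S)) := by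
  obtain ⟨g, hg, -, hLI⟩ := Submodule.exists_fun_fin_finrank_span_eq
    (FractionRing (MvPolynomial σ K)) ((fun i p =>
      algebraMap (MvPolynomial σ K) (FractionRing (MvPolynomial σ K)) (f i p)) '' S)
  choose c hcS hc using hg
  obtain ⟨G, hG, hGu⟩ := exists_forall_eval_linearIndependent (fun k => f (c k)) (by
    have : g = fun k p => _ := funext fun k => (hc k).symm
    rwa [this] at hLI)
  refine ⟨G, hG, fun u hu => le_antisymm ?_ ?_⟩
  · obtain ⟨g', hg', -, hLI'⟩ := Submodule.exists_fun_fin_finrank_span_eq K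
      ((fun i p => eval u (f i p)) '' S)
    choose c' hcS' hc' using hg'
    have := linearIndependent_fractionRing_of_eval (fun k => f (c' k)) u (by
      have : g' = fun k p => _ := funext fun k => (hc' k).symm
      rwa [this] at hLI')
    calc _ = Fintype.card (Fin _) := (Fintype.card_fin _).symm
      _ = _ := (finrank_span_eq_card this).symm
      _ ≤ _ := Submodule.finrank_mono (Submodule.span_mono (by
        rintro _ ⟨k, rfl⟩; exact ⟨c' k, hcS' k, rfl⟩))
  · calc _ = Fintype.card (Fin _) := (Fintype.card_fin _).symm
      _ = _ := (finrank_span_eq_card (hGu u hu)).symm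
      _ ≤ _ := Submodule.finrank_mono (Submodule.span_mono (by
        rintro _ ⟨k, rfl⟩; exact ⟨c k, hcS k, rfl⟩))

end GenericRank

/-! ### Vector fields tangent to many hyperplanes. -/

section Aligned

variable {K : Type*} [Field K] {n : ℕ}

/-- Finitely many vectors outside a subspace `N` are simultaneously non-orthogonal to some vector of
the orthogonal complement of `N`. -/
theorem exists_orthogonal_avoiding [Infinite K] (N : Submodule K (Vec K n)) (S : Finset (Vec K n))
    (hS : ∀ z ∈ S, z ∉ N) : ∃ v : Vec K n, (∀ x ∈ N, v ⬝ᵥ x = 0) ∧ ∀ z ∈ S, v ⬝ᵥ z ≠ 0 := by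
  let U : Submodule K (Vec K n) :=
    { carrier := {v | ∀ x ∈ N, v ⬝ᵥ x = 0}
      zero_mem' := fun x _ => by simp
      add_mem' := fun {a b} ha hb x hx => by rw [add_dotProduct, ha x hx, hb x hx, add_zero]
      smul_mem' := fun c a ha x hx => by rw [smul_dotProduct, ha x hx, smul_zero] }
  by_contra hcon
  push Not at hcon
  obtain ⟨⟨z, hz⟩, htop⟩ := Subspace.exists_eq_top_of_iUnion_eq_univ
    (p := fun z : S => LinearMap.ker ((dotForm (z : Vec K n)).domRestrict U)) (by
      rw [Set.eq_univ_iff_forall]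
      rintro ⟨v, hv⟩
      obtain ⟨z, hz, h0⟩ := hcon v hv
      refine Set.mem_iUnion.2 ⟨⟨z, hz⟩, ?_⟩
      simp [dotProduct_comm z v, h0])
  refine hS z hz ?_
  rw [← Submodule.span_eq N]
  refine mem_span_of_forall_dotProduct fun g hg => ?_
  have : (⟨g, hg⟩ : U) ∈ LinearMap.ker ((dotForm z).domRestrict U) := by
    rw [htop]; trivial
  simpa [dotProduct_comm z g] using this

theorem eval_line (f : Poly K n) (w v : Vec K n) (r : K) :
    (aeval (fun i => Polynomial.C (w i) + Polynomial.C (v i) * Polynomial.X) f :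
      Polynomial K).eval r = eval (w + r • v) f := by
  have : (Polynomial.evalRingHom r).comp ((aeval fun i =>
      Polynomial.C (w i) + Polynomial.C (v i) * Polynomial.X : Poly K n →ₐ[K] Polynomial K) :
        Poly K n →+* Polynomial K) = eval (w + r • v) := by
    refine MvPolynomial.ringHom_ext (fun c => by simp) fun i => ?_
    simp
    ring
  exact RingHom.congr_fun this f

theorem natDegree_line_le (f : Poly K n) (w v : Vec K n) :
    (aeval (fun i => Polynomial.C (w i) + Polynomial.C (v i) * Polynomial.X) f :
      Polynomial K).natDegree ≤ f.totalDegree := by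
  have := MvPolynomial.aeval_natDegree_le (m := f.totalDegree) (n := 1) f le_rfl
    (fun i => Polynomial.C (w i) + Polynomial.C (v i) * Polynomial.X) (fun i => by
      rw [add_comm]; exact Polynomial.natDegree_linear_le)
  simpa using this

/-- Let `X` be a set of vectors with span `H` that is not covered by finitely many proper subspaces
of `H`. A polynomial vector field on the dual space that is tangent to the hyperplanes dual to the
points of `X` is, as far as `H` is concerned, proportional to the Euler vector field. -/
theorem tangent_field_aligned [Infinite K] (X : Set (Vec K n)) (H : Submodule K (Vec K n)) (hXH : X ⊆ H)
    (hX : ∀ s : Finset (Submodule K (Vec K n)), X ⊆ ⋃ p ∈ s, (p : Set (Vec K n)) →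
      ∃ p ∈ s, H ≤ p)
    (A : Fin (n + 1) → Poly K n)
    (hA : ∀ w, ∀ x ∈ X, w ⬝ᵥ x = 0 → (fun i => eval w (A i)) ⬝ᵥ x = 0)
    (w : Vec K n) {x y : Vec K n} (hx : x ∈ H) (hy : y ∈ H) :
    (w ⬝ᵥ x) * ((fun i => eval w (A i)) ⬝ᵥ y) = (w ⬝ᵥ y) * ((fun i => eval w (A i)) ⬝ᵥ x) := by
  classical
  -- Induction on the codimension in H of a space N, spanned by points of X, on which w vanishes.
  -- Tangency makes A(w) vanish on N too, so when N has codimension at most 1 both functionals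
  -- factor through a space of dimension at most 1 and are proportional. The statement itself is the
  -- case N = 0.
  suffices claim : ∀ k : ℕ, ∀ N ≤ H, Submodule.span K (X ∩ N) = N →
      Module.finrank K H ≤ Module.finrank K N + k + 1 → ∀ w : Vec K n, (∀ z ∈ N, w ⬝ᵥ z = 0) →
      ∀ x ∈ H, ∀ y ∈ H,
      (w ⬝ᵥ x) * ((fun i => eval w (A i)) ⬝ᵥ y) = (w ⬝ᵥ y) * ((fun i => eval w (A i)) ⬝ᵥ x) by
    refine claim (Module.finrank K H) ⊥ bot_le ?_ (by simp) w (by simp) x hx y hy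
    rw [eq_bot_iff]
    exact (Submodule.span_mono Set.inter_subset_right).trans (Submodule.span_eq _).le
  intro k
  induction k with
  | zero =>
    intro N hN hspan hrank w hw x hx y hy
    have hAN : ∀ z ∈ N, (fun i => eval w (A i)) ⬝ᵥ z = 0 := by
      intro z hz
      rw [← hspan] at hz
      induction hz using Submodule.span_induction with
      | mem z hz => exact hA w z hz.1 (hw z hz.2)
      | zero => simp
      | add a b _ _ ha hb => rw [dotProduct_add, ha, hb, add_zero]
      | smul c a _ ha => rw [dotProduct_smul, ha, smul_zero]
    by_cases hxN : x ∈ N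
    · rw [hw x hxN, hAN x hxN]; ring
    · have hlt : N < N ⊔ Submodule.span K {x} := by
        refine lt_of_le_of_ne le_sup_left fun h => hxN ?_
        rw [h]
        exact Submodule.mem_sup_right (Submodule.mem_span_singleton_self x)
      have h1 := Submodule.finrank_lt_finrank_of_lt hlt
      have h2 : N ⊔ Submodule.span K {x} ≤ H := sup_le hN (by simpa using hx)
      have h3 : N ⊔ Submodule.span K {x} = H :=
        Submodule.eq_of_le_of_finrank_le h2 (by omega)
      rw [← h3, Submodule.mem_sup] at hy
      obtain ⟨z, hz, _, hx', rfl⟩ := hy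
      obtain ⟨c, rfl⟩ := Submodule.mem_span_singleton.1 hx'
      rw [dotProduct_add, dotProduct_add, hw z hz, hAN z hz, dotProduct_smul, dotProduct_smul]
      simp only [smul_eq_mul]
      ring
  | succ k ih =>
    intro N hN hspan hrank w hw x hx y hy
    by_cases hle : Module.finrank K H ≤ Module.finrank K N + k + 1
    · exact ih N hN hspan hle w hw x hx y hy
    have hcodim : ∀ a, Module.finrank K (N ⊔ Submodule.span K {a} : Submodule K (Vec K n)) <
        Module.finrank K H := by
      intro a
      have h1 := Submodule.finrank_add_le_finrank_add_finrank N (Submodule.span K {a})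
      have h2 : Module.finrank K (Submodule.span K {a}) ≤ 1 := by
        simpa using finrank_span_le_card (R := K) ({a} : Set (Vec K n))
      omega
    have ih' : ∀ a ∈ X, a ∉ N → ∀ w : Vec K n, (∀ z ∈ N, w ⬝ᵥ z = 0) → w ⬝ᵥ a = 0 →
        (w ⬝ᵥ x) * ((fun i => eval w (A i)) ⬝ᵥ y) =
          (w ⬝ᵥ y) * ((fun i => eval w (A i)) ⬝ᵥ x) := by
      intro a ha haN w hw hwa
      have hlt : N < N ⊔ Submodule.span K {a} := by
        refine lt_of_le_of_ne le_sup_left fun h => haN ?_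
        rw [h]
        exact Submodule.mem_sup_right (Submodule.mem_span_singleton_self a)
      have h1 := Submodule.finrank_lt_finrank_of_lt hlt
      refine ih (N ⊔ Submodule.span K {a}) (sup_le hN (by simpa using hXH ha)) ?_ (by omega) w ?_
        x hx y hy
      · apply le_antisymm
        · exact (Submodule.span_mono Set.inter_subset_right).trans (Submodule.span_eq _).le
        · refine sup_le ?_ ?_
          · conv_lhs => rw [← hspan]
            exact Submodule.span_mono (Set.inter_subset_inter_right _ (by
              exact_mod_cast le_sup_left))
          · rw [Submodule.span_le, Set.singleton_subset_iff]
            exact Submodule.subset_span ⟨ha,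
              Submodule.mem_sup_right (Submodule.mem_span_singleton_self a)⟩
      · intro z hz
        obtain ⟨z', hz', _, ha', rfl⟩ := Submodule.mem_sup.1 hz
        obtain ⟨c, rfl⟩ := Submodule.mem_span_singleton.1 ha'
        rw [dotProduct_add, hw z' hz', dotProduct_smul, hwa]; simp
    -- Infinitely many points of X outside N, pairwise independent modulo N. They exist because each
    -- N + ⟨a⟩ is still a proper subspace of H and finitely many such subspaces do not cover X.
    obtain ⟨p, hp, hpp⟩ := exists_seq_of_forall_finset_exists
      (fun a => a ∈ X ∧ a ∉ N) (fun a b => b ∉ N ⊔ Submodule.span K {a}) (by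
        intro s _
        by_contra hcon
        push Not at hcon
        obtain ⟨q, hq, hHq⟩ := hX (insert N (s.image fun a => N ⊔ Submodule.span K {a})) (by
          intro a ha
          simp only [Finset.mem_insert, Finset.mem_image, Set.mem_iUnion, exists_prop]
          by_cases haN : a ∈ N
          · exact ⟨N, Or.inl rfl, haN⟩
          · obtain ⟨b, hb, hab⟩ := hcon a ⟨ha, haN⟩
            exact ⟨_, Or.inr ⟨b, hb, rfl⟩, hab⟩)
        have hq' := Submodule.finrank_mono hHq
        rcases Finset.mem_insert.1 hq with rfl | hq
        · omega
        · obtain ⟨b, -, rfl⟩ := Finset.mem_image.1 hq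
          have := hcodim b
          omega)
    let f : Poly K n := linForm x * (∑ i, A i * C (y i)) - linForm y * (∑ i, A i * C (x i))
    have hf : ∀ w, eval w f = (w ⬝ᵥ x) * ((fun i => eval w (A i)) ⬝ᵥ y) -
        (w ⬝ᵥ y) * ((fun i => eval w (A i)) ⬝ᵥ x) := by
      intro w
      simp [f, dotProduct, mul_comm]
    rw [← sub_eq_zero, ← hf]
    by_cases hex : ∃ i, w ⬝ᵥ p i = 0
    · obtain ⟨i, hi⟩ := hex
      rw [hf, sub_eq_zero]
      exact ih' (p i) (hp i).1 (hp i).2 w hw hi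
    push Not at hex
    -- On the line w + tv with v orthogonal to N, the minor f vanishes for each i < D at the
    -- parameter where the functional kills `p i`, by the induction hypothesis for N + ⟨p i⟩.
    -- Genericity of v makes these D > deg f parameters distinct, so f vanishes along the whole
    -- line, in particular at t = 0.
    let D := f.totalDegree + 1
    obtain ⟨v, hvN, hv⟩ := exists_orthogonal_avoiding N
      ((Finset.range D).image p ∪ ((Finset.range D ×ˢ Finset.range D).filter
        fun ij => ij.1 < ij.2).image fun ij => (w ⬝ᵥ p ij.1) • p ij.2 - (w ⬝ᵥ p ij.2) • p ij.1) (by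
        intro z hz hzN
        rcases Finset.mem_union.1 hz with hz | hz
        · obtain ⟨i, -, rfl⟩ := Finset.mem_image.1 hz
          exact (hp i).2 hzN
        · obtain ⟨⟨i, j⟩, hij, rfl⟩ := Finset.mem_image.1 hz
          refine hpp i j (Finset.mem_filter.1 hij).2 ?_
          have h1 : (w ⬝ᵥ p i) • p j ∈ N ⊔ Submodule.span K {p i} := by
            have := Submodule.add_mem_sup hzN
              (Submodule.smul_mem _ (w ⬝ᵥ p j) (Submodule.mem_span_singleton_self (R := K) (p i)))
            simpa using this
          exact (Submodule.smul_mem_iff _ (hex i)).1 h1)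
    have hv1 : ∀ i < D, v ⬝ᵥ p i ≠ 0 := fun i hi => hv _ (Finset.mem_union_left _
      (Finset.mem_image_of_mem _ (Finset.mem_range.2 hi)))
    have hv2 : ∀ i j, i < j → j < D → (w ⬝ᵥ p i) * (v ⬝ᵥ p j) ≠ (w ⬝ᵥ p j) * (v ⬝ᵥ p i) := by
      intro i j hij hj h0
      refine hv ((w ⬝ᵥ p i) • p j - (w ⬝ᵥ p j) • p i) (Finset.mem_union_right _
        (Finset.mem_image.2 ⟨(i, j), by simp [hij, hj, hij.trans hj], rfl⟩)) ?_
      rw [dotProduct_sub, dotProduct_smul, dotProduct_smul, smul_eq_mul, smul_eq_mul, h0, sub_self]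
    let q : Polynomial K := aeval (fun i => Polynomial.C (w i) + Polynomial.C (v i) * Polynomial.X) f
    have hq : q = 0 := by
      let r : Fin D → K := fun i => -(w ⬝ᵥ p i) / (v ⬝ᵥ p i)
      have hrinj : Function.Injective r := by
        have hlt : ∀ i j : Fin D, i < j → r i ≠ r j := by
          intro i j hij h
          simp only [r] at h
          rw [div_eq_div_iff (hv1 i i.2) (hv1 j j.2)] at h
          exact hv2 i j hij j.2 (by linear_combination -h)
        intro i j h
        rcases lt_trichotomy i j with hij | hij | hij
        · exact absurd h (hlt i j hij)
        · exact hij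
        · exact absurd h.symm (hlt j i hij)
      refine Polynomial.eq_zero_of_natDegree_lt_card_of_eval_eq_zero q hrinj (fun i => ?_) ?_
      · rw [eval_line, hf, sub_eq_zero]
        refine ih' (p i) (hp i).1 (hp i).2 _ (fun z hz => ?_) ?_
        · rw [add_dotProduct, smul_dotProduct, hw z hz, hvN z hz]; simp
        · rw [add_dotProduct, smul_dotProduct, smul_eq_mul]
          simp only [r]
          rw [div_mul_cancel₀ _ (hv1 i i.2)]
          ring
      · rw [Fintype.card_fin]
        exact Nat.lt_succ_of_le (natDegree_line_le f w v)
    have := eval_line f w v 0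
    rw [show (aeval (fun i => Polynomial.C (w i) + Polynomial.C (v i) * Polynomial.X) f :
      Polynomial K) = 0 from hq] at this
    simpa using this.symm

end Aligned
end UnexpectedHypersurfaces

namespace UnexpectedHypersurfaces

/-! ### Calculus of general tuples. -/

section ForGeneral

variable {K : Type*} [Field K] {n k : ℕ}

theorem ForGeneral.mono {P Q : (Fin k → Vec K n) → Prop} (hP : ForGeneral k P)
    (h : ∀ u, LinearIndependent K u → P u → Q u) : ForGeneral k Q := by
  obtain ⟨G, hG, hGP⟩ := hP
  exact ⟨G, hG, fun u hu hGu => h u hu (hGP u hu hGu)⟩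

theorem ForGeneral.and {P Q : (Fin k → Vec K n) → Prop} (hP : ForGeneral k P)
    (hQ : ForGeneral k Q) : ForGeneral k fun u => P u ∧ Q u := by
  obtain ⟨G, hG, hGP⟩ := hP
  obtain ⟨G', hG', hGQ⟩ := hQ
  refine ⟨G * G', mul_ne_zero hG hG', fun u hu hGu => ?_⟩
  rw [map_mul] at hGu
  exact ⟨hGP u hu (left_ne_zero_of_mul hGu), hGQ u hu (right_ne_zero_of_mul hGu)⟩

theorem ForGeneral.of_forall {P : (Fin k → Vec K n) → Prop}
    (h : ∀ u, LinearIndependent K u → P u) : ForGeneral k P :=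
  ⟨1, one_ne_zero, fun u hu _ => h u hu⟩

theorem ForGeneral.forall_finset {ι : Type*} (S : Finset ι) {P : ι → (Fin k → Vec K n) → Prop}
    (h : ∀ i ∈ S, ForGeneral k (P i)) : ForGeneral k fun u => ∀ i ∈ S, P i u := by
  classical
  induction S using Finset.induction_on with
  | empty => exact .of_forall (by simp)
  | insert a S _ ih =>
    refine ((h a (by simp)).and (ih fun i hi => h i (by simp [hi]))).mono fun u _ hu i hi => ?_
    rcases Finset.mem_insert.1 hi with rfl | hi
    · exact hu.1
    · exact hu.2 i hi

theorem forGeneral_eval_ne_zero (G : MvPolynomial (Fin k × Fin (n + 1)) K) (u : Fin k → Vec K n)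
    (hu : eval (fun p => u p.1 p.2) G ≠ 0) :
    ForGeneral k fun u : Fin k → Vec K n => eval (fun p => u p.1 p.2) G ≠ 0 :=
  ⟨G, fun h => hu (by rw [h, map_zero]), fun _ _ h => h⟩

/-- Multiplying G by a 2 × 2 minor of u makes its nonvanishing force independence, and a nonzero
polynomial has a nonzero value over an infinite field. At least two coordinates are needed for the
minor. -/
theorem ForGeneral.exists [Infinite K] (hn : 0 < n) {P : (Fin 2 → Vec K n) → Prop}
    (hP : ForGeneral 2 P) : ∃ u, LinearIndependent K u ∧ P u := by
  obtain ⟨G, hG, hGP⟩ := hP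
  obtain ⟨i₁, hi₁⟩ : ∃ i : Fin (n + 1), i ≠ 0 := ⟨⟨1, by omega⟩, by simp [Fin.ext_iff]⟩
  let D : MvPolynomial (Fin 2 × Fin (n + 1)) K := X (0, 0) * X (1, i₁) - X (0, i₁) * X (1, 0)
  have hD : D ≠ 0 := by
    intro h
    have := congrArg (eval fun p : Fin 2 × Fin (n + 1) =>
      if p = (0, 0) ∨ p = (1, i₁) then (1 : K) else 0) h
    simp [D, hi₁] at this
  have : ∃ U, eval U (G * D) ≠ 0 := by
    by_contra hcon
    push Not at hcon
    exact mul_ne_zero hG hD (MvPolynomial.funext fun U => by rw [hcon U, map_zero])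
  obtain ⟨U, hU⟩ := this
  rw [map_mul] at hU
  have hU2 := right_ne_zero_of_mul hU
  have hli : LinearIndependent K (fun j i => U (j, i)) := by
    have e : (fun j i => U (j, i)) = ![fun i => U (0, i), fun i => U (1, i)] := by
      ext j i; fin_cases j <;> rfl
    rw [e, LinearIndependent.pair_iff']
    · intro a ha
      have h1 := congrFun ha 0
      have h2 := congrFun ha i₁
      simp only [Pi.smul_apply, smul_eq_mul] at h1 h2
      apply hU2
      simp only [D, map_sub, map_mul, eval_X, ← h1, ← h2]
      ring
    · intro h0
      apply hU2
      have h1 := congrFun h0 0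
      have h2 := congrFun h0 i₁
      simp only [Pi.zero_apply] at h1 h2
      simp only [D, map_sub, map_mul, eval_X, h1, h2]
      ring
  exact ⟨_, hli, hGP _ hli (left_ne_zero_of_mul hU)⟩

/-- The bilinear form `u_j·x` as a polynomial in the entries of `u`. -/
noncomputable def genDot (j : Fin k) (x : Vec K n) : MvPolynomial (Fin k × Fin (n + 1)) K :=
  ∑ i, C (x i) * X (j, i)

@[simp] theorem eval_genDot (j : Fin k) (x : Vec K n) (u : Fin k × Fin (n + 1) → K) :
    eval u (genDot j x) = (fun i => u (j, i)) ⬝ᵥ x := by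
  simp [genDot, dotProduct, mul_comm]

end ForGeneral

/-! ### Generic rank of the power vectors of a set and of its span. -/

section GenericPowerVectors

variable {K : Type*} [Field K] {n : ℕ}

/-- The power vector of `x` for a generic pair `u`. -/
noncomputable def genPowVec (m : ℕ) (x : Vec K n) :
    Fin (m + 1) × Fin (n + 1) → MvPolynomial (Fin 2 × Fin (n + 1)) K :=
  fun p => genDot 0 x ^ (p.1 : ℕ) * genDot 1 x ^ (m - p.1) * C (x p.2)

theorem eval_genPowVec (m : ℕ) (x : Vec K n) (u : Fin 2 × Fin (n + 1) → K) (p) :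
    eval u (genPowVec m x p) = powVec m (fun j i => u (j, i)) x p := by
  simp [genPowVec, powVec]

/-- The rank of the power vectors of the points of `X` for a generic pair `u`. -/
noncomputable def genericRank (m : ℕ) (X : Set (Vec K n)) : ℕ :=
  Module.finrank (FractionRing (MvPolynomial (Fin 2 × Fin (n + 1)) K))
    (Submodule.span (FractionRing (MvPolynomial (Fin 2 × Fin (n + 1)) K))
      ((fun x p => algebraMap _ (FractionRing (MvPolynomial (Fin 2 × Fin (n + 1)) K))
        (genPowVec m x p)) '' X))

theorem forGeneral_finrank_span_powVec (m : ℕ) (X : Set (Vec K n)) :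
    ForGeneral 2 fun u : Fin 2 → Vec K n =>
      Module.finrank K (Submodule.span K (powVec m u '' X)) = genericRank m X := by
  obtain ⟨G, hG, h⟩ := exists_forall_eval_finrank_eq (genPowVec (K := K) (n := n) m) X
  refine ⟨G, hG, fun u _ hu => ?_⟩
  rw [genericRank, ← h _ hu]
  have : powVec m u = fun x p => eval (fun p => u p.1 p.2) (genPowVec m x p) := by
    ext x p; exact (eval_genPowVec m x (fun p => u p.1 p.2) p).symm
  beta_reduce
  rw [this]

/-- Where u₀ = r u₁, every monomial of degree m in the two forms is a power of r times (u₁·x)^m. The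
remaining factor is a vector independent of x paired with x, which is how forms become vector
fields. -/
theorem dotProduct_powVec_of_eq (m : ℕ) (u : Fin 2 → Vec K n) (x : Vec K n) (r : K)
    (h : u 0 ⬝ᵥ x = r * (u 1 ⬝ᵥ x)) (c : Fin (m + 1) × Fin (n + 1) → K) :
    c ⬝ᵥ powVec m u x = (u 1 ⬝ᵥ x) ^ m * ((fun i => ∑ j : Fin (m + 1), r ^ (j : ℕ) * c (j, i)) ⬝ᵥ x) := by
  simp only [dotProduct, powVec]
  rw [Fintype.sum_prod_type_right, Finset.mul_sum]
  refine Finset.sum_congr rfl fun i _ => ?_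
  rw [Finset.sum_mul, Finset.mul_sum]
  refine Finset.sum_congr rfl fun j _ => ?_
  change c (j, i) * ((u 0 ⬝ᵥ x) ^ (j : ℕ) * (u 1 ⬝ᵥ x) ^ (m - j) * x i) = (u 1 ⬝ᵥ x) ^ m * _
  have : (u 1 ⬝ᵥ x) ^ m = (u 1 ⬝ᵥ x) ^ (j : ℕ) * (u 1 ⬝ᵥ x) ^ (m - j) := by
    rw [← pow_add]; congr 1; omega
  rw [this, h, mul_pow]
  ring

/-- Here g is a form whose coefficients depend polynomially on u. Fix u₁ and r and substitute u₀ = w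
+ r u₁: on the points z with w·z = 0 the form becomes (u₁·z)^m A(w)·z for a polynomial vector field
A. Vanishing on X makes A tangent to the dual hyperplanes, so A(w) is proportional to w on H. For r
= (u₀·x)/(u₁·x) the functional w = u₀ - r u₁ kills x but is nonzero on H, hence A(w)·x = 0. -/
theorem dotProduct_genPowVec_eq_zero [Infinite K] (m : ℕ) (X : Set (Vec K n))
    (H : Submodule K (Vec K n)) (hH : 2 ≤ Module.finrank K H) (hXH : X ⊆ H)
    (hX : ∀ s : Finset (Submodule K (Vec K n)), X ⊆ ⋃ p ∈ s, (p : Set (Vec K n)) →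
      ∃ p ∈ s, H ≤ p)
    (g : Fin (m + 1) × Fin (n + 1) → MvPolynomial (Fin 2 × Fin (n + 1)) K)
    (hg : ∀ x ∈ X, g ⬝ᵥ genPowVec m x = 0) {x : Vec K n} (hx : x ∈ H) :
    g ⬝ᵥ genPowVec m x = 0 := by
  classical
  have heval : ∀ (u : Fin 2 → Vec K n) (x : Vec K n), eval (fun p => u p.1 p.2)
      (g ⬝ᵥ genPowVec m x) = (fun p => eval (fun p => u p.1 p.2) (g p)) ⬝ᵥ powVec m u x := by
    intro u x
    simp only [dotProduct, map_sum, map_mul, eval_genPowVec]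
  by_cases hx0 : x = 0
  · subst hx0
    simp [genPowVec, dotProduct]
  obtain ⟨y, hy, hyx⟩ : ∃ y ∈ H, y ∉ Submodule.span K {x} := by
    by_contra hcon
    push Not at hcon
    have h1 := Submodule.finrank_mono (show H ≤ Submodule.span K {x} from hcon)
    rw [finrank_span_singleton hx0] at h1
    omega
  -- Nonvanishing of G says that r is defined and that u₀ - r u₁, which kills x, does not kill y. It
  -- suffices to prove the vanishing where G ≠ 0.
  let G : MvPolynomial (Fin 2 × Fin (n + 1)) K :=
    genDot 1 x * (genDot 1 x * genDot 0 y - genDot 0 x * genDot 1 y)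
  have hG : G ≠ 0 := by
    obtain ⟨a, ha, hay⟩ := exists_orthogonal_avoiding (Submodule.span K {x}) {y} (by simpa using hyx)
    obtain ⟨b, -, hbx⟩ := exists_orthogonal_avoiding (⊥ : Submodule K (Vec K n)) {x}
      (by simpa using hx0)
    have hax := ha x (Submodule.mem_span_singleton_self x)
    have hay' := hay y (by simp)
    have hbx' := hbx x (by simp)
    intro h0
    have := congrArg (eval fun p : Fin 2 × Fin (n + 1) => (![a, b] : Fin 2 → Vec K n) p.1 p.2) h0
    simp only [G, map_mul, map_sub, eval_genDot, map_zero] at this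
    change (b ⬝ᵥ x) * ((b ⬝ᵥ x) * (a ⬝ᵥ y) - (a ⬝ᵥ x) * (b ⬝ᵥ y)) = 0 at this
    rw [hax, zero_mul, sub_zero] at this
    exact mul_ne_zero hbx' (mul_ne_zero hbx' hay') this
  refine (mul_eq_zero.1 (?_ : _ * G = 0)).resolve_right hG
  refine MvPolynomial.funext fun U => ?_
  rw [map_mul, map_zero]
  by_cases hGU : eval U G = 0
  · rw [hGU, mul_zero]
  refine mul_eq_zero_of_left ?_ _
  set u : Fin 2 → Vec K n := fun j i => U (j, i) with hu
  have hUu : U = fun p => u p.1 p.2 := rfl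
  simp only [G, map_mul, map_sub, eval_genDot] at hGU
  change (u 1 ⬝ᵥ x) * ((u 1 ⬝ᵥ x) * (u 0 ⬝ᵥ y) - (u 0 ⬝ᵥ x) * (u 1 ⬝ᵥ y)) ≠ 0 at hGU
  have h1x := left_ne_zero_of_mul hGU
  have h2 := right_ne_zero_of_mul hGU
  set r := (u 0 ⬝ᵥ x) / (u 1 ⬝ᵥ x) with hr
  have hrx : u 0 ⬝ᵥ x = r * (u 1 ⬝ᵥ x) := by rw [hr, div_mul_cancel₀ _ h1x]
  let φ : MvPolynomial (Fin 2 × Fin (n + 1)) K →ₐ[K] Poly K n := aeval fun p =>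
    if p.1 = 0 then MvPolynomial.X p.2 + C (r * u 1 p.2) else C (u 1 p.2)
  have hφ : ∀ w f, eval w (φ f) =
      eval (fun p => (![w + r • u 1, u 1] : Fin 2 → Vec K n) p.1 p.2) f := by
    intro w f
    have : (eval w : Poly K n →+* K).comp
        (φ : MvPolynomial (Fin 2 × Fin (n + 1)) K →+* Poly K n) =
        eval (fun p : Fin 2 × Fin (n + 1) => (![w + r • u 1, u 1] : Fin 2 → Vec K n) p.1 p.2) := by
      refine MvPolynomial.ringHom_ext (fun c => by simp [φ]) ?_
      rintro ⟨j, i⟩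
      fin_cases j <;> simp [φ]
    exact RingHom.congr_fun this f
  let A : Fin (n + 1) → Poly K n := fun i => ∑ j : Fin (m + 1), C (r ^ (j : ℕ)) * φ (g (j, i))
  have hA : ∀ w : Vec K n, ∀ z : Vec K n, w ⬝ᵥ z = 0 →
      eval (fun p => (![w + r • u 1, u 1] : Fin 2 → Vec K n) p.1 p.2) (g ⬝ᵥ genPowVec m z) =
        (u 1 ⬝ᵥ z) ^ m * ((fun i => eval w (A i)) ⬝ᵥ z) := by
    intro w z hwz
    rw [heval, dotProduct_powVec_of_eq m _ z r]
    · simp [A, hφ]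
    · change (w + r • u 1) ⬝ᵥ z = r * (u 1 ⬝ᵥ z)
      rw [add_dotProduct, hwz, smul_dotProduct, smul_eq_mul, zero_add]
  -- Points with u₁·z = 0 have to be discarded before cancelling (u₁·z)^m. They lie in one
  -- hyperplane, which does not contain H because u₁·x ≠ 0, so the remaining points still satisfy
  -- the covering hypothesis.
  have key := tangent_field_aligned {z ∈ X | u 1 ⬝ᵥ z ≠ 0} H (fun z hz => hXH hz.1) (by
    intro s hs
    obtain ⟨p, hp, hHp⟩ := hX (insert (LinearMap.ker (dotForm (u 1))) s) (by
      intro z hz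
      simp only [Finset.mem_insert, Set.mem_iUnion, exists_prop]
      by_cases hz0 : u 1 ⬝ᵥ z = 0
      · exact ⟨_, Or.inl rfl, hz0⟩
      · obtain ⟨p, hp, hzp⟩ := Set.mem_iUnion₂.1 (hs ⟨hz, hz0⟩)
        exact ⟨p, Or.inr hp, hzp⟩)
    rcases Finset.mem_insert.1 hp with rfl | hp
    · exact absurd (hHp hx) h1x
    · exact ⟨p, hp, hHp⟩) A (by
    rintro w z ⟨hz, hz0⟩ hwz
    have := hA w z hwz
    rw [hg z hz, map_zero] at this
    exact (mul_eq_zero.1 this.symm).resolve_left (pow_ne_zero _ hz0)) (u 0 - r • u 1) hx hy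
  have hwx : (u 0 - r • u 1) ⬝ᵥ x = 0 := by
    rw [sub_dotProduct, smul_dotProduct, hrx, smul_eq_mul, sub_self]
  have hwy : (u 0 - r • u 1) ⬝ᵥ y ≠ 0 := by
    intro h0
    rw [sub_dotProduct, smul_dotProduct, smul_eq_mul] at h0
    apply h2
    rw [hrx]
    linear_combination (u 1 ⬝ᵥ x) * h0
  rw [hwx, zero_mul] at key
  have hfin := hA _ x hwx
  rw [(mul_eq_zero.1 key.symm).resolve_left hwy, mul_zero, sub_add_cancel] at hfin
  rw [hUu, ← hfin]
  congr 2
  ext p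
  obtain ⟨j, i⟩ := p
  fin_cases j <;> rfl

theorem genericRank_mono (m : ℕ) {X Y : Set (Vec K n)} (h : X ⊆ Y) :
    genericRank m X ≤ genericRank m Y :=
  Submodule.finrank_mono (Submodule.span_mono (Set.image_mono h))

/-- The generic rank of the power vectors of a subset `X` of `H` that is not covered by finitely many
proper subspaces of `H` is that of `H`. -/
theorem genericRank_eq_of_not_covered [Infinite K] (m : ℕ) (X : Set (Vec K n))
    (H : Submodule K (Vec K n)) (hH : 2 ≤ Module.finrank K H) (hXH : X ⊆ H)
    (hX : ∀ s : Finset (Submodule K (Vec K n)), X ⊆ ⋃ p ∈ s, (p : Set (Vec K n)) →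
      ∃ p ∈ s, H ≤ p) :
    genericRank m X = genericRank m (H : Set (Vec K n)) := by
  refine le_antisymm (genericRank_mono m hXH) (Submodule.finrank_mono ?_)
  rw [Submodule.span_le]
  rintro _ ⟨x, hx, rfl⟩
  refine mem_span_of_forall_dotProduct fun g hg => ?_
  obtain ⟨b, hb⟩ := IsLocalization.exist_integer_multiples_of_finite
    (nonZeroDivisors (MvPolynomial (Fin 2 × Fin (n + 1)) K)) g
  choose g' hg' using hb
  have hdot : ∀ z : Vec K n, algebraMap _ (FractionRing (MvPolynomial (Fin 2 × Fin (n + 1)) K))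
      (g' ⬝ᵥ genPowVec m z) = algebraMap _ _ (b : MvPolynomial (Fin 2 × Fin (n + 1)) K) *
        (g ⬝ᵥ fun p => algebraMap _ _ (genPowVec m z p)) := by
    intro z
    simp only [dotProduct, map_sum, map_mul, hg', Finset.mul_sum, Algebra.smul_def, mul_assoc]
  have h0 := dotProduct_genPowVec_eq_zero m X H hH hXH hX g' (fun z hz => by
    apply IsFractionRing.injective (MvPolynomial (Fin 2 × Fin (n + 1)) K)
      (FractionRing (MvPolynomial (Fin 2 × Fin (n + 1)) K))
    rw [hdot, hg _ ⟨z, hz, rfl⟩, mul_zero, map_zero]) hx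
  have h1 := hdot x
  rw [h0, map_zero] at h1
  refine (mul_eq_zero.1 h1.symm).resolve_left ?_
  exact IsFractionRing.to_map_ne_zero_of_mem_nonZeroDivisors b.2

/-- A general pair u is independent on H; solving the resulting 2 × 2 system for x, y ∈ H gives the
dual vectors required by `finrank_span_powVec_submodule`. This is why H must have dimension at least
2. -/
theorem genericRank_submodule [Infinite K] (hn : 0 < n) (m : ℕ) (H : Submodule K (Vec K n))
    (hH : 2 ≤ Module.finrank K H) :
    genericRank m (H : Set (Vec K n)) + m = (m + 1) * Module.finrank K H := by
  obtain ⟨x, hx, hx0⟩ : ∃ x ∈ H, x ≠ 0 := by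
    refine Submodule.exists_mem_ne_zero_of_ne_bot ?_
    rintro rfl
    simp at hH
  obtain ⟨y, hy, hyx⟩ : ∃ y ∈ H, y ∉ Submodule.span K {x} := by
    by_contra hcon
    push Not at hcon
    have h1 := Submodule.finrank_mono (show H ≤ Submodule.span K {x} from hcon)
    rw [finrank_span_singleton hx0] at h1
    omega
  obtain ⟨a, ha, hay⟩ := exists_orthogonal_avoiding (Submodule.span K {x}) {y} (by simpa using hyx)
  obtain ⟨b, -, hbx⟩ := exists_orthogonal_avoiding (⊥ : Submodule K (Vec K n)) {x}
    (by simpa using hx0)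
  have hax := ha x (Submodule.mem_span_singleton_self x)
  have hay' := hay y (by simp)
  have hbx' := hbx x (by simp)
  have hdet := forGeneral_eval_ne_zero
    (genDot 1 x * (genDot 0 y * genDot 1 x - genDot 1 y * genDot 0 x)) ![a, b] (by
    simp only [map_mul, map_sub, eval_genDot]
    change (b ⬝ᵥ x) * ((a ⬝ᵥ y) * (b ⬝ᵥ x) - (b ⬝ᵥ y) * (a ⬝ᵥ x)) ≠ 0
    rw [hax, mul_zero, sub_zero]
    exact mul_ne_zero hbx' (mul_ne_zero hay' hbx'))
  obtain ⟨u, -, hu, hdet⟩ := ((forGeneral_finrank_span_powVec m (H : Set (Vec K n))).and hdet).exists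
    hn
  simp only [map_mul, map_sub, eval_genDot] at hdet
  have h1 := left_ne_zero_of_mul hdet
  have h2 := right_ne_zero_of_mul hdet
  rw [← hu]
  set D := (u 0 ⬝ᵥ y) * (u 1 ⬝ᵥ x) - (u 1 ⬝ᵥ y) * (u 0 ⬝ᵥ x) with hD
  change D ≠ 0 at h2
  change u 1 ⬝ᵥ x ≠ 0 at h1
  refine finrank_span_powVec_submodule m u H
    (b₀ := D⁻¹ • ((u 1 ⬝ᵥ x) • y - (u 1 ⬝ᵥ y) • x)) (b₁ := (u 1 ⬝ᵥ x)⁻¹ • x)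
    (H.smul_mem _ (H.sub_mem (H.smul_mem _ hy) (H.smul_mem _ hx))) (H.smul_mem _ hx) ?_ ?_ ?_
  · simp only [dotProduct_smul, dotProduct_sub, smul_eq_mul]
    rw [inv_mul_eq_one₀ h2, hD]
    ring
  · simp only [dotProduct_smul, dotProduct_sub, smul_eq_mul]
    ring
  · rw [dotProduct_smul, smul_eq_mul, inv_mul_cancel₀ h1]

end GenericPowerVectors
end UnexpectedHypersurfaces

namespace UnexpectedHypersurfaces

/-! ### Ideals of linear subspaces and their powers. -/

section LinearIdeals

variable {K : Type*} [Field K] {n : ℕ}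

theorem mem_linIdeal {H : Submodule K (Vec K n)} {f : Poly K n} :
    f ∈ linIdeal H ↔ ∀ x ∈ H, eval x f = 0 := by
  simp [linIdeal, mem_vanishingIdeal_iff, aeval_eq_eval]

/-- The ideal of a linear subspace `H` is generated by the coordinates of `X - π X`, for any
projection `π` onto `H`. -/
theorem linIdeal_le_span_of_proj [Infinite K] (H : Submodule K (Vec K n)) (p : Fin (n + 1) → Poly K n)
    (hp : ∀ x, (fun i => eval x (p i)) ∈ H) :
    linIdeal H ≤ Ideal.span (Set.range fun i => (X i - p i : Poly K n)) := by
  intro f hf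
  set I := Ideal.span (Set.range fun i => (X i - p i : Poly K n))
  -- Modulo I each variable equals its projected coordinate, so f is congruent to its composite with
  -- the projection, which vanishes when f vanishes on H.
  have h1 : ∀ f, Ideal.Quotient.mkₐ K I f = Ideal.Quotient.mkₐ K I (aeval p f) := by
    intro f
    have : Ideal.Quotient.mkₐ K I = (Ideal.Quotient.mkₐ K I).comp (aeval p) := by
      ext i
      simp only [AlgHom.comp_apply, aeval_X, Ideal.Quotient.mkₐ_eq_mk]
      rw [Ideal.Quotient.eq]
      exact Ideal.subset_span ⟨i, rfl⟩
    exact AlgHom.congr_fun this f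
  have h2 : aeval p f = 0 := by
    refine MvPolynomial.funext fun x => ?_
    have : eval x (aeval p f) = eval (fun i => eval x (p i)) f := by
      have : (eval x : Poly K n →+* K).comp (aeval p : Poly K n →ₐ[K] Poly K n) =
          eval (fun i => eval x (p i)) :=
        MvPolynomial.ringHom_ext (fun c => by simp) fun i => by simp
      exact RingHom.congr_fun this f
    rw [this, map_zero]
    exact mem_linIdeal.1 hf _ (hp x)
  have := h1 f
  rw [h2, map_zero] at this
  exact Ideal.Quotient.eq_zero_iff_mem.1 this

theorem exists_dual_pair {u : Fin 2 → Vec K n} (hu : LinearIndependent K u) :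
    ∃ w : Fin 2 → Vec K n, u 0 ⬝ᵥ w 0 = 1 ∧ u 0 ⬝ᵥ w 1 = 0 ∧ u 1 ⬝ᵥ w 0 = 0 ∧ u 1 ⬝ᵥ w 1 = 1 := by
  obtain ⟨B, hB⟩ := LinearIndependent.exists_dual_family hu
  have h : ∀ i j, u i ⬝ᵥ (fun k => B k j) = (1 : Matrix (Fin 2) (Fin 2) K) i j := by
    intro i j
    rw [← hB]; rfl
  exact ⟨fun j i => B i j, by simp [h], by simp [h], by simp [h], by simp [h]⟩

theorem mem_cutOut {k : ℕ} {u : Fin k → Vec K n} {x : Vec K n} :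
    x ∈ cutOut u ↔ ∀ j, u j ⬝ᵥ x = 0 := by
  rw [cutOut, LinearMap.mem_ker, Matrix.mulVecLin_apply, funext_iff]
  rfl

theorem linIdeal_cutOut [Infinite K] {u : Fin 2 → Vec K n} (hu : LinearIndependent K u) :
    linIdeal (cutOut u) = Ideal.span (Set.range fun j => linForm (u j)) := by
  apply le_antisymm
  · obtain ⟨w, h00, h01, h10, h11⟩ := exists_dual_pair hu
    refine (linIdeal_le_span_of_proj (cutOut u) (fun i => X i - (linForm (u 0) * C (w 0 i) +
      linForm (u 1) * C (w 1 i))) fun x => ?_).trans ?_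
    · have e : (fun i => eval x (X i - (linForm (u 0) * C (w 0 i) + linForm (u 1) * C (w 1 i)))) =
          x - ((u 0 ⬝ᵥ x) • w 0 + (u 1 ⬝ᵥ x) • w 1) := by
        ext i; simp
      rw [e, mem_cutOut, Fin.forall_fin_two]
      simp only [dotProduct_sub, dotProduct_add, dotProduct_smul, h00, h01, h10, h11, smul_eq_mul]
      constructor <;> ring
    · rw [Ideal.span_le]
      rintro _ ⟨i, rfl⟩
      simp only [sub_sub_cancel, SetLike.mem_coe]
      exact Ideal.add_mem _ (Ideal.mul_mem_right _ _ (Ideal.subset_span ⟨0, rfl⟩))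
        (Ideal.mul_mem_right _ _ (Ideal.subset_span ⟨1, rfl⟩))
  · rw [Ideal.span_le]
    rintro _ ⟨j, rfl⟩
    refine mem_linIdeal.2 fun x hx => ?_
    rw [eval_linForm]
    exact mem_cutOut.1 hx j

theorem homogeneousComponent_mul_isHomogeneous {σ : Type*} (r q : MvPolynomial σ K) {k : ℕ}
    (hq : q.IsHomogeneous k) (j : ℕ) :
    homogeneousComponent (j + k) (r * q) = homogeneousComponent j r * q := by
  conv_lhs => rw [← sum_homogeneousComponent r, Finset.sum_mul, map_sum]
  have h : ∀ i, homogeneousComponent (j + k) (homogeneousComponent i r * q) =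
      if i = j then homogeneousComponent j r * q else 0 := by
    intro i
    rw [homogeneousComponent_of_mem
      (((homogeneousComponent_isHomogeneous i r).mul hq : _ ∈ homogeneousSubmodule σ K (i + k)))]
    by_cases hij : i = j
    · simp [hij]
    · rw [if_neg (by omega), if_neg hij]
  rw [Finset.sum_congr rfl fun i _ => h i, Finset.sum_ite_eq']
  split_ifs with hj
  · rfl
  · rw [homogeneousComponent_eq_zero j r (by simpa using hj), zero_mul]

theorem gradedPiece_natCast (I : Ideal (Poly K n)) (d : ℕ) :
    gradedPiece I (d : ℤ) = I.restrictScalars K ⊓ homogeneousSubmodule (Fin (n + 1)) K d := rfl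

theorem mem_gradedPiece_natCast {I : Ideal (Poly K n)} {d : ℕ} {f : Poly K n} :
    f ∈ gradedPiece I (d : ℤ) ↔ f ∈ I ∧ f.IsHomogeneous d := Iff.rfl

theorem gradedPiece_of_neg (I : Ideal (Poly K n)) {d : ℤ} (hd : d < 0) : gradedPiece I d = ⊥ := by
  match d, hd with
  | Int.negSucc _, _ => rfl

theorem gradedPiece_mono {I J : Ideal (Poly K n)} (h : I ≤ J) (d : ℤ) :
    gradedPiece I d ≤ gradedPiece J d := by
  match d with
  | Int.ofNat d => exact inf_le_inf_right _ h
  | Int.negSucc _ => exact le_rfl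

instance finite_gradedPiece (I : Ideal (Poly K n)) (d : ℤ) : Module.Finite K (gradedPiece I d) := by
  match d with
  | Int.ofNat d =>
    have : Module.Finite K (homogeneousSubmodule (Fin (n + 1)) K d) :=
      Module.Finite.iff_fg.2 (homogeneousSubmodule_fg (Fin (n + 1)) K d)
    exact Submodule.finiteDimensional_of_le inf_le_right
  | Int.negSucc _ => exact inferInstanceAs (Module.Finite K (⊥ : Submodule K (Poly K n)))

theorem quotDim_add_hdim {I J : Ideal (Poly K n)} (h : J ≤ I) (d : ℤ) :
    quotDim I J d + hdim J d = hdim I d := by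
  rw [quotDim, hdim, hdim, ← Submodule.finrank_quotient_add_finrank
    ((gradedPiece J d).submoduleOf (gradedPiece I d))]
  congr 1
  exact (Submodule.submoduleOfEquivOfLe (gradedPiece_mono h d)).finrank_eq.symm

/-- The graded piece of degree `m + 1` of the `m`-th power of the ideal of a codimension two linear
subspace. -/
theorem gradedPiece_linIdeal_pow [Infinite K] {u : Fin 2 → Vec K n} (hu : LinearIndependent K u)
    (m : ℕ) : gradedPiece (linIdeal (cutOut u) ^ m) ((m + 1 : ℕ) : ℤ) =
      LinearMap.range (powForm m u) := by
  rw [linIdeal_cutOut hu]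
  ext F
  rw [mem_gradedPiece_natCast]
  constructor
  · rintro ⟨hF, hhom⟩
    -- F is a form of degree m in u₀·X and u₁·X with polynomial coefficients. Since F is homogeneous
    -- of degree m + 1, only the linear parts of the coefficients contribute.
    rw [Ideal.mem_span_pow_iff_exists_isHomogeneous] at hF
    obtain ⟨p, hp, rfl⟩ := hF
    rw [← homogeneousComponent_eq_self hhom, eval_eq', map_sum]
    refine Submodule.sum_mem _ fun d hd => ?_
    have hdeg : d 0 + d 1 = m := by
      have := hp (mem_support_iff.1 hd)
      simpa [Finsupp.weight_apply, Finsupp.sum_fintype] using this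
    have hq : (∏ i, linForm (u i) ^ d i : Poly K n).IsHomogeneous m := by
      rw [Fin.prod_univ_two, ← hdeg]
      simpa using ((linForm_isHomogeneous (u 0)).pow (d 0)).mul
        ((linForm_isHomogeneous (u 1)).pow (d 1))
    have e := homogeneousComponent_mul_isHomogeneous (coeff d p) _ hq 1
    rw [add_comm 1 m] at e
    rw [e]
    have hlin := homogeneousComponent_isHomogeneous 1 (coeff d p)
    rw [← mem_homogeneousSubmodule, homogeneousSubmodule_one_eq_span_X,
      Submodule.mem_span_range_iff_exists_fun] at hlin
    obtain ⟨c, hc⟩ := hlin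
    rw [← hc, Finset.sum_mul]
    refine Submodule.sum_mem _ fun i _ => ⟨Pi.single (⟨d 0, by omega⟩, i) (c i), ?_⟩
    rw [powForm, Fintype.linearCombination_apply_single, Fin.prod_univ_two]
    have : m - d 0 = d 1 := by omega
    simp only [this, smul_mul_assoc]
    rw [mul_comm (X i)]
  · rintro ⟨g, rfl⟩
    refine ⟨?_, powForm_isHomogeneous m u g⟩
    rw [powForm, Fintype.linearCombination_apply]
    refine Ideal.sum_mem _ fun p _ => ?_
    rw [smul_eq_C_mul]
    refine Ideal.mul_mem_left _ _ (Ideal.mul_mem_right _ _ ?_)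
    have e : m = (p.1 : ℕ) + (m - p.1) := by omega
    conv_lhs => rw [e, pow_add]
    exact Ideal.mul_mem_mul (Ideal.pow_mem_pow (Ideal.subset_span (Set.mem_range_self 0)) _)
      (Ideal.pow_mem_pow (Ideal.subset_span (Set.mem_range_self 1)) _)

end LinearIdeals

/-! ### Conditions imposed by a set as the rank of its power vectors. -/

section Cones

variable {K : Type*} [Field K] {n : ℕ}

/-- The nonzero vectors that represent a point of `X`. -/
def cone (X : Set (ℙ K (Vec K n))) : Set (Vec K n) :=
  {v | ∃ hv : v ≠ 0, Projectivization.mk K v hv ∈ X}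

theorem rep_mem_cone {X : Set (ℙ K (Vec K n))} {P : ℙ K (Vec K n)} (hP : P ∈ X) : P.rep ∈ cone X :=
  ⟨P.rep_nonzero, by rwa [P.mk_rep]⟩

theorem mem_cone_iff {X : Set (ℙ K (Vec K n))} {v : Vec K n} :
    v ∈ cone X ↔ ∃ P ∈ X, ∃ c : K, c ≠ 0 ∧ v = c • P.rep := by
  constructor
  · rintro ⟨hv, hX⟩
    obtain ⟨a, ha⟩ := Projectivization.exists_smul_eq_mk_rep K v hv
    refine ⟨_, hX, (a⁻¹ : Kˣ), Units.ne_zero _, ?_⟩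
    rw [← ha]
    simp [Units.smul_def, smul_smul]
  · rintro ⟨P, hP, c, hc, rfl⟩
    refine ⟨smul_ne_zero hc P.rep_nonzero, ?_⟩
    convert hP
    conv_rhs => rw [← P.mk_rep]
    rw [Projectivization.mk_eq_mk_iff']
    exact ⟨c, rfl⟩

theorem mem_projIdeal {X : Set (ℙ K (Vec K n))} {f : Poly K n} :
    f ∈ projIdeal X ↔ ∀ x ∈ cone X, eval x f = 0 := by
  simp [projIdeal, mem_vanishingIdeal_iff, aeval_eq_eval, cone]

theorem eval_smul_of_isHomogeneous {f : Poly K n} {d : ℕ} (hf : f.IsHomogeneous d) (c : K)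
    (x : Vec K n) : eval (c • x) f = c ^ d * eval x f := by
  simp only [eval_eq', Finset.mul_sum]
  refine Finset.sum_congr rfl fun e he => ?_
  have := hf (mem_support_iff.1 he)
  have hdeg : ∑ i, e i = d := by
    rw [← this]; simp [Finsupp.weight_apply, Finsupp.sum_fintype]
  simp only [Pi.smul_apply, smul_eq_mul, mul_pow, Finset.prod_mul_distrib]
  rw [Finset.prod_pow_eq_pow_sum, hdeg]
  ring

theorem mem_projIdeal_of_isHomogeneous {X : Set (ℙ K (Vec K n))} {f : Poly K n} {d : ℕ}
    (hf : f.IsHomogeneous d) : f ∈ projIdeal X ↔ ∀ P ∈ X, eval P.rep f = 0 := by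
  rw [mem_projIdeal]
  constructor
  · intro h P hP; exact h _ (rep_mem_cone hP)
  · intro h x hx
    obtain ⟨P, hP, c, -, rfl⟩ := mem_cone_iff.1 hx
    rw [eval_smul_of_isHomogeneous hf, h P hP, mul_zero]

theorem projIdeal_anti {X Y : Set (ℙ K (Vec K n))} (h : X ⊆ Y) : projIdeal Y ≤ projIdeal X :=
  vanishingIdeal_anti_mono fun _ ⟨hv, hX⟩ => ⟨hv, h hX⟩

theorem projIdeal_univ [Infinite K] : projIdeal (Set.univ : Set (ℙ K (Vec K n))) = ⊥ := by
  rw [eq_bot_iff]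
  intro f hf
  rw [mem_projIdeal] at hf
  have : f * X 0 = 0 := by
    refine MvPolynomial.funext fun x => ?_
    rw [map_mul, map_zero, eval_X]
    by_cases hx : x = 0
    · simp [hx]
    · rw [hf x ⟨hx, trivial⟩, zero_mul]
  exact (mul_eq_zero.1 this).resolve_right (X_ne_zero 0)

theorem cone_mono {X Y : Set (ℙ K (Vec K n))} (h : X ⊆ Y) : cone X ⊆ cone Y :=
  fun _ ⟨hv, hX⟩ => ⟨hv, h hX⟩

theorem powVec_smul (m : ℕ) (u : Fin 2 → Vec K n) (c : K) (x : Vec K n) :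
    powVec m u (c • x) = c ^ (m + 1) • powVec m u x := by
  ext p
  simp only [powVec, dotProduct_smul, smul_eq_mul, Pi.smul_apply, mul_pow]
  have : c ^ (m + 1) = c ^ (p.1 : ℕ) * c ^ (m - p.1) * c := by
    rw [← pow_add, ← pow_succ]; congr 2; omega
  rw [this]; ring

theorem span_powVec_cone (m : ℕ) (u : Fin 2 → Vec K n) (X : Set (ℙ K (Vec K n))) :
    Submodule.span K (powVec m u '' cone X) =
      Submodule.span K ((fun P : ℙ K (Vec K n) => powVec m u P.rep) '' X) := by
  apply le_antisymm
  · rw [Submodule.span_le]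
    rintro _ ⟨x, hx, rfl⟩
    obtain ⟨P, hP, c, -, rfl⟩ := mem_cone_iff.1 hx
    rw [powVec_smul]
    exact Submodule.smul_mem _ _ (Submodule.subset_span ⟨P, hP, rfl⟩)
  · refine Submodule.span_mono ?_
    rintro _ ⟨P, hP, rfl⟩
    exact ⟨_, rep_mem_cone hP, rfl⟩

theorem finrank_orthogonal_add {ι : Type*} [Fintype ι] [DecidableEq ι] (S : Set (ι → K))
    (N : Submodule K (ι → K)) (hN : ∀ g, g ∈ N ↔ ∀ x ∈ S, g ⬝ᵥ x = 0) :
    Module.finrank K (Submodule.span K S) + Module.finrank K N = Fintype.card ι := by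
  have h1 := Subspace.finrank_add_finrank_dualAnnihilator_eq (Submodule.span K S)
  have h2 : N.map (dotProductEquiv K ι : (ι → K) →ₗ[K] Module.Dual K (ι → K)) =
      (Submodule.span K S).dualAnnihilator := by
    ext f
    rw [Submodule.mem_dualAnnihilator]
    constructor
    · rintro ⟨g, hg, rfl⟩ x hx
      induction hx using Submodule.span_induction with
      | mem x hx => exact (hN g).1 hg x hx
      | zero => simp
      | add a b _ _ ha hb => rw [map_add, ha, hb, add_zero]
      | smul c a _ ha => rw [map_smul, ha, smul_zero]
    · intro hf
      refine ⟨(dotProductEquiv K ι).symm f, (hN _).2 fun x hx => ?_, by simp⟩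
      have := hf x (Submodule.subset_span hx)
      rw [← (dotProductEquiv K ι).apply_symm_apply f] at this
      exact this
  rw [← h2, LinearEquiv.finrank_map_eq, Module.finrank_fintype_fun_eq_card] at h1
  exact h1

/-- The number of conditions that `X` imposes on forms of degree `m + 1` with multiplicity `m` along
a codimension two linear subspace. -/
theorem quotDim_linIdeal_pow [Infinite K] {u : Fin 2 → Vec K n} (hu : LinearIndependent K u) (m : ℕ)
    (X : Set (ℙ K (Vec K n))) :
    quotDim (linIdeal (cutOut u) ^ m) (projIdeal X ⊓ linIdeal (cutOut u) ^ m) ((m + 1 : ℕ) : ℤ) =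
      Module.finrank K (Submodule.span K (powVec m u '' cone X)) := by
  set W := gradedPiece (linIdeal (cutOut u) ^ m) ((m + 1 : ℕ) : ℤ) with hW
  set J := gradedPiece (projIdeal X ⊓ linIdeal (cutOut u) ^ m) ((m + 1 : ℕ) : ℤ) with hJ
  have h1 := quotDim_add_hdim (I := linIdeal (cutOut u) ^ m)
    (J := projIdeal X ⊓ linIdeal (cutOut u) ^ m) inf_le_right ((m + 1 : ℕ) : ℤ)
  rw [hdim, hdim, ← hW, ← hJ] at h1
  have hWr : W = LinearMap.range (powForm m u) := gradedPiece_linIdeal_pow hu m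
  have hJW : J ≤ W := gradedPiece_mono inf_le_right _
  -- `powForm` need not be injective, so dimensions are compared upstairs: the preimages of W and J
  -- contain the same kernel, which cancels, and the preimage of J is the orthogonal complement of
  -- the power vectors.
  have h2 := finrank_map_add_finrank_inf_ker ⊤ (powForm m u)
  have h3 := finrank_map_add_finrank_inf_ker (J.comap (powForm m u)) (powForm m u)
  rw [Submodule.map_comap_eq, ← hWr, inf_eq_right.2 hJW, inf_eq_right.2
    (LinearMap.ker_le_comap _)] at h3
  rw [Submodule.map_top, ← hWr, top_inf_eq, finrank_top,
    Module.finrank_fintype_fun_eq_card] at h2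
  have h4 := finrank_orthogonal_add (powVec m u '' cone X) (J.comap (powForm m u)) (by
    intro g
    rw [Submodule.mem_comap, Set.forall_mem_image]
    simp only [← eval_powForm]
    rw [← mem_projIdeal]
    refine ⟨fun h => (mem_gradedPiece_natCast.1 h).1.1, fun h => ?_⟩
    have hin : powForm m u g ∈ W := by rw [hWr]; exact ⟨g, rfl⟩
    exact mem_gradedPiece_natCast.2 ⟨⟨h, (mem_gradedPiece_natCast.1 hin).1⟩,
      powForm_isHomogeneous m u g⟩)
  omega

theorem span_powVec_cone_univ (m : ℕ) (u : Fin 2 → Vec K n) :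
    Submodule.span K (powVec m u '' cone Set.univ) =
      Submodule.span K (powVec m u '' ((⊤ : Submodule K (Vec K n)) : Set (Vec K n))) := by
  apply le_antisymm
  · exact Submodule.span_mono (Set.image_mono fun _ _ => trivial)
  · rw [Submodule.span_le]
    rintro _ ⟨x, -, rfl⟩
    by_cases hx : x = 0
    · have : powVec m u x = 0 := by ext; simp [powVec, hx]
      rw [this]; exact Submodule.zero_mem _
    · exact Submodule.subset_span ⟨x, ⟨hx, trivial⟩, rfl⟩

/-- Only the zero form vanishes on all of ℙⁿ, so the dimension is the number of conditions imposed
by the whole space, namely (m + 1)(n + 1) - m. -/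
theorem hdim_linIdeal_pow [Infinite K] {u : Fin 2 → Vec K n} (hu : LinearIndependent K u) (m : ℕ) :
    hdim (linIdeal (cutOut u) ^ m) ((m + 1 : ℕ) : ℤ) = n * (m + 1) + 1 := by
  have h1 := quotDim_add_hdim (I := linIdeal (cutOut u) ^ m)
    (J := projIdeal Set.univ ⊓ linIdeal (cutOut u) ^ m) inf_le_right ((m + 1 : ℕ) : ℤ)
  rw [quotDim_linIdeal_pow hu, span_powVec_cone_univ] at h1
  obtain ⟨w, h00, h01, h10, h11⟩ := exists_dual_pair hu
  have h2 := finrank_span_powVec_submodule m u ⊤ (b₀ := w 0) (b₁ := w 1) trivial trivial h00 h10 h11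
  have h3 : hdim (projIdeal Set.univ ⊓ linIdeal (cutOut u) ^ m) ((m + 1 : ℕ) : ℤ) = 0 := by
    have : gradedPiece (⊥ : Ideal (Poly K n)) ((m + 1 : ℕ) : ℤ) = ⊥ := by
      rw [gradedPiece_natCast, eq_bot_iff]; exact inf_le_left
    rw [projIdeal_univ, bot_inf_eq, hdim, this, finrank_bot]
  rw [finrank_top, Module.finrank_fintype_fun_eq_card, Fintype.card_fin] at h2
  rw [h3] at h1
  have : (m + 1) * (n + 1) = n * (m + 1) + 1 + m := by ring
  omega

end Cones
end UnexpectedHypersurfaces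

namespace UnexpectedHypersurfaces

/-! ### Restriction to a line and the passage from vector fields to forms. -/

section Restriction

variable {K : Type*} [Field K] {n : ℕ}

theorem exists_dotProduct_eq_one {z : Vec K n} (hz : z ≠ 0) : ∃ e : Vec K n, z ⬝ᵥ e = 1 := by
  obtain ⟨i, hi⟩ := Function.ne_iff.1 hz
  exact ⟨Pi.single i (z i)⁻¹, by
    rw [dotProduct_single]; exact mul_inv_cancel₀ hi⟩

theorem linForm_dvd_iff [Infinite K] {z : Vec K n} (hz : z ≠ 0) {f : Poly K n} :
    linForm z ∣ f ↔ ∀ x, z ⬝ᵥ x = 0 → eval x f = 0 := by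
  constructor
  · rintro ⟨c, rfl⟩ x hx
    rw [map_mul, eval_linForm, hx, zero_mul]
  · intro h
    obtain ⟨e, he⟩ := exists_dotProduct_eq_one hz
    have hf : f ∈ linIdeal (LinearMap.ker (dotForm z)) := mem_linIdeal.2 fun x hx => h x hx
    have := linIdeal_le_span_of_proj (LinearMap.ker (dotForm z))
      (fun i => X i - linForm z * C (e i)) (fun x => by
        have e1 : (fun i => eval x (X i - linForm z * C (e i))) = x - (z ⬝ᵥ x) • e := by
          ext i; simp
        rw [e1, LinearMap.mem_ker, dotForm_apply, dotProduct_sub, dotProduct_smul, he, smul_eq_mul,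
          mul_one, sub_self]) hf
    rw [← Ideal.mem_span_singleton]
    refine (Ideal.span_le.2 ?_ : _ ≤ Ideal.span {linForm z}) this
    rintro _ ⟨i, rfl⟩
    simp only [sub_sub_cancel, SetLike.mem_coe]
    exact Ideal.mem_span_singleton.2 (dvd_mul_right _ _)

theorem linForm_ne_zero {z : Vec K n} (hz : z ≠ 0) : linForm z ≠ 0 := by
  obtain ⟨e, he⟩ := exists_dotProduct_eq_one hz
  intro h
  have := eval_linForm z e
  rw [h, map_zero, he] at this
  exact zero_ne_one this

/-- Restriction of polynomials to the plane spanned by `u`, in coordinates. -/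
noncomputable def res (u : Fin 2 → Vec K n) : Poly K n →ₐ[K] Poly K 1 :=
  aeval fun i => linForm (n := 1) ![u 0 i, u 1 i]

/-- Substitution of the linear forms `u₁·X` and `-u₀·X`. -/
noncomputable def pencilHom (u : Fin 2 → Vec K n) : Poly K 1 →ₐ[K] Poly K n :=
  aeval ![linForm (u 1), -linForm (u 0)]

theorem eval_res (u : Fin 2 → Vec K n) (c : Vec K 1) (f : Poly K n) :
    eval c (res u f) = eval (c 0 • u 0 + c 1 • u 1) f := by
  have : (eval c : Poly K 1 →+* K).comp (res u : Poly K n →+* Poly K 1) =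
      eval (c 0 • u 0 + c 1 • u 1) := by
    refine MvPolynomial.ringHom_ext (fun r => by simp) fun i => ?_
    simp [res, dotProduct]
    ring
  exact RingHom.congr_fun this f

theorem eval_pencilHom (u : Fin 2 → Vec K n) (x : Vec K n) (b : Poly K 1) :
    eval x (pencilHom u b) = eval ![u 1 ⬝ᵥ x, -(u 0 ⬝ᵥ x)] b := by
  have : (eval x : Poly K n →+* K).comp (pencilHom u : Poly K 1 →+* Poly K n) =
      eval ![u 1 ⬝ᵥ x, -(u 0 ⬝ᵥ x)] := by
    refine MvPolynomial.ringHom_ext (fun r => by simp) fun i => ?_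
    fin_cases i <;> simp [pencilHom]
  exact RingHom.congr_fun this b

theorem mem_span_range_pair {u : Fin 2 → Vec K n} {x : Vec K n} :
    x ∈ Submodule.span K (Set.range u) ↔ ∃ c : Vec K 1, c 0 • u 0 + c 1 • u 1 = x := by
  rw [Submodule.mem_span_range_iff_exists_fun]
  exact exists_congr fun c => by rw [Fin.sum_univ_two]

theorem res_eq_zero_iff [Infinite K] {u : Fin 2 → Vec K n} {f : Poly K n} :
    res u f = 0 ↔ f ∈ linIdeal (Submodule.span K (Set.range u)) := by
  rw [mem_linIdeal]
  constructor
  · rintro h x hx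
    obtain ⟨c, rfl⟩ := mem_span_range_pair.1 hx
    rw [← eval_res, h, map_zero]
  · intro h
    refine MvPolynomial.funext fun c => ?_
    rw [eval_res, map_zero]
    exact h _ (mem_span_range_pair.2 ⟨c, rfl⟩)

theorem res_linForm [Infinite K] (u : Fin 2 → Vec K n) (z : Vec K n) :
    res u (linForm z) = linForm (n := 1) ![u 0 ⬝ᵥ z, u 1 ⬝ᵥ z] := by
  refine MvPolynomial.funext fun c => ?_
  rw [eval_res, eval_linForm, eval_linForm, dotProduct_add, dotProduct_smul, dotProduct_smul,
    dotProduct_comm z, dotProduct_comm z]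
  simp [dotProduct, Fin.sum_univ_two, mul_comm]

theorem res_isHomogeneous (u : Fin 2 → Vec K n) {f : Poly K n} {k : ℕ} (hf : f.IsHomogeneous k) :
    (res u f).IsHomogeneous k := by
  have := hf.aeval (fun i => linForm (n := 1) ![u 0 i, u 1 i])
    (fun i => linForm_isHomogeneous (n := 1) _)
  simpa [res] using this

theorem pencilHom_isHomogeneous (u : Fin 2 → Vec K n) {f : Poly K 1} {k : ℕ}
    (hf : f.IsHomogeneous k) : (pencilHom u f).IsHomogeneous k := by
  have := hf.aeval ![linForm (u 1), -linForm (u 0)] (n := 1) (fun i => by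
    fin_cases i
    · exact linForm_isHomogeneous _
    · exact (linForm_isHomogeneous _).neg)
  simpa [pencilHom] using this

/-- A section of `res u`, given by a pair of vectors dual to `u`. -/
noncomputable def sec (w : Fin 2 → Vec K n) : Poly K 1 →ₐ[K] Poly K n :=
  aeval fun j => linForm (w j)

/-- `w` is a pair of vectors dual to `u`. -/
def IsDualPair (u w : Fin 2 → Vec K n) : Prop :=
  u 0 ⬝ᵥ w 0 = 1 ∧ u 0 ⬝ᵥ w 1 = 0 ∧ u 1 ⬝ᵥ w 0 = 0 ∧ u 1 ⬝ᵥ w 1 = 1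

variable {u w : Fin 2 → Vec K n}

theorem res_sec [Infinite K] (h : IsDualPair u w) (b : Poly K 1) : res u (sec w b) = b := by
  have : (res u).comp (sec w) = AlgHom.id K _ := by
    ext1 j
    simp only [AlgHom.comp_apply, sec, aeval_X, AlgHom.id_apply, res_linForm]
    obtain ⟨h00, h01, h10, h11⟩ := h
    fin_cases j
    · simp [linForm, Fin.sum_univ_two, h00, h10]
    · simp [linForm, Fin.sum_univ_two, h01, h11]
  exact AlgHom.congr_fun this b

theorem pencilHom_injective [Infinite K] (h : IsDualPair u w) :
    Function.Injective (pencilHom u) := by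
  rw [injective_iff_map_eq_zero]
  intro b hb
  refine MvPolynomial.funext fun c => ?_
  have := eval_pencilHom u (c 0 • w 1 - c 1 • w 0) b
  obtain ⟨h00, h01, h10, h11⟩ := h
  rw [hb, map_zero] at this
  rw [map_zero, this]
  congr 2
  ext j
  fin_cases j
  · simp [dotProduct_sub, dotProduct_smul, h10, h11]
  · simp [dotProduct_sub, dotProduct_smul, h00, h01]

/-- The form `∑ g_i(u₁·X, -u₀·X) X_i` attached to a derivation along the line spanned by `u`. -/
noncomputable def dualForm (u : Fin 2 → Vec K n) (g : Fin (n + 1) → Poly K 1) : Poly K n :=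
  ∑ i, pencilHom u (g i) * X i

theorem dualForm_add (g g' : Fin (n + 1) → Poly K 1) :
    dualForm u (g + g') = dualForm u g + dualForm u g' := by
  simp [dualForm, add_mul, Finset.sum_add_distrib]

theorem dualForm_smul (b : Poly K 1) (g : Fin (n + 1) → Poly K 1) :
    dualForm u (b • g) = pencilHom u b * dualForm u g := by
  simp [dualForm, Finset.mul_sum, mul_assoc]

theorem dualForm_isHomogeneous {g : Fin (n + 1) → Poly K 1} {k : ℕ}
    (hg : ∀ i, (g i).IsHomogeneous k) : (dualForm u g).IsHomogeneous (k + 1) :=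
  IsHomogeneous.sum _ _ _ fun i _ => (pencilHom_isHomogeneous u (hg i)).mul (isHomogeneous_X K i)

theorem eval_dualForm (g : Fin (n + 1) → Poly K 1) (x : Vec K n) :
    eval x (dualForm u g) = ∑ i, eval ![u 1 ⬝ᵥ x, -(u 0 ⬝ᵥ x)] (g i) * x i := by
  simp [dualForm, eval_pencilHom]

theorem X_dvd_of_X_dvd_mul {i j : Fin 2} (hij : i ≠ j) {k : ℕ} {f : Poly K 1}
    (h : (X i : Poly K 1) ^ k ∣ X j ^ k * f) : (X i : Poly K 1) ^ k ∣ f := by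
  have hp : Prime (X i : Poly K 1) := MvPolynomial.X_prime
  refine hp.pow_dvd_of_dvd_mul_left k (fun hd => hij ?_) h
  have := hp.dvd_of_dvd_pow hd
  simpa [MvPolynomial.X_dvd_X] using this

/-- The hypothesis says g(c)·x = 0 whenever the point c of L is orthogonal to x, so g(c) is
proportional to c. Comparing the components along the dual pair gives X₀ γ(w₁) = X₁ γ(w₀), and
coprimality of the two variables makes the factor of proportionality a polynomial. -/
theorem eq_smul_euler_of_dualForm_eq_zero [Infinite K] (h : IsDualPair u w)
    {g : Fin (n + 1) → Poly K 1} (hg : dualForm u g = 0) :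
    ∃ c : Poly K 1, ∀ i, g i = c * res u (X i) := by
  obtain ⟨h00, h01, h10, h11⟩ := h
  let γ : Vec K n → Poly K 1 := fun z => ∑ i, C (z i) * g i
  have hγ : ∀ (a : Vec K 1) (x : Vec K n), u 1 ⬝ᵥ x = a 0 → -(u 0 ⬝ᵥ x) = a 1 →
      eval a (γ x) = 0 := by
    intro a x h0 h1
    have := eval_dualForm (u := u) g x
    rw [hg, map_zero, h0, h1] at this
    have ha : ![a 0, a 1] = a := by ext j; fin_cases j <;> rfl
    rw [ha] at this
    simp only [γ, map_sum, map_mul, eval_C]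
    rw [this]
    exact Finset.sum_congr rfl fun i _ => mul_comm _ _
  have hadd : ∀ x y, γ (x + y) = γ x + γ y := by
    intro x y; simp [γ, add_mul, Finset.sum_add_distrib]
  have hsmul : ∀ (c : K) x, γ (c • x) = C c * γ x := by
    intro c x; simp [γ, Finset.mul_sum, mul_assoc]
  have hsub : ∀ x y, γ (x - y) = γ x - γ y := by
    intro x y; simp [γ, sub_mul, Finset.sum_sub_distrib]
  have e1 : X 0 * γ (w 1) = X 1 * γ (w 0) := by
    refine MvPolynomial.funext fun a => ?_
    have := hγ a (a 0 • w 1 - a 1 • w 0)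
      (by simp [dotProduct_sub, dotProduct_smul, h10, h11])
      (by simp [dotProduct_sub, dotProduct_smul, h00, h01])
    rw [hsub, hsmul, hsmul, map_sub, map_mul, map_mul, eval_C, eval_C, sub_eq_zero] at this
    simpa using this
  -- The difference of z and its projection to the span of w is killed by both u₀ and u₁, so adding
  -- it to x does not move the associated point of the line.
  have e2 : ∀ z, γ z = C (u 0 ⬝ᵥ z) * γ (w 0) + C (u 1 ⬝ᵥ z) * γ (w 1) := by
    intro z
    refine MvPolynomial.funext fun a => ?_
    have e3 := hγ a (a 0 • w 1 - a 1 • w 0)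
      (by simp [dotProduct_sub, dotProduct_smul, h10, h11])
      (by simp [dotProduct_sub, dotProduct_smul, h00, h01])
    have e4 := hγ a (a 0 • w 1 - a 1 • w 0 + (z - ((u 0 ⬝ᵥ z) • w 0 + (u 1 ⬝ᵥ z) • w 1)))
      (by simp [dotProduct_add, dotProduct_sub, dotProduct_smul, h10, h11])
      (by simp [dotProduct_add, dotProduct_sub, dotProduct_smul, h00, h01])
    rw [hadd, map_add, e3, zero_add, hsub, hadd, hsmul, hsmul, map_sub, sub_eq_zero] at e4
    exact e4
  obtain ⟨c, hc⟩ : (X 0 : Poly K 1) ^ 1 ∣ γ (w 0) :=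
    X_dvd_of_X_dvd_mul (i := 0) (j := 1) (by decide) ⟨γ (w 1), by rw [pow_one, pow_one, e1]⟩
  rw [pow_one] at hc
  have hc1 : γ (w 1) = X 1 * c := by
    refine mul_left_cancel₀ (X_ne_zero (0 : Fin 2) : (X 0 : Poly K 1) ≠ 0) ?_
    rw [e1, hc]; ring
  refine ⟨c, fun i => ?_⟩
  have h1 : γ (Pi.single i 1) = g i := by
    simp [γ, Pi.single_apply]
  rw [← h1, e2, hc, hc1, res, aeval_X]
  simp only [dotProduct_single, mul_one, linForm]
  simp
  ring

/-- A form of degree at least `2 k - 1` in two variables lies in the ideal of the `k`-th powers of the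
variables. -/
theorem exists_eq_of_isHomogeneous_two_mul {c : Poly K 1} {k e : ℕ} (hc : c.IsHomogeneous e)
    (he : 2 * k ≤ e + 1) : ∃ c₀ c₁ : Poly K 1, c = X 0 ^ k * c₀ + X 1 ^ k * c₁ := by
  have : c ∈ Ideal.span {(X 0 : Poly K 1) ^ k, X 1 ^ k} := by
    rw [c.as_sum]
    refine Ideal.sum_mem _ fun d hd => ?_
    have hdeg : d 0 + d 1 = e := by
      have := hc (mem_support_iff.1 hd)
      simpa [Finsupp.weight_apply, Finsupp.sum_fintype] using this
    rw [monomial_eq, Finsupp.prod_fintype _ _ (fun _ => pow_zero _), Fin.prod_univ_two]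
    refine Ideal.mul_mem_left _ _ ?_
    rcases le_or_gt k (d 0) with h | h
    · exact Ideal.mul_mem_right _ _ (Ideal.mem_of_dvd _ (pow_dvd_pow _ h)
        (Ideal.subset_span (by simp)))
    · exact Ideal.mul_mem_left _ _ (Ideal.mem_of_dvd _ (pow_dvd_pow _ (by omega : k ≤ d 1))
        (Ideal.subset_span (by simp)))
  obtain ⟨a, b, h⟩ := Ideal.mem_span_pair.1 this
  exact ⟨a, b, by rw [← h]; ring⟩

theorem finrank_gradedPiece_top_one (z : ℤ) :
    Module.finrank K (gradedPiece (⊤ : Ideal (Poly K 1)) z) = (z + 1).toNat := by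
  rcases lt_or_ge z 0 with hz | hz
  · rw [gradedPiece_of_neg _ hz, finrank_bot]; omega
  · obtain ⟨k, rfl⟩ := Int.eq_ofNat_of_zero_le hz
    rw [gradedPiece_natCast]
    have e1 : (⊤ : Ideal (Poly K 1)).restrictScalars K ⊓ homogeneousSubmodule (Fin (1 + 1)) K k =
        homogeneousSubmodule (Fin 2) K k := by simp
    rw [e1, homogeneousSubmodule_eq_finsupp_supported]
    let E : {d : Fin 2 →₀ ℕ | d.degree = k} ≃ Fin (k + 1) :=
      { toFun := fun d => ⟨d.1 0, by
          have := d.2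
          simp only [Set.mem_ofPred_eq, Finsupp.degree_eq_sum, Fin.sum_univ_two] at this
          omega⟩
        invFun := fun j => ⟨Finsupp.equivFunOnFinite.symm ![(j : ℕ), k - j], by
          simp only [Set.mem_ofPred_eq, Finsupp.degree_eq_sum, Fin.sum_univ_two]
          simp
          omega⟩
        left_inv := fun d => by
          have := d.2
          simp only [Set.mem_ofPred_eq, Finsupp.degree_eq_sum, Fin.sum_univ_two] at this
          ext j
          fin_cases j
          · simp
          · simp; omega
        right_inv := fun j => by ext; simp }
    have : Fintype {d : Fin 2 →₀ ℕ | d.degree = k} := Fintype.ofEquiv _ E.symm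
    have e2 := (AddMonoidAlgebra.supportedEquivFinsupp (S := K) (R := K)
      {d : Fin 2 →₀ ℕ | d.degree = k}).finrank_eq
    rw [Module.finrank_finsupp_self] at e2
    have e3 : Fintype.card {d : Fin 2 →₀ ℕ | d.degree = k} = k + 1 := by
      rw [Fintype.card_congr E, Fintype.card_fin]
    rw [e3] at e2
    have : ((k : ℤ) + 1).toNat = k + 1 := by omega
    rw [this, ← e2]

end Restriction
end UnexpectedHypersurfaces

namespace UnexpectedHypersurfaces

/-! ### Derivations of the arrangement near a transverse line. -/

section Derivations

variable {K : Type*} [Field K] {n : ℕ}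

/-- The value `∑ x_i θ_i` of the derivation `θ` on the linear form with coefficients `x`. -/
noncomputable def dotDer (x : Vec K n) : Der K n →ₗ[Poly K n] Poly K n :=
  Fintype.linearCombination (Poly K n) (fun i => (C (x i) : Poly K n))

theorem dotDer_apply (x : Vec K n) (θ : Der K n) : dotDer x θ = ∑ i, θ i * C (x i) := by
  simp [dotDer, Fintype.linearCombination_apply]

theorem toDer_linForm (θ : Der K n) (z : Vec K n) : toDer θ (linForm z) = dotDer z θ := by
  simp [toDer, linForm, dotDer_apply, mkDerivation_X, mul_comm]

theorem mem_hyperplaneIdeal [Infinite K] {P : ℙ K (Vec K n)} {f : Poly K n} :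
    f ∈ hyperplaneIdeal P ↔ linForm P.rep ∣ f := by
  rw [linForm_dvd_iff P.rep_nonzero]
  simp [hyperplaneIdeal, mem_vanishingIdeal_iff, aeval_eq_eval]

/-- The ideal of a hyperplane is principal, so by the Leibniz rule tangency need only be tested on
the defining linear form. -/
theorem mem_arrDer_iff [Infinite K] {Z : Finset (ℙ K (Vec K n))} {θ : Der K n} :
    θ ∈ arrDer Z ↔ ∀ P ∈ Z, linForm P.rep ∣ dotDer P.rep θ := by
  constructor
  · intro h P hP
    rw [← toDer_linForm, ← mem_hyperplaneIdeal]
    exact h P hP _ (mem_hyperplaneIdeal.2 dvd_rfl)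
  · intro h P hP f hf
    rw [mem_hyperplaneIdeal] at hf ⊢
    obtain ⟨c, rfl⟩ := hf
    rw [Derivation.leibniz, toDer_linForm, smul_eq_mul, smul_eq_mul]
    exact dvd_add (dvd_mul_right _ _) ((h P hP).mul_left c)

theorem dotDer_eulerDer (z : Vec K n) : dotDer z (eulerDer K n) = linForm z := by
  simp [dotDer_apply, eulerDer, linForm, mul_comm]

theorem eulerDer_mem_arrDer [Infinite K] (Z : Finset (ℙ K (Vec K n))) : eulerDer K n ∈ arrDer Z :=
  mem_arrDer_iff.2 fun P _ => by rw [dotDer_eulerDer]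

/-- The homogeneous component of degree `j` of a derivation. -/
noncomputable def compDer (j : ℕ) (θ : Der K n) : Der K n := fun i => homogeneousComponent j (θ i)

theorem compDer_isHomogDer (j : ℕ) (θ : Der K n) : IsHomogDer (compDer j θ) j := fun _ =>
  homogeneousComponent_isHomogeneous _ _

theorem linForm_dvd_homogeneousComponent {z : Vec K n} {f : Poly K n} (h : linForm z ∣ f) (j : ℕ) :
    linForm z ∣ homogeneousComponent j f := by
  obtain ⟨c, rfl⟩ := h
  rw [mul_comm]
  cases j with
  | zero =>
    rw [homogeneousComponent_zero, ← constantCoeff_eq, map_mul]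
    have : constantCoeff (linForm z) = 0 := by simp [linForm]
    rw [this]; simp
  | succ j =>
    rw [homogeneousComponent_mul_isHomogeneous _ _ (linForm_isHomogeneous z)]
    exact dvd_mul_left _ _

theorem compDer_mem_arrDer [Infinite K] {Z : Finset (ℙ K (Vec K n))} {θ : Der K n}
    (hθ : θ ∈ arrDer Z) (j : ℕ) : compDer j θ ∈ arrDer Z := by
  rw [mem_arrDer_iff] at hθ ⊢
  intro P hP
  have : dotDer P.rep (compDer j θ) = homogeneousComponent j (dotDer P.rep θ) := by
    simp only [dotDer_apply, compDer, map_sum]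
    refine Finset.sum_congr rfl fun i _ => ?_
    rw [mul_comm (θ i), homogeneousComponent_C_mul, mul_comm]
  rw [this]
  exact linForm_dvd_homogeneousComponent (hθ P hP) j

theorem exists_sum_compDer (θ : Der K n) :
    ∃ N, θ = ∑ j ∈ Finset.range N, compDer j θ ∧ ∀ j, N ≤ j → compDer j θ = 0 := by
  refine ⟨(Finset.univ.sup fun i => (θ i).totalDegree) + 1, ?_, ?_⟩
  · ext1 i
    rw [Finset.sum_apply]
    conv_lhs => rw [← sum_homogeneousComponent (θ i)]
    refine Finset.sum_subset (fun j hj => ?_) fun j _ hj => ?_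
    · have := Finset.le_sup (f := fun i => (θ i).totalDegree) (Finset.mem_univ i)
      simp only [Finset.mem_range] at hj ⊢
      omega
    · exact homogeneousComponent_eq_zero _ _ (by simpa using hj)
  · intro j hj
    ext1 i
    have := Finset.le_sup (f := fun i => (θ i).totalDegree) (Finset.mem_univ i)
    exact homogeneousComponent_eq_zero _ _ (by omega)

open Classical in
/-- The product of the linear forms dual to the points of `Z` other than `P`. -/
noncomputable def otherForms (Z : Finset (ℙ K (Vec K n))) (P : ℙ K (Vec K n)) : Poly K n :=
  ∏ Q ∈ Z.erase P, linForm Q.rep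

theorem otherForms_smul_mem_arrDer [Infinite K] {Z : Finset (ℙ K (Vec K n))} {P : ℙ K (Vec K n)}
    {η : Der K n} (hη : linForm P.rep ∣ dotDer P.rep η) : otherForms Z P • η ∈ arrDer Z := by
  classical
  rw [mem_arrDer_iff]
  intro Q hQ
  rw [map_smul, smul_eq_mul]
  by_cases hQP : Q = P
  · subst hQP; exact hη.mul_left _
  · exact (Finset.dvd_prod_of_mem (fun Q : ℙ K (Vec K n) => linForm Q.rep)
      (Finset.mem_erase.2 ⟨hQP, hQ⟩)).mul_right _

/-- The line spanned by `u` meets the hyperplanes dual to the points of `Z` in distinct points. -/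
def IsTransverse (Z : Finset (ℙ K (Vec K n))) (u : Fin 2 → Vec K n) : Prop :=
  (∀ P ∈ Z, u 0 ⬝ᵥ P.rep ≠ 0 ∨ u 1 ⬝ᵥ P.rep ≠ 0) ∧
    ∀ P ∈ Z, ∀ Q ∈ Z, P ≠ Q →
      (u 0 ⬝ᵥ P.rep) * (u 1 ⬝ᵥ Q.rep) - (u 1 ⬝ᵥ P.rep) * (u 0 ⬝ᵥ Q.rep) ≠ 0

theorem not_linearIndependent_rep {P Q : ℙ K (Vec K n)} (h : P ≠ Q) :
    Q.rep ∉ Submodule.span K {P.rep} := by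
  intro hmem
  obtain ⟨a, ha⟩ := Submodule.mem_span_singleton.1 hmem
  apply h
  rw [← P.mk_rep, ← Q.mk_rep, eq_comm, Projectivization.mk_eq_mk_iff']
  exact ⟨a, ha⟩

theorem forGeneral_isTransverse [Infinite K] (Z : Finset (ℙ K (Vec K n))) :
    ForGeneral 2 fun u : Fin 2 → Vec K n => IsTransverse Z u := by
  refine (ForGeneral.and (P := fun u => ∀ P ∈ Z, u 0 ⬝ᵥ P.rep ≠ 0 ∨ u 1 ⬝ᵥ P.rep ≠ 0)
    (Q := fun u => ∀ P ∈ Z, ∀ Q ∈ Z, P ≠ Q →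
      (u 0 ⬝ᵥ P.rep) * (u 1 ⬝ᵥ Q.rep) - (u 1 ⬝ᵥ P.rep) * (u 0 ⬝ᵥ Q.rep) ≠ 0) ?_ ?_)
  · refine ForGeneral.forall_finset Z fun P _ => ?_
    obtain ⟨e, he⟩ := exists_dotProduct_eq_one P.rep_nonzero
    refine (forGeneral_eval_ne_zero (genDot 0 P.rep) ![e, e] ?_).mono fun u _ hu => Or.inl ?_
    · rw [eval_genDot]
      change e ⬝ᵥ P.rep ≠ 0
      rw [dotProduct_comm, he]; exact one_ne_zero
    · rwa [eval_genDot] at hu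
  · refine ForGeneral.forall_finset Z fun P _ => ForGeneral.forall_finset Z fun Q _ => ?_
    by_cases hPQ : P = Q
    · exact .of_forall fun u _ h => absurd hPQ h
    obtain ⟨a, ha, haQ⟩ := exists_orthogonal_avoiding (Submodule.span K {P.rep}) {Q.rep}
      (by simpa using not_linearIndependent_rep hPQ)
    obtain ⟨e, he⟩ := exists_dotProduct_eq_one P.rep_nonzero
    refine (forGeneral_eval_ne_zero
      (genDot 0 P.rep * genDot 1 Q.rep - genDot 1 P.rep * genDot 0 Q.rep) ![e, a] ?_).mono
      fun u _ hu _ => ?_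
    · simp only [map_sub, map_mul, eval_genDot]
      change (e ⬝ᵥ P.rep) * (a ⬝ᵥ Q.rep) - (a ⬝ᵥ P.rep) * (e ⬝ᵥ Q.rep) ≠ 0
      rw [ha _ (Submodule.mem_span_singleton_self _), dotProduct_comm e, he]
      simpa using haQ _ (by simp)
    · simpa only [map_sub, map_mul, eval_genDot] using hu

variable {u w : Fin 2 → Vec K n} {Z : Finset (ℙ K (Vec K n))}

theorem IsTransverse.res_linForm_ne_zero [Infinite K] (hZ : IsTransverse Z u) {P : ℙ K (Vec K n)}
    (hP : P ∈ Z) : res u (linForm P.rep) ≠ 0 := by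
  rw [res_linForm]
  refine linForm_ne_zero fun h => ?_
  rcases hZ.1 P hP with h0 | h1
  · exact h0 (congrFun h 0)
  · exact h1 (congrFun h 1)

/-- A vector field along the line that is tangent to the arrangement lifts to a derivation of the
arrangement, after multiplication by the forms of the other hyperplanes. -/
theorem exists_arrDer_res_eq_otherForms_mul [Infinite K] (hd : IsDualPair u w)
    {P : ℙ K (Vec K n)} {g : Fin (n + 1) → Poly K 1}
    (hg : res u (linForm P.rep) ∣ ∑ i, g i * C (P.rep i)) :
    ∃ θ ∈ arrDer Z, ∀ i, res u (θ i) = res u (otherForms Z P) * g i := by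
  obtain ⟨c, hc⟩ := hg
  obtain ⟨e, he⟩ := exists_dotProduct_eq_one P.rep_nonzero
  -- b measures the failure of the naive lift to be tangent to the hyperplane of P. It vanishes on
  -- L, so subtracting b times a constant field e with P·e = 1 restores tangency without changing
  -- the restriction. The factor `otherForms Z P` takes care of the other hyperplanes.
  set b : Poly K n := dotDer P.rep (fun i => sec w (g i)) - linForm P.rep * sec w c with hb
  have hb0 : res u b = 0 := by
    rw [hb, map_sub, map_mul, res_sec hd, ← hc, dotDer_apply, map_sum, sub_eq_zero]
    refine Finset.sum_congr rfl fun i _ => ?_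
    rw [map_mul, res_sec hd]
    congr 1
    exact algHom_C _ _
  have he' : ∑ i, C (e i) * C (P.rep i) = (1 : Poly K n) := by
    rw [← C_1, ← he]
    simp [dotProduct, mul_comm]
  refine ⟨_, otherForms_smul_mem_arrDer (P := P)
    (η := fun i => sec w (g i) - b * C (e i)) ?_, fun i => ?_⟩
  · have : dotDer P.rep (fun i => sec w (g i) - b * C (e i)) = linForm P.rep * sec w c := by
      have h1 : (fun i => sec w (g i) - b * C (e i)) =
          (fun i => sec w (g i)) - b • (fun i => C (e i) : Der K n) := rfl
      rw [h1, map_sub, map_smul, smul_eq_mul, dotDer_apply P.rep (fun i => C (e i)), he', mul_one,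
        hb]
      ring
    rw [this]
    exact dvd_mul_right _ _
  · rw [Pi.smul_apply, smul_eq_mul, map_mul, map_sub, map_mul, hb0, res_sec hd, zero_mul, sub_zero]

/-- At a common zero of these products the functional lies on at least two of the hyperplanes, which
transversality forbids for points of L. The only common zero is thus the origin, and the
Nullstellensatz applies. -/
theorem IsTransverse.exists_pow_mem [IsAlgClosed K] (hZ : IsTransverse Z u) (hne : Z.Nonempty) :
    ∃ k₀, ∀ k ≥ k₀, ∀ j : Fin 2, (X j : Poly K 1) ^ k ∈
      Ideal.span ((fun P => res u (otherForms Z P)) '' (Z : Set (ℙ K (Vec K n)))) := by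
  classical
  have : Infinite K := IsAlgClosed.instInfinite
  set I := Ideal.span ((fun P => res u (otherForms Z P)) '' (Z : Set (ℙ K (Vec K n))))
  have hzero : ∀ x ∈ zeroLocus K I, x = 0 := by
    intro x hx
    have hx' : ∀ P ∈ Z, ∃ Q ∈ Z, Q ≠ P ∧ (x 0 • u 0 + x 1 • u 1) ⬝ᵥ Q.rep = 0 := by
      intro P hP
      have := mem_zeroLocus_iff.1 hx _ (Ideal.subset_span ⟨P, hP, rfl⟩)
      rw [aeval_eq_eval] at this
      change eval x (res u (otherForms Z P)) = 0 at this
      rw [eval_res, otherForms, map_prod, Finset.prod_eq_zero_iff] at this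
      obtain ⟨Q, hQ, h0⟩ := this
      exact ⟨Q, (Finset.mem_erase.1 hQ).2, (Finset.mem_erase.1 hQ).1, by
        rw [dotProduct_comm, ← eval_linForm]; exact h0⟩
    obtain ⟨P₀, hP₀⟩ := hne
    obtain ⟨P, hP, -, h1⟩ := hx' P₀ hP₀
    obtain ⟨Q, hQ, hQP, h2⟩ := hx' P hP
    have hdet := hZ.2 P hP Q hQ hQP.symm
    rw [add_dotProduct, smul_dotProduct, smul_dotProduct, smul_eq_mul, smul_eq_mul] at h1 h2
    have e0 : x 0 = 0 := by
      refine (mul_eq_zero.1 (?_ : _ * x 0 = 0)).resolve_left hdet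
      linear_combination (u 1 ⬝ᵥ Q.rep) * h1 - (u 1 ⬝ᵥ P.rep) * h2
    have e1 : x 1 = 0 := by
      refine (mul_eq_zero.1 (?_ : _ * x 1 = 0)).resolve_left hdet
      linear_combination (u 0 ⬝ᵥ P.rep) * h2 - (u 0 ⬝ᵥ Q.rep) * h1
    ext j
    fin_cases j
    · exact e0
    · exact e1
  have hrad : ∀ j : Fin 2, ∃ k, (X j : Poly K 1) ^ k ∈ I := by
    intro j
    have : (X j : Poly K 1) ∈ I.radical := by
      rw [← vanishingIdeal_zeroLocus_eq_radical (K := K) I, mem_vanishingIdeal_iff]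
      intro x hx
      rw [aeval_X, hzero x hx, Pi.zero_apply]
    exact this
  choose k hk using hrad
  refine ⟨max (k 0) (k 1), fun l hl j => ?_⟩
  refine Ideal.mem_of_dvd _ (pow_dvd_pow _ (?_ : k j ≤ l)) (hk j)
  fin_cases j
  · exact (le_max_left _ _).trans hl
  · exact (le_max_right _ _).trans hl

/-- Near any point of L at most one hyperplane matters, so lifts exist locally. Algebraically, the
multipliers for which a lift can be built this way form an ideal that contains large powers of both
variables. Thus tangent fields along L are restrictions of derivations, as sheaves. -/
theorem IsTransverse.exists_arrDer_res_eq_pow_mul [IsAlgClosed K] (hd : IsDualPair u w)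
    (hZ : IsTransverse Z u) (hne : Z.Nonempty) :
    ∃ k₀, ∀ k ≥ k₀, ∀ j : Fin 2, ∀ g : Fin (n + 1) → Poly K 1,
      (∀ P ∈ Z, res u (linForm P.rep) ∣ ∑ i, g i * C (P.rep i)) →
      ∃ θ ∈ arrDer Z, ∀ i, res u (θ i) = X j ^ k * g i := by
  have : Infinite K := IsAlgClosed.instInfinite
  obtain ⟨k₀, hk₀⟩ := hZ.exists_pow_mem hne
  refine ⟨k₀, fun k hk j g hg => ?_⟩
  have hmem := hk₀ k hk j
  have hsub : ∀ f ∈ Ideal.span ((fun P => res u (otherForms Z P)) '' (Z : Set (ℙ K (Vec K n)))),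
      ∃ θ ∈ arrDer Z, ∀ i, res u (θ i) = f * g i := by
    intro f hf
    induction hf using Submodule.span_induction with
    | mem f hf =>
      obtain ⟨P, hP, rfl⟩ := hf
      exact exists_arrDer_res_eq_otherForms_mul hd (hg P hP)
    | zero => exact ⟨0, Submodule.zero_mem _, by simp⟩
    | add a b _ _ ha hb =>
      obtain ⟨θ, hθ, h1⟩ := ha
      obtain ⟨θ', hθ', h2⟩ := hb
      exact ⟨θ + θ', Submodule.add_mem _ hθ hθ', fun i => by
        rw [Pi.add_apply, map_add, h1, h2, add_mul]⟩
    | smul c a _ ha =>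
      obtain ⟨θ, hθ, h1⟩ := ha
      exact ⟨sec w c • θ, Submodule.smul_mem _ _ hθ, fun i => by
        rw [Pi.smul_apply, smul_eq_mul, map_mul, h1, res_sec hd, smul_eq_mul, mul_assoc]⟩
  exact hsub _ hmem

/-- A derivation of the arrangement that vanishes along the line becomes a combination of derivations
of the arrangement with coefficients in the ideal of the line, after multiplication by the forms of
all hyperplanes but one. -/
theorem exists_otherForms_smul_eq_sum [Infinite K] (hd : IsDualPair u w) (hZ : IsTransverse Z u)
    {P : ℙ K (Vec K n)} (hP : P ∈ Z) {θ : Der K n} (hθ : θ ∈ arrDer Z)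
    (h0 : ∀ i, res u (θ i) = 0) :
    ∃ (l : Fin (n + 1) → Poly K n) (η : Fin (n + 1) → Der K n), (∀ j, res u (l j) = 0) ∧
      (∀ j, η j ∈ arrDer Z) ∧ otherForms Z P • θ = ∑ j, l j • η j := by
  set l : Fin (n + 1) → Poly K n := fun j => X j - sec w (res u (X j)) with hl
  have hl0 : ∀ j, res u (l j) = 0 := fun j => by
    rw [hl, map_sub, res_sec hd, sub_self]
  have hgen : ∀ f : Poly K n, res u f = 0 → ∃ c : Fin (n + 1) → Poly K n, ∑ j, c j * l j = f := by
    intro f hf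
    have := linIdeal_le_span_of_proj (Submodule.span K (Set.range u))
      (fun j => sec w (res u (X j))) (fun x => by
        rw [mem_span_range_pair]
        refine ⟨fun j => w j ⬝ᵥ x, ?_⟩
        have hs : ∀ b : Poly K 1, eval x (sec w b) = eval (fun j => w j ⬝ᵥ x) b := by
          intro b
          have : (eval x : Poly K n →+* K).comp (sec w : Poly K 1 →+* Poly K n) =
              eval (fun j => w j ⬝ᵥ x) :=
            MvPolynomial.ringHom_ext (fun r => by simp [sec]) fun j => by simp [sec]
          exact RingHom.congr_fun this b
        ext j
        rw [hs, eval_res, eval_X]) (res_eq_zero_iff.1 hf)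
    exact Ideal.mem_span_range_iff_exists_fun.1 this
  choose c hc using fun i => hgen (θ i) (h0 i)
  obtain ⟨q, hq⟩ := mem_arrDer_iff.1 hθ P hP
  have hq0 : res u q = 0 := by
    have : res u (linForm P.rep) * res u q = 0 := by
      rw [← map_mul, ← hq, dotDer_apply, map_sum]
      exact Finset.sum_eq_zero fun i _ => by rw [map_mul, h0, zero_mul]
    exact (mul_eq_zero.1 this).resolve_left (hZ.res_linForm_ne_zero hP)
  obtain ⟨a, ha⟩ := hgen q hq0
  obtain ⟨e, he⟩ := exists_dotProduct_eq_one P.rep_nonzero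
  have he' : dotDer P.rep (fun i => C (e i) : Der K n) = 1 := by
    rw [← C_1, ← he, dotDer_apply]
    simp [dotProduct, mul_comm]
  -- Expand θ with coefficients `l j` in the ideal of L and arbitrary fields `κ j`, then correct
  -- each `κ j` along e to make it tangent to the hyperplane of P. The quotient q also vanishes on
  -- L; expanding it in the same generators makes the corrections cancel in the sum.
  let κ : Fin (n + 1) → Der K n := fun j i => c i j
  let η : Fin (n + 1) → Der K n := fun j =>
    κ j - (dotDer P.rep (κ j) - linForm P.rep * a j) • (fun i => C (e i) : Der K n)
  have hη : ∀ j, dotDer P.rep (η j) = linForm P.rep * a j := by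
    intro j
    simp only [η]
    rw [map_sub, map_smul, he', smul_eq_mul, mul_one, sub_sub_cancel]
  have hκ : ∑ j, l j • κ j = θ := by
    ext1 i
    rw [Finset.sum_apply, ← hc i]
    exact Finset.sum_congr rfl fun j _ => by simp [κ, mul_comm]
  have hsum : ∑ j, l j • η j = θ := by
    simp only [η, smul_sub, Finset.sum_sub_distrib, hκ, sub_eq_self, smul_smul, ← Finset.sum_smul]
    have : ∑ j, l j * (dotDer P.rep (κ j) - linForm P.rep * a j) = 0 := by
      simp only [mul_sub, Finset.sum_sub_distrib]
      have e1 : ∑ j, l j * dotDer P.rep (κ j) = dotDer P.rep θ := by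
        rw [← hκ, map_sum]; simp
      have e2 : ∑ j, l j * (linForm P.rep * a j) = linForm P.rep * q := by
        rw [← ha, Finset.mul_sum]
        exact Finset.sum_congr rfl fun j _ => by ring
      rw [e1, e2, hq, sub_self]
    rw [this, zero_smul]
  refine ⟨l, fun j => otherForms Z P • η j, hl0, fun j => otherForms_smul_mem_arrDer
    ⟨a j, hη j⟩, ?_⟩
  conv_lhs => rw [← hsum, Finset.smul_sum]
  exact Finset.sum_congr rfl fun j _ => smul_comm _ _ _

end Derivations
end UnexpectedHypersurfaces

namespace UnexpectedHypersurfaces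

/-! ### Homogeneous components and integer-indexed graded pieces. -/

section Components

variable {K : Type*} [Field K] {n : ℕ}

theorem ext_homogeneousComponent {σ : Type*} {p q : MvPolynomial σ K}
    (h : ∀ j, homogeneousComponent j p = homogeneousComponent j q) : p = q := by
  ext d
  have := congrArg (coeff d) (h d.degree)
  simpa [coeff_homogeneousComponent] using this

theorem homogeneousComponent_eq_ite {σ : Type*} {p : MvPolynomial σ K} {k : ℕ} (hp : p.IsHomogeneous k)
    (j : ℕ) : homogeneousComponent j p = if k = j then p else 0 := by
  rw [homogeneousComponent_of_mem hp]
  simp only [eq_comm]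

theorem homogeneousComponent_algHom {σ τ : Type*} (f : MvPolynomial σ K →ₐ[K] MvPolynomial τ K)
    (hf : ∀ p k, p.IsHomogeneous k → (f p).IsHomogeneous k) (p : MvPolynomial σ K) (j : ℕ) :
    homogeneousComponent j (f p) = f (homogeneousComponent j p) := by
  conv_lhs => rw [← sum_homogeneousComponent p, map_sum, map_sum]
  have h : ∀ i, homogeneousComponent j (f (homogeneousComponent i p)) =
      if i = j then f (homogeneousComponent j p) else 0 := by
    intro i
    rw [homogeneousComponent_eq_ite (hf _ i (homogeneousComponent_isHomogeneous i p))]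
    split_ifs with h
    · rw [h]
    · rfl
  rw [Finset.sum_congr rfl fun i _ => h i, Finset.sum_ite_eq']
  split_ifs with hj
  · rfl
  · rw [homogeneousComponent_eq_zero j p (by simpa using hj), map_zero]

theorem homogeneousComponent_dualForm (u : Fin 2 → Vec K n) (g : Fin (n + 1) → Poly K 1) (m : ℕ) :
    homogeneousComponent (m + 1) (dualForm u g) =
      dualForm u fun i => homogeneousComponent m (g i) := by
  simp only [dualForm, map_sum]
  refine Finset.sum_congr rfl fun i _ => ?_
  rw [homogeneousComponent_mul_isHomogeneous _ _ (isHomogeneous_X K i),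
    homogeneousComponent_algHom _ fun p k hp => pencilHom_isHomogeneous u hp]

theorem mem_gradedPiece_top_iff {q : Poly K n} {z : ℤ} :
    q ∈ gradedPiece (⊤ : Ideal (Poly K n)) z ↔
      ∀ j : ℕ, (j : ℤ) ≠ z → homogeneousComponent j q = 0 := by
  rcases lt_or_ge z 0 with hz | hz
  · rw [gradedPiece_of_neg _ hz, Submodule.mem_bot]
    constructor
    · rintro rfl j _; exact map_zero _
    · intro h
      exact ext_homogeneousComponent fun j => by rw [h j (by omega), map_zero]
  · obtain ⟨k, rfl⟩ := Int.eq_ofNat_of_zero_le hz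
    rw [mem_gradedPiece_natCast]
    constructor
    · rintro ⟨-, hq⟩ j hj
      rw [homogeneousComponent_eq_ite hq, if_neg (by omega)]
    · intro h
      refine ⟨trivial, ?_⟩
      have : q = homogeneousComponent k q := by
        refine ext_homogeneousComponent fun j => ?_
        rw [homogeneousComponent_eq_ite (homogeneousComponent_isHomogeneous k q)]
        split_ifs with hj
        · rw [hj]
        · exact h j (by omega)
      rw [this]
      exact homogeneousComponent_isHomogeneous k q

theorem mem_gradedPiece_top_of_pow_mul {y : Poly K 1} {j : Fin 2} {k : ℕ} {z : ℤ}
    (h : X j ^ k * y ∈ gradedPiece (⊤ : Ideal (Poly K 1)) (z + k)) :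
    y ∈ gradedPiece (⊤ : Ideal (Poly K 1)) z := by
  rw [mem_gradedPiece_top_iff] at h ⊢
  intro i hi
  have h1 := h (i + k) (by push_cast; omega)
  rw [mul_comm, homogeneousComponent_mul_isHomogeneous _ _ (isHomogeneous_X_pow j k)] at h1
  exact (mul_eq_zero.1 h1).resolve_right (pow_ne_zero _ (X_ne_zero j))

theorem pow_mul_mem_gradedPiece_top {y : Poly K 1} {z : ℤ}
    (h : y ∈ gradedPiece (⊤ : Ideal (Poly K 1)) z) (j : Fin 2) (k : ℕ) :
    X j ^ k * y ∈ gradedPiece (⊤ : Ideal (Poly K 1)) (z + k) := by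
  rcases lt_or_ge z 0 with hz | hz
  · rw [gradedPiece_of_neg _ hz, Submodule.mem_bot] at h
    rw [h, mul_zero]; exact Submodule.zero_mem _
  · obtain ⟨l, rfl⟩ := Int.eq_ofNat_of_zero_le hz
    have := (isHomogeneous_X_pow (R := K) j k).mul h.2
    rw [add_comm k l] at this
    exact mem_gradedPiece_natCast.2 ⟨trivial, this⟩

end Components

/-! ### Forms with multiplicity along Q versus vector fields along L. -/

section DualForms

variable {K : Type*} [Field K] {n : ℕ} {u w : Fin 2 → Vec K n} {Z : Finset (ℙ K (Vec K n))}

theorem dualForm_mem_gradedPiece [Infinite K] (hu : LinearIndependent K u)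
    {g : Fin (n + 1) → Poly K 1} {m : ℕ} (hg : ∀ i, (g i).IsHomogeneous m) :
    dualForm u g ∈ gradedPiece (linIdeal (cutOut u) ^ m) ((m + 1 : ℕ) : ℤ) := by
  refine mem_gradedPiece_natCast.2 ⟨?_, dualForm_isHomogeneous hg⟩
  refine Ideal.sum_mem _ fun i _ => Ideal.mul_mem_right _ _ ?_
  rw [linIdeal_cutOut hu, (g i).as_sum, map_sum]
  refine Ideal.sum_mem _ fun d hd => ?_
  have hdeg : d 0 + d 1 = m := by
    have := hg i (mem_support_iff.1 hd)
    simpa [Finsupp.weight_apply, Finsupp.sum_fintype] using this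
  rw [monomial_eq, Finsupp.prod_fintype _ _ (fun _ => pow_zero _), Fin.prod_univ_two, map_mul]
  refine Ideal.mul_mem_left _ _ ?_
  rw [map_mul, map_pow, map_pow, ← hdeg, pow_add]
  refine Ideal.mul_mem_mul (Ideal.pow_mem_pow ?_ _) (Ideal.pow_mem_pow ?_ _)
  · simp only [pencilHom, aeval_X]
    exact Ideal.subset_span (Set.mem_range_self 1)
  · simp only [pencilHom, aeval_X]
    exact Ideal.neg_mem_iff _ |>.2 (Ideal.subset_span (Set.mem_range_self 0))

theorem exists_dualForm_eq [Infinite K] (hu : LinearIndependent K u) {m : ℕ} {F : Poly K n}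
    (hF : F ∈ gradedPiece (linIdeal (cutOut u) ^ m) ((m + 1 : ℕ) : ℤ)) :
    ∃ g : Fin (n + 1) → Poly K 1, (∀ i, (g i).IsHomogeneous m) ∧ dualForm u g = F := by
  rw [gradedPiece_linIdeal_pow hu] at hF
  obtain ⟨c, rfl⟩ := hF
  -- The substitution sends -X₁ to u₀·X and X₀ to u₁·X.
  refine ⟨fun i => ∑ j : Fin (m + 1), C (c (j, i)) * ((-X 1) ^ (j : ℕ) * X 0 ^ (m - j)),
    fun i => IsHomogeneous.sum _ _ _ fun j _ => ?_, ?_⟩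
  · refine IsHomogeneous.C_mul ?_ _
    have := ((isHomogeneous_X K (1 : Fin 2)).neg.pow (j : ℕ)).mul
      (isHomogeneous_X_pow (R := K) (0 : Fin 2) (m - j))
    rwa [one_mul, Nat.add_sub_cancel' (Nat.lt_succ_iff.1 j.2)] at this
  · rw [powForm, Fintype.linearCombination_apply, Fintype.sum_prod_type_right, dualForm]
    refine Finset.sum_congr rfl fun i _ => ?_
    rw [map_sum, Finset.sum_mul]
    refine Finset.sum_congr rfl fun j _ => ?_
    rw [smul_eq_C_mul, map_mul, map_mul, map_pow, map_pow, map_neg, algHom_C]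
    simp only [pencilHom, aeval_X]
    simp [mul_assoc]

/-- The Euler field at a point c is c itself, and the point of L attached to x is orthogonal to x.
-/
theorem dualForm_euler (u : Fin 2 → Vec K n) (c : Poly K 1) :
    dualForm u (fun i => c * res u (X i)) = 0 := by
  have h1 : (fun i => c * res u (X i)) = c • fun i : Fin (n + 1) => res u (X i : Poly K n) := rfl
  rw [h1, dualForm_smul]
  refine mul_eq_zero_of_right _ ?_
  have h2 : ∀ i : Fin (n + 1), pencilHom u (res u (X i : Poly K n)) =
      C (u 0 i) * linForm (u 1) + C (u 1 i) * (-linForm (u 0)) := by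
    intro i
    simp [res, pencilHom, linForm, Fin.sum_univ_two]
  simp only [dualForm, h2, add_mul, Finset.sum_add_distrib]
  have e : ∀ (j : Fin 2) (f : Poly K n), ∑ i, C (u j i) * f * X i = f * linForm (u j) := by
    intro j f
    rw [linForm, Finset.mul_sum]
    exact Finset.sum_congr rfl fun i _ => by ring
  rw [e 0, e 1]
  ring

theorem eval_dualForm_eq_eval_sum (g : Fin (n + 1) → Poly K 1) (x : Vec K n) :
    eval x (dualForm u g) = eval ![u 1 ⬝ᵥ x, -(u 0 ⬝ᵥ x)] (∑ i, g i * C (x i)) := by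
  rw [eval_dualForm]; simp

/-- The dual form of a vector field vanishes at the points of `Z` only if the field is tangent to
the dual arrangement. -/
theorem IsTransverse.dvd_of_eval_dualForm_eq_zero [Infinite K] (hZ : IsTransverse Z u) {m : ℕ}
    {g : Fin (n + 1) → Poly K 1} (hg : ∀ i, (g i).IsHomogeneous m) {P : ℙ K (Vec K n)} (hP : P ∈ Z)
    (h : eval P.rep (dualForm u g) = 0) : res u (linForm P.rep) ∣ ∑ i, g i * C (P.rep i) := by
  have hhom : (∑ i, g i * C (P.rep i)).IsHomogeneous m := IsHomogeneous.sum _ _ _ fun i _ => by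
    rw [mul_comm]; exact (hg i).C_mul _
  have hnz := hZ.1 P hP
  rw [eval_dualForm_eq_eval_sum] at h
  rw [res_linForm]
  set α := u 0 ⬝ᵥ P.rep
  set β := u 1 ⬝ᵥ P.rep
  rw [linForm_dvd_iff (fun h => hnz.elim (fun h0 => h0 (congrFun h 0)) fun h1 => h1 (congrFun h 1))]
  intro x hx
  have hx' : α * x 0 + β * x 1 = 0 := by
    simpa [dotProduct, Fin.sum_univ_two] using hx
  -- The hyperplane of P meets L in the single point (β, -α), so by homogeneity vanishing there
  -- means divisibility by its linear form.
  obtain ⟨c, hc⟩ : ∃ c : K, x = c • ![β, -α] := by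
    rcases hnz with h0 | h1
    · refine ⟨-(x 1) / α, ?_⟩
      ext j; fin_cases j
      · simp; field_simp; linear_combination hx'
      · simp; field_simp
    · refine ⟨x 0 / β, ?_⟩
      ext j; fin_cases j
      · simp; field_simp
      · simp; field_simp; linear_combination hx'
  rw [hc, eval_smul_of_isHomogeneous hhom, h, mul_zero]

theorem eval_dualForm_res_eq_zero [Infinite K] {θ : Der K n} (hθ : θ ∈ arrDer Z)
    {P : ℙ K (Vec K n)} (hP : P ∈ Z) : eval P.rep (dualForm u fun i => res u (θ i)) = 0 := by
  obtain ⟨q, hq⟩ := mem_arrDer_iff.1 hθ P hP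
  have : ∑ i, res u (θ i) * C (P.rep i) = res u (linForm P.rep) * res u q := by
    rw [← map_mul, ← hq, dotDer_apply, map_sum]
    refine Finset.sum_congr rfl fun i _ => ?_
    rw [map_mul]
    congr 1
    exact (algHom_C _ _).symm
  rw [eval_dualForm_eq_eval_sum, this, map_mul, res_linForm, eval_linForm]
  refine mul_eq_zero_of_left ?_ _
  simp [dotProduct, Fin.sum_univ_two]
  ring

end DualForms

/-! ### The splitting of the sheaf on L expressed by binary forms. -/

section SplittingModel

variable {K : Type*} [Field K] {n : ℕ} {u w : Fin 2 → Vec K n} {Z : Finset (ℙ K (Vec K n))}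

/-- The homogeneous coordinate ring of a line is the polynomial ring in two variables. -/
noncomputable def resBar [Infinite K] (u : Fin 2 → Vec K n) :
    Poly K n ⧸ linIdeal (Submodule.span K (Set.range u)) →+* Poly K 1 :=
  Ideal.Quotient.lift _ (res u : Poly K n →+* Poly K 1) fun _ hf => res_eq_zero_iff.2 hf

theorem resBar_mk [Infinite K] (f : Poly K n) :
    resBar u (Ideal.Quotient.mk _ f) = res u f := rfl

theorem resBar_injective [Infinite K] : Function.Injective (resBar u) := by
  rw [injective_iff_map_eq_zero]
  intro x hx
  obtain ⟨f, rfl⟩ := Ideal.Quotient.mk_surjective x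
  rw [resBar_mk, res_eq_zero_iff] at hx
  exact Ideal.Quotient.eq_zero_iff_mem.2 hx

theorem resBar_smul [Infinite K] (f : Poly K n)
    (x : Poly K n ⧸ linIdeal (Submodule.span K (Set.range u))) :
    resBar u (f • x) = res u f * resBar u x := by
  obtain ⟨g, rfl⟩ := Ideal.Quotient.mk_surjective x
  rw [← resBar_mk, ← map_mul]
  rfl

theorem linForm_mem_irrelevant (z : Vec K n) : linForm z ∈ irrelevant K n :=
  Ideal.sum_mem _ fun i _ => Ideal.mul_mem_left _ _ (Ideal.subset_span ⟨i, rfl⟩)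

/-- Derivations of the arrangement with zero dual form along the line. -/
noncomputable def dualFormKer (Z : Finset (ℙ K (Vec K n))) (u : Fin 2 → Vec K n) :
    Submodule (Poly K n) (arrDer Z) where
  carrier := {θ | dualForm u (fun i => res u (θ.1 i)) = 0}
  zero_mem' := by simp [dualForm]
  add_mem' := fun {a b} ha hb => by
    have : (fun i => res u ((a + b).1 i)) = (fun i => res u (a.1 i)) + fun i => res u (b.1 i) := by
      ext1 i; exact map_add _ _ _
    rw [Set.mem_ofPred_eq, this, dualForm_add, ha, hb, add_zero]
  smul_mem' := fun c a ha => by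
    have : (fun i => res u ((c • a).1 i)) = res u c • fun i => res u (a.1 i) := by
      ext1 i; exact map_mul _ _ _
    rw [Set.mem_ofPred_eq, this, dualForm_smul, ha, mul_zero]

/-- The class of a derivation in the reduced module. -/
noncomputable abbrev toRedDer (θ : arrDer Z) : RedDer Z := Submodule.Quotient.mk θ

/-- A homomorphism from `D₀(A_Z)` to a free module on a line, in terms of polynomials in two
variables. -/
noncomputable def splitMap [Infinite K]
    (φ : RedDer Z →ₗ[Poly K n] (Fin n → Poly K n ⧸ linIdeal (Submodule.span K (Set.range u)))) :
    arrDer Z →+ (Fin n → Poly K 1) where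
  toFun θ i := resBar u (φ (toRedDer θ) i)
  map_zero' := by
    ext1 i
    rw [toRedDer, Submodule.Quotient.mk_zero, map_zero, Pi.zero_apply, map_zero, Pi.zero_apply]
  map_add' θ θ' := by
    ext1 i
    rw [toRedDer, Submodule.Quotient.mk_add, map_add, Pi.add_apply, map_add, Pi.add_apply]

theorem smul_mem_dualFormKer (θ : arrDer Z) {r : Poly K n} (hr : res u r = 0) :
    r • θ ∈ dualFormKer Z u := by
  have : (fun i => res u ((r • θ).1 i)) = res u r • fun i => res u (θ.1 i) := by
    ext1 i; exact map_mul _ _ _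
  change dualForm u (fun i => res u ((r • θ).1 i)) = 0
  rw [this, hr, zero_smul]
  simp [dualForm]

theorem linForm_pow_mem_irrelevant_pow (z : Vec K n) {k k₁ : ℕ} (hk : k₁ ≤ k) :
    linForm z ^ k ∈ irrelevant K n ^ k₁ :=
  Ideal.pow_le_pow_right hk (Ideal.pow_mem_pow (linForm_mem_irrelevant _) _)

section

variable [Infinite K]
  {φ : RedDer Z →ₗ[Poly K n] (Fin n → Poly K n ⧸ linIdeal (Submodule.span K (Set.range u)))}

theorem splitMap_apply (θ : arrDer Z) (i : Fin n) :
    splitMap φ θ i = resBar u (φ (toRedDer θ) i) := rfl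

theorem splitMap_smul (f : Poly K n) (θ : arrDer Z) :
    splitMap φ (f • θ) = res u f • splitMap φ θ := by
  ext1 i
  rw [splitMap_apply, toRedDer, Submodule.Quotient.mk_smul, map_smul, Pi.smul_apply, resBar_smul,
    Pi.smul_apply, smul_eq_mul, splitMap_apply]

theorem splitMap_eq_zero_iff {θ : arrDer Z} : splitMap φ θ = 0 ↔ φ (toRedDer θ) = 0 := by
  constructor
  · intro h
    ext1 i
    exact resBar_injective (by rw [Pi.zero_apply, map_zero]; exact congrFun h i)
  · intro h
    ext1 i
    rw [splitMap_apply, h, Pi.zero_apply, map_zero, Pi.zero_apply]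

theorem res_linForm_of_isDualPair (hd : IsDualPair u w) (j : Fin 2) :
    res u (linForm (w j)) = X j := by
  have : sec w (X j) = linForm (w j) := by simp [sec]
  rw [← this, res_sec hd]

theorem eulerDer_mem_dualFormKer :
    (⟨eulerDer K n, eulerDer_mem_arrDer Z⟩ : arrDer Z) ∈ dualFormKer Z u := by
  change dualForm u (fun i => res u (eulerDer K n i)) = 0
  have := dualForm_euler (n := n) u 1
  simp only [one_mul] at this
  exact this

theorem submoduleOf_euler_le_dualFormKer :
    (Submodule.span (Poly K n) {eulerDer K n}).submoduleOf (arrDer Z) ≤ dualFormKer Z u := by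
  intro θ hθ
  obtain ⟨c, hc⟩ := Submodule.mem_span_singleton.1 hθ
  have : θ = c • ⟨eulerDer K n, eulerDer_mem_arrDer Z⟩ := Subtype.ext hc.symm
  rw [this]
  exact Submodule.smul_mem _ _ eulerDer_mem_dualFormKer

theorem mem_dualFormKer_of_smul_mem (hd : IsDualPair u w) {θ : arrDer Z} {r : Poly K n}
    (hr : res u r ≠ 0) (h : r • θ ∈ dualFormKer Z u) : θ ∈ dualFormKer Z u := by
  have h5 : (fun i => res u ((r • θ).1 i)) = res u r • fun i => res u (θ.1 i) := by
    ext1 i; exact map_mul _ _ _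
  change dualForm u (fun i => res u ((r • θ).1 i)) = 0 at h
  rw [h5, dualForm_smul] at h
  refine (mul_eq_zero.1 h).resolve_left ?_
  rw [← map_zero (pencilHom u)]
  exact (pencilHom_injective hd).ne hr

theorem mem_dualFormKer_of_toRedDer_mem {θ : arrDer Z}
    (h : toRedDer θ ∈ linIdeal (Submodule.span K (Set.range u)) •
      (⊤ : Submodule (Poly K n) (RedDer Z))) : θ ∈ dualFormKer Z u := by
  have h2 : linIdeal (Submodule.span K (Set.range u)) • (⊤ : Submodule (Poly K n) (RedDer Z)) ≤
      (dualFormKer Z u).map (Submodule.mkQ _) := by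
    refine Submodule.smul_le.2 fun r hr x _ => ?_
    obtain ⟨η, rfl⟩ := Submodule.Quotient.mk_surjective _ x
    exact ⟨r • η, smul_mem_dualFormKer η (res_eq_zero_iff.2 hr), rfl⟩
  obtain ⟨η, hη, hmk⟩ := h2 h
  have h4 : η - θ ∈ dualFormKer Z u :=
    submoduleOf_euler_le_dualFormKer ((Submodule.Quotient.eq _).1 hmk)
  have := Submodule.sub_mem _ hη h4
  rwa [sub_sub_cancel] at this

/-- A power of the irrelevant ideal moves θ into I(L)·D₀, where dual forms vanish. The power of the
linear form of w₀ used for this restricts to a power of X₀ on L and can be cancelled. -/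
theorem mem_dualFormKer_of_splitMap_eq_zero (hd : IsDualPair u w) {k : ℕ}
    (hker : ∀ x : RedDer Z, φ x = 0 → ∀ f ∈ irrelevant K n ^ k,
      f • x ∈ linIdeal (Submodule.span K (Set.range u)) • (⊤ : Submodule (Poly K n) (RedDer Z)))
    {θ : arrDer Z} (h : splitMap φ θ = 0) : θ ∈ dualFormKer Z u := by
  have h1 := hker _ (splitMap_eq_zero_iff.1 h) _
    (linForm_pow_mem_irrelevant_pow (w 0) (le_refl k))
  refine mem_dualFormKer_of_smul_mem hd (r := linForm (w 0) ^ k) ?_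
    (mem_dualFormKer_of_toRedDer_mem h1)
  rw [map_pow, res_linForm_of_isDualPair hd]
  exact pow_ne_zero _ (X_ne_zero _)

/-- By transversality `otherForms Z P` times θ lies in I(L)·D(A_Z), which the map kills. The target
is torsion-free over the coordinate ring of L, and the multiplier is nonzero on L. -/
theorem splitMap_eq_zero_of_res_eq_zero (hd : IsDualPair u w) (hZ : IsTransverse Z u)
    (hne : Z.Nonempty) {θ : arrDer Z} (h0 : ∀ i, res u (θ.1 i) = 0) : splitMap φ θ = 0 := by
  obtain ⟨P, hP⟩ := hne
  obtain ⟨l, η, hl, hη, hsum⟩ := exists_otherForms_smul_eq_sum hd hZ hP θ.2 h0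
  have hsum' : otherForms Z P • θ = ∑ j, l j • (⟨η j, hη j⟩ : arrDer Z) := by
    refine Subtype.ext ?_
    rw [Submodule.coe_smul, hsum, Submodule.coe_sum]
    rfl
  have h1 : splitMap φ (otherForms Z P • θ) = 0 := by
    rw [hsum', map_sum]
    refine Finset.sum_eq_zero fun j _ => ?_
    rw [splitMap_smul, hl, zero_smul]
  rw [splitMap_smul] at h1
  refine (smul_eq_zero.1 h1).resolve_left ?_
  rw [otherForms, map_prod]
  classical
  exact Finset.prod_ne_zero_iff.2 fun Q hQ =>
    hZ.res_linForm_ne_zero (Finset.mem_of_mem_erase hQ)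

/-- A zero dual form means that θ restricts to a multiple of the Euler field on L. Subtracting a
lift of that multiple, which is zero in D₀, leaves a derivation vanishing along L. -/
theorem splitMap_eq_zero_of_mem_dualFormKer (hd : IsDualPair u w) (hZ : IsTransverse Z u)
    (hne : Z.Nonempty) {θ : arrDer Z} (h : θ ∈ dualFormKer Z u) : splitMap φ θ = 0 := by
  obtain ⟨c, hc⟩ := eq_smul_euler_of_dualForm_eq_zero hd h
  let E : arrDer Z := ⟨eulerDer K n, eulerDer_mem_arrDer Z⟩
  have hE : splitMap φ E = 0 := by
    rw [splitMap_eq_zero_iff]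
    have hmem : E ∈ (Submodule.span (Poly K n) {eulerDer K n}).submoduleOf (arrDer Z) :=
      Submodule.mem_span_singleton_self (eulerDer K n)
    rw [toRedDer, (Submodule.Quotient.mk_eq_zero _).2 hmem, map_zero]
  have h1 : splitMap φ (θ - sec w c • E) = 0 := by
    refine splitMap_eq_zero_of_res_eq_zero hd hZ hne fun i => ?_
    have e : ((θ - sec w c • E : arrDer Z) : Der K n) = θ.1 - sec w c • eulerDer K n := by
      rw [Submodule.coe_sub, Submodule.coe_smul]
    rw [e, Pi.sub_apply, Pi.smul_apply, smul_eq_mul, map_sub, map_mul, res_sec hd, hc i, eulerDer,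
      sub_self]
  rwa [map_sub, splitMap_smul, hE, smul_zero, sub_zero] at h1

end

/-- What the splitting of the restriction of `D₀(A_Z)` to a line means in terms of polynomials in two
variables. -/
theorem exists_splitting_model [Infinite K] (hd : IsDualPair u w) (hZ : IsTransverse Z u)
    (hne : Z.Nonempty) {a : Fin n → ℕ} (hR : RestrictsTo Z a (Submodule.span K (Set.range u))) :
    ∃ Φ : arrDer Z →+ (Fin n → Poly K 1),
      (∀ f θ, Φ (f • θ) = res u f • Φ θ) ∧
      (∀ d (θ : arrDer Z), IsHomogDer (θ : Der K n) d → ∀ i,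
        Φ θ i ∈ gradedPiece (⊤ : Ideal (Poly K 1)) ((d : ℤ) - a i)) ∧
      (∀ θ : arrDer Z, Φ θ = 0 ↔ dualForm u (fun i => res u (θ.1 i)) = 0) ∧
      ∃ k₁, ∀ k ≥ k₁, ∀ j : Fin 2, ∀ y : Fin n → Poly K 1, ∃ θ, Φ θ = (X j ^ k : Poly K 1) • y := by
  obtain ⟨φ, hhom, k₁, hker, hcoker⟩ := hR
  refine ⟨splitMap φ, splitMap_smul, ?_, fun θ => ⟨mem_dualFormKer_of_splitMap_eq_zero hd hker,
    splitMap_eq_zero_of_mem_dualFormKer hd hZ hne⟩, k₁, ?_⟩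
  · intro d θ hθ i
    obtain ⟨g, hg, hgφ⟩ := hhom d θ hθ i
    rw [splitMap_apply, hgφ, resBar_mk]
    rw [mem_gradedPiece_top_iff] at hg ⊢
    intro j hj
    rw [homogeneousComponent_algHom _ fun p k hp => res_isHomogeneous u hp, hg j hj, map_zero]
  · intro k hk j y
    obtain ⟨x, hx⟩ := hcoker (fun i => Ideal.Quotient.mk _ (sec w (y i))) _
      (linForm_pow_mem_irrelevant_pow (w j) hk)
    obtain ⟨θ, rfl⟩ := Submodule.Quotient.mk_surjective _ x
    refine ⟨θ, ?_⟩
    ext1 i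
    rw [splitMap_apply, hx, Pi.smul_apply, resBar_smul, resBar_mk, res_sec hd, map_pow,
      res_linForm_of_isDualPair hd, Pi.smul_apply, smul_eq_mul]

end SplittingModel
end UnexpectedHypersurfaces

namespace UnexpectedHypersurfaces

/-! ### Identification of forms through Z with sections of the split bundle. -/

section Correspondence

/-- The relation Γ is the graph of an isomorphism; describing it by a relation avoids constructing
either direction as a linear map. -/
theorem finrank_eq_of_correspondence {K M N : Type*} [Field K] [AddCommGroup M] [Module K M]
    [AddCommGroup N] [Module K N] (Γ : Submodule K (M × N)) (h₁ : ∀ x, ∃ y, (x, y) ∈ Γ)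
    (h₂ : ∀ y, ∃ x, (x, y) ∈ Γ) (h : ∀ p ∈ Γ, p.1 = 0 ↔ p.2 = 0) :
    Module.finrank K M = Module.finrank K N := by
  let p₁ : Γ →ₗ[K] M := (LinearMap.fst K M N).comp Γ.subtype
  let p₂ : Γ →ₗ[K] N := (LinearMap.snd K M N).comp Γ.subtype
  have hb₁ : Function.Bijective p₁ :=
    ⟨(injective_iff_map_eq_zero p₁).2 fun p hp => Subtype.ext (Prod.ext hp ((h p p.2).1 hp)),
      fun x => let ⟨y, hy⟩ := h₁ x; ⟨⟨(x, y), hy⟩, rfl⟩⟩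
  have hb₂ : Function.Bijective p₂ :=
    ⟨(injective_iff_map_eq_zero p₂).2 fun p hp => Subtype.ext (Prod.ext ((h p p.2).2 hp) hp),
      fun y => let ⟨x, hx⟩ := h₂ y; ⟨⟨(x, y), hx⟩, rfl⟩⟩
  exact (LinearEquiv.ofBijective p₁ hb₁).finrank_eq.symm.trans
    (LinearEquiv.ofBijective p₂ hb₂).finrank_eq

variable {K : Type*} [Field K] {n : ℕ} {u w : Fin 2 → Vec K n} {Z : Finset (ℙ K (Vec K n))}

/-- The form on `ℙ(V)` attached to a derivation of the arrangement and a line. -/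
noncomputable def formOf (u : Fin 2 → Vec K n) (Z : Finset (ℙ K (Vec K n))) :
    arrDer Z →+ Poly K n where
  toFun θ := dualForm u fun i => res u (θ.1 i)
  map_zero' := by simp [dualForm]
  map_add' θ θ' := by
    rw [← dualForm_add]
    congr 1
    ext1 i
    exact map_add _ _ _

theorem formOf_apply (θ : arrDer Z) : formOf u Z θ = dualForm u fun i => res u (θ.1 i) := rfl

theorem formOf_smul (f : Poly K n) (θ : arrDer Z) :
    formOf u Z (f • θ) = pencilHom u (res u f) * formOf u Z θ := by
  rw [formOf_apply, formOf_apply, ← dualForm_smul]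
  congr 1
  ext1 i
  exact map_mul _ _ _

/-- The homogeneous components of a derivation of the arrangement. -/
noncomputable def compArr [Infinite K] (j : ℕ) (θ : arrDer Z) : arrDer Z :=
  ⟨compDer j θ.1, compDer_mem_arrDer θ.2 j⟩

theorem res_compArr [Infinite K] (j : ℕ) (θ : arrDer Z) (i : Fin (n + 1)) :
    res u ((compArr j θ).1 i) = homogeneousComponent j (res u (θ.1 i)) :=
  (homogeneousComponent_algHom _ (fun _ _ hp => res_isHomogeneous u hp) _ _).symm

theorem homogeneousComponent_eq_self {σ : Type*} {p : MvPolynomial σ K} {k : ℕ}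
    (hp : p.IsHomogeneous k) : homogeneousComponent k p = p := by
  rw [homogeneousComponent_eq_ite hp, if_pos rfl]

theorem exists_eq_pow_mul {f g : Poly K 1} {k : ℕ} (h : X 1 ^ k * f = X 0 ^ k * g) :
    ∃ y, f = X 0 ^ k * y ∧ g = X 1 ^ k * y := by
  obtain ⟨y, hy⟩ := X_dvd_of_X_dvd_mul (i := 0) (j := 1) (by decide) (Dvd.intro _ h.symm)
  refine ⟨y, hy, mul_left_cancel₀ (pow_ne_zero k (X_ne_zero 0)) ?_⟩
  rw [← h, hy]
  ring

variable [Infinite K] {Φ : arrDer Z →+ (Fin n → Poly K 1)} {a : Fin n → ℕ}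

/-- The map is graded with shift `a i` in coordinate i, so degree l there is reached only from
derivations of degree l + a i. -/
theorem homogeneousComponent_splitting
    (hdeg : ∀ d (θ : arrDer Z), IsHomogDer (θ : Der K n) d → ∀ i,
        Φ θ i ∈ gradedPiece (⊤ : Ideal (Poly K 1)) ((d : ℤ) - a i))
    (θ : arrDer Z) (i : Fin n) (l : ℕ) :
    homogeneousComponent l (Φ θ i) = homogeneousComponent l (Φ (compArr (l + a i) θ) i) := by
  obtain ⟨N, hN, hN'⟩ := exists_sum_compDer θ.1
  have h0 : ∀ j, j ≠ l + a i → homogeneousComponent l (Φ (compArr j θ) i) = 0 := fun j hj =>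
    mem_gradedPiece_top_iff.1 (hdeg j (compArr j θ) (compDer_isHomogDer j θ.1) i) l (by omega)
  have hsum : θ = ∑ j ∈ Finset.range N, compArr j θ := by
    refine Subtype.ext ?_
    rw [Submodule.coe_sum]
    exact hN
  conv_lhs => rw [hsum, map_sum, Finset.sum_apply, map_sum]
  refine Finset.sum_eq_single (l + a i) (fun j _ hj => h0 j hj) fun hl => ?_
  have : compArr (l + a i) θ = 0 :=
    Subtype.ext (hN' _ (by simpa using hl))
  rw [this, map_zero, Pi.zero_apply, map_zero]

theorem splitting_compArr
    (hdeg : ∀ d (θ : arrDer Z), IsHomogDer (θ : Der K n) d → ∀ i,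
        Φ θ i ∈ gradedPiece (⊤ : Ideal (Poly K 1)) ((d : ℤ) - a i))
    {θ : arrDer Z} {e : ℕ}
    (h : ∀ i, Φ θ i ∈ gradedPiece (⊤ : Ideal (Poly K 1)) ((e : ℤ) - a i)) :
    Φ (compArr e θ) = Φ θ := by
  ext1 i
  refine ext_homogeneousComponent fun l => ?_
  by_cases hl : l + a i = e
  · rw [homogeneousComponent_splitting hdeg θ, hl]
  · rw [mem_gradedPiece_top_iff.1 (h i) l (by omega), mem_gradedPiece_top_iff.1
      (hdeg e (compArr e θ) (compDer_isHomogDer e θ.1) i) l (by omega)]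

/-- The difference that compares derivations lifting `X₀ᵏ` and `X₁ᵏ` times the same object. -/
noncomputable def crossDer (w : Fin 2 → Vec K n) (k : ℕ) (θ : Fin 2 → arrDer Z) : arrDer Z :=
  linForm (w 1) ^ k • θ 0 - linForm (w 0) ^ k • θ 1

theorem res_crossDer (hd : IsDualPair u w) (k : ℕ) (θ : Fin 2 → arrDer Z) (i : Fin (n + 1)) :
    res u ((crossDer w k θ).1 i) =
      X 1 ^ k * res u ((θ 0).1 i) - X 0 ^ k * res u ((θ 1).1 i) := by
  have e : (crossDer w k θ).1 = linForm (w 1) ^ k • (θ 0).1 - linForm (w 0) ^ k • (θ 1).1 := by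
    rw [crossDer, Submodule.coe_sub, Submodule.coe_smul, Submodule.coe_smul]
  rw [e, Pi.sub_apply, Pi.smul_apply, Pi.smul_apply, smul_eq_mul, smul_eq_mul, map_sub, map_mul,
    map_mul, map_pow, map_pow, res_linForm_of_isDualPair hd, res_linForm_of_isDualPair hd]

theorem splitting_crossDer (hd : IsDualPair u w) (hsmul : ∀ f θ, Φ (f • θ) = res u f • Φ θ) (k : ℕ)
    (θ : Fin 2 → arrDer Z) (i : Fin n) :
    Φ (crossDer w k θ) i = X 1 ^ k * Φ (θ 0) i - X 0 ^ k * Φ (θ 1) i := by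
  rw [crossDer, map_sub, hsmul, hsmul, Pi.sub_apply, Pi.smul_apply, Pi.smul_apply, smul_eq_mul,
    smul_eq_mul, map_pow, map_pow, res_linForm_of_isDualPair hd, res_linForm_of_isDualPair hd]

/-- F comes from a tangent field g on L. After multiplication by X₀ᵏ and X₁ᵏ it lifts to two
derivations, which agree on L after cross-multiplication; hence so do their images, and coprimality
of the powers gives one common y. The power k plays the role of restriction to the two standard
charts of L. -/
theorem exists_splitting_of_form (hd : IsDualPair u w)
    (hu : LinearIndependent K u) (hZ : IsTransverse Z u)
    (hsmul : ∀ f θ, Φ (f • θ) = res u f • Φ θ)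
    (hdeg : ∀ d (θ : arrDer Z), IsHomogDer (θ : Der K n) d → ∀ i,
        Φ θ i ∈ gradedPiece (⊤ : Ideal (Poly K 1)) ((d : ℤ) - a i))
    (hker : ∀ θ : arrDer Z, Φ θ = 0 ↔ dualForm u (fun i => res u (θ.1 i)) = 0) {k : ℕ}
    (hlift : ∀ j : Fin 2, ∀ g : Fin (n + 1) → Poly K 1,
      (∀ P ∈ Z, res u (linForm P.rep) ∣ ∑ i, g i * C (P.rep i)) →
      ∃ θ ∈ arrDer Z, ∀ i, res u (θ i) = X j ^ k * g i)
    {m : ℕ} {F : Poly K n}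
    (hF : F ∈ gradedPiece (projIdeal (Z : Set (ℙ K (Vec K n))) ⊓ linIdeal (cutOut u) ^ m)
      ((m + 1 : ℕ) : ℤ)) :
    ∃ y : Fin n → Poly K 1, (∀ i, y i ∈ gradedPiece (⊤ : Ideal (Poly K 1)) ((m : ℤ) - a i)) ∧
      ∀ j : Fin 2, ∃ θ : arrDer Z, formOf u Z θ = pencilHom u (X j) ^ k * F ∧
        Φ θ = (X j ^ k : Poly K 1) • y := by
  obtain ⟨hFI, hFhom⟩ := mem_gradedPiece_natCast.1 hF
  obtain ⟨g, hg, hgF⟩ := exists_dualForm_eq hu (mem_gradedPiece_natCast.2 ⟨hFI.2, hFhom⟩)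
  have hdvd : ∀ P ∈ Z, res u (linForm P.rep) ∣ ∑ i, g i * C (P.rep i) := fun P hP =>
    hZ.dvd_of_eval_dualForm_eq_zero hg hP
      (by rw [hgF]; exact (mem_projIdeal_of_isHomogeneous hFhom).1 hFI.1 P hP)
  choose θ hθ hθg using fun j => hlift j g hdvd
  let η : Fin 2 → arrDer Z := fun j => compArr (m + k) ⟨θ j, hθ j⟩
  have hη : ∀ j i, res u ((η j).1 i) = X j ^ k * g i := by
    intro j i
    rw [res_compArr, hθg, homogeneousComponent_eq_self]
    rw [add_comm m k]
    exact (isHomogeneous_X_pow j k).mul (hg i)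
  have hcross : Φ (crossDer w k η) = 0 := by
    rw [hker]
    have : (fun i => res u ((crossDer w k η).1 i)) = 0 := by
      ext1 i
      rw [res_crossDer hd, hη, hη, Pi.zero_apply]
      ring
    rw [this]
    simp [dualForm]
  have hy : ∀ i, ∃ y, Φ (η 0) i = X 0 ^ k * y ∧ Φ (η 1) i = X 1 ^ k * y := by
    intro i
    refine exists_eq_pow_mul ?_
    rw [← sub_eq_zero, ← splitting_crossDer hd hsmul, hcross, Pi.zero_apply]
  choose y hy0 hy1 using hy
  have hyj : ∀ j, Φ (η j) = (X j ^ k : Poly K 1) • y := by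
    intro j
    ext1 i
    fin_cases j
    · exact hy0 i
    · exact hy1 i
  refine ⟨y, fun i => ?_, fun j => ⟨η j, ?_, hyj j⟩⟩
  · refine mem_gradedPiece_top_of_pow_mul (j := 0) (k := k) ?_
    rw [← hy0]
    have := hdeg (m + k) (η 0) (compDer_isHomogDer _ _) i
    push_cast at this
    rwa [show (m : ℤ) - a i + k = m + k - a i by ring]
  · have : (fun i => res u ((η j).1 i)) = (X j ^ k : Poly K 1) • g := by
      ext1 i
      exact hη j i
    rw [formOf_apply, this, dualForm_smul, hgF, map_pow]

/-- Two local fields agree on the overlap only up to a multiple c of the Euler field. Its component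
of degree m + 2k - 1 ≥ 2k - 1 lies in (X₀ᵏ, X₁ᵏ), so each local field can be corrected by an Euler
multiple and the two glue. This is the vanishing of H¹(𝒪_L(m - 1)) for m ≥ 0. -/
theorem exists_dualForm_eq_pow_mul (hd : IsDualPair u w) (hu : LinearIndependent K u) {m k : ℕ}
    (hk : 0 < k) {g : Fin 2 → Fin (n + 1) → Poly K 1} (hg : ∀ j i, (g j i).IsHomogeneous (m + k))
    (h : dualForm u (fun i => X 1 ^ k * g 0 i - X 0 ^ k * g 1 i) = 0) :
    ∃ F ∈ gradedPiece (linIdeal (cutOut u) ^ m) ((m + 1 : ℕ) : ℤ),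
      ∀ j, dualForm u (g j) = pencilHom u (X j) ^ k * F := by
  obtain ⟨c, hc⟩ := eq_smul_euler_of_dualForm_eq_zero hd h
  have hc' : ∀ i, X 1 ^ k * g 0 i - X 0 ^ k * g 1 i =
      homogeneousComponent (m + 2 * k - 1) c * res u (X i) := by
    intro i
    have h2 := congrArg (homogeneousComponent (m + 2 * k - 1 + 1)) (hc i)
    rw [homogeneousComponent_mul_isHomogeneous _ _ (res_isHomogeneous u (isHomogeneous_X K i)),
      homogeneousComponent_eq_self] at h2
    · exact h2
    · have e : m + 2 * k - 1 + 1 = k + (m + k) := by omega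
      rw [e]
      exact ((isHomogeneous_X_pow _ k).mul (hg 0 i)).sub ((isHomogeneous_X_pow _ k).mul (hg 1 i))
  obtain ⟨c₀, c₁, hcc⟩ := exists_eq_of_isHomogeneous_two_mul (k := k)
    (homogeneousComponent_isHomogeneous (m + 2 * k - 1) c) (by omega)
  have hG : ∀ i, ∃ G, g 0 i - c₁ * res u (X i) = X 0 ^ k * G ∧
      g 1 i + c₀ * res u (X i) = X 1 ^ k * G := by
    intro i
    refine exists_eq_pow_mul ?_
    have := hc' i
    rw [hcc] at this
    linear_combination this
  choose G hG0 hG1 using hG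
  have hform : ∀ j, dualForm u (g j) = pencilHom u (X j) ^ k * dualForm u G := by
    intro j
    have hex : ∃ b : Poly K 1, g j = (X j ^ k : Poly K 1) • G + fun i => b * res u (X i) := by
      fin_cases j
      · exact ⟨c₁, funext fun i => eq_add_of_sub_eq (hG0 i)⟩
      · refine ⟨-c₀, funext fun i => ?_⟩
        have := hG1 i
        change g 1 i = X 1 ^ k * G i + -c₀ * res u (X i)
        linear_combination this
    obtain ⟨b, hb⟩ := hex
    rw [hb, dualForm_add, dualForm_euler, add_zero, dualForm_smul, map_pow]
  refine ⟨homogeneousComponent (m + 1) (dualForm u G), ?_, fun j => ?_⟩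
  · rw [homogeneousComponent_dualForm]
    exact dualForm_mem_gradedPiece hu fun i => homogeneousComponent_isHomogeneous _ _
  · have h1 := congrArg (homogeneousComponent (m + 1 + k)) (hform j)
    have h2 : (dualForm u (g j)).IsHomogeneous (m + 1 + k) := by
      rw [add_right_comm]
      exact dualForm_isHomogeneous (hg j)
    have h3 : (pencilHom u (X j) ^ k).IsHomogeneous k := by
      have := (pencilHom_isHomogeneous u (isHomogeneous_X K j)).pow k
      rwa [one_mul] at this
    rw [homogeneousComponent_eq_self h2, mul_comm,
      homogeneousComponent_mul_isHomogeneous _ _ h3] at h1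
    rw [h1, mul_comm]

/-- Lift X₀ᵏ y and X₁ᵏ y to derivations of degree m + k; their cross difference has zero image,
hence zero dual form, and the two dual forms glue to F. At a point P of Z one of u₀·P, u₁·P is
nonzero, so the factor X_jᵏ can be cancelled there for a suitable j. -/
theorem exists_form_of_splitting (hd : IsDualPair u w)
    (hu : LinearIndependent K u) (hZ : IsTransverse Z u)
    (hsmul : ∀ f θ, Φ (f • θ) = res u f • Φ θ)
    (hdeg : ∀ d (θ : arrDer Z), IsHomogDer (θ : Der K n) d → ∀ i,
        Φ θ i ∈ gradedPiece (⊤ : Ideal (Poly K 1)) ((d : ℤ) - a i))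
    (hker : ∀ θ : arrDer Z, Φ θ = 0 ↔ dualForm u (fun i => res u (θ.1 i)) = 0) {k : ℕ} (hk : 0 < k)
    (hsurj : ∀ j : Fin 2, ∀ y : Fin n → Poly K 1, ∃ θ, Φ θ = (X j ^ k : Poly K 1) • y)
    {m : ℕ} {y : Fin n → Poly K 1}
    (hy : ∀ i, y i ∈ gradedPiece (⊤ : Ideal (Poly K 1)) ((m : ℤ) - a i)) :
    ∃ F ∈ gradedPiece (projIdeal (Z : Set (ℙ K (Vec K n))) ⊓ linIdeal (cutOut u) ^ m)
      ((m + 1 : ℕ) : ℤ),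
      ∀ j : Fin 2, ∃ θ : arrDer Z, formOf u Z θ = pencilHom u (X j) ^ k * F ∧
        Φ θ = (X j ^ k : Poly K 1) • y := by
  choose θ hθ using fun j => hsurj j y
  let η : Fin 2 → arrDer Z := fun j => compArr (m + k) (θ j)
  have hη : ∀ j, Φ (η j) = (X j ^ k : Poly K 1) • y := by
    intro j
    rw [← hθ j]
    refine splitting_compArr hdeg fun i => ?_
    rw [hθ j, Nat.cast_add, show (m : ℤ) + k - a i = m - a i + k by ring]
    exact pow_mul_mem_gradedPiece_top (hy i) j k
  have hhom : ∀ j i, (res u ((η j).1 i)).IsHomogeneous (m + k) := fun j i =>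
    res_isHomogeneous u (homogeneousComponent_isHomogeneous _ _)
  have hcross : Φ (crossDer w k η) = 0 := by
    ext1 i
    rw [splitting_crossDer hd hsmul, hη, hη, Pi.smul_apply, Pi.smul_apply, smul_eq_mul, smul_eq_mul,
      Pi.zero_apply]
    ring
  have hcross' := (hker _).1 hcross
  rw [funext (res_crossDer hd k η)] at hcross'
  obtain ⟨F, hFQ, hform⟩ := exists_dualForm_eq_pow_mul hd hu hk hhom hcross'
  obtain ⟨hF1, hF2⟩ := mem_gradedPiece_natCast.1 hFQ
  refine ⟨F, mem_gradedPiece_natCast.2 ⟨⟨?_, hF1⟩, hF2⟩, fun j => ⟨η j, hform j, hη j⟩⟩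
  refine (mem_projIdeal_of_isHomogeneous hF2).2 fun P hP => ?_
  have key : ∀ j, eval P.rep (pencilHom u (X j)) ≠ 0 → eval P.rep F = 0 := by
    intro j hj
    have h1 := eval_dualForm_res_eq_zero (u := u) (η j).2 hP
    rw [hform j, map_mul, map_pow] at h1
    exact (mul_eq_zero.1 h1).resolve_left (pow_ne_zero _ hj)
  rcases hZ.1 P hP with h | h
  · exact key 1 (by simpa [pencilHom] using h)
  · exact key 0 (by simpa [pencilHom] using h)

end Correspondence

/-! ### The dimension formula from the splitting type. -/

section Dimension

variable {K : Type*} [Field K] {n : ℕ} {u w : Fin 2 → Vec K n} {Z : Finset (ℙ K (Vec K n))}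

/-- The splitting type determines the number of forms of degree `m + 1` that vanish on `Z` and have
multiplicity `m` along the codimension two subspace dual to the line. -/
theorem hdim_eq_sum_of_restrictsTo [IsAlgClosed K] (hu : LinearIndependent K u)
    (hZ : IsTransverse Z u) (hne : Z.Nonempty) {a : Fin n → ℕ}
    (hR : RestrictsTo Z a (Submodule.span K (Set.range u))) (m : ℕ) :
    hdim (projIdeal (Z : Set (ℙ K (Vec K n))) ⊓ linIdeal (cutOut u) ^ m) ((m + 1 : ℕ) : ℤ) =
      ∑ i, (m + 1 - a i) := by
  have : Infinite K := IsAlgClosed.instInfinite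
  obtain ⟨w, hd⟩ := exists_dual_pair hu
  replace hd : IsDualPair u w := hd
  obtain ⟨Φ, hsmul, hdeg, hker, k₁, hsurj⟩ := exists_splitting_model hd hZ hne hR
  obtain ⟨k₀, hlift⟩ := hZ.exists_arrDer_res_eq_pow_mul hd hne
  obtain ⟨k, hk0, hk1, hk⟩ : ∃ k, k₀ ≤ k ∧ k₁ ≤ k ∧ 0 < k := ⟨k₀ + k₁ + 1, by omega, by omega, by omega⟩
  let M := gradedPiece (projIdeal (Z : Set (ℙ K (Vec K n))) ⊓ linIdeal (cutOut u) ^ m)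
    ((m + 1 : ℕ) : ℤ)
  let N := fun i => gradedPiece (⊤ : Ideal (Poly K 1)) ((m : ℤ) - a i)
  -- F and y correspond when, for both j, X_jᵏ times F and X_jᵏ times y come from one and the same
  -- derivation.
  let Γ : Submodule K (M × Π i, N i) :=
    { carrier := {p | ∀ j : Fin 2, ∃ θ : arrDer Z, formOf u Z θ = pencilHom u (X j) ^ k * p.1 ∧
        Φ θ = (X j ^ k : Poly K 1) • fun i => (p.2 i : Poly K 1)}
      zero_mem' := fun j => ⟨0, by rw [map_zero]; exact (mul_zero _).symm, by
        rw [map_zero]; exact (smul_zero _).symm⟩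
      add_mem' := by
        intro p q hp hq j
        obtain ⟨θ, h1, h2⟩ := hp j
        obtain ⟨θ', h1', h2'⟩ := hq j
        refine ⟨θ + θ', ?_, ?_⟩
        · rw [map_add, h1, h1', ← mul_add]; rfl
        · rw [map_add, h2, h2', ← smul_add]; rfl
      smul_mem' := by
        intro c p hp j
        obtain ⟨θ, h1, h2⟩ := hp j
        refine ⟨(C c : Poly K n) • θ, ?_, ?_⟩
        · rw [formOf_smul, h1, ← algebraMap_eq, AlgHom.commutes, AlgHom.commutes, Prod.smul_fst,
            Submodule.coe_smul, Algebra.smul_def]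
          ring
        · rw [hsmul, h2, ← algebraMap_eq, AlgHom.commutes]
          ext1 i
          change algebraMap K (Poly K 1) c * (X j ^ k * (p.2 i : Poly K 1)) =
            X j ^ k * (c • (p.2 i : Poly K 1))
          rw [Algebra.smul_def]
          ring }
  have hpen : pencilHom u (X 0) ^ k ≠ 0 :=
    pow_ne_zero _ (by
      rw [← map_zero (pencilHom u)]
      exact (pencilHom_injective hd).ne (X_ne_zero _))
  have hiff : ∀ p ∈ Γ, p.1 = 0 ↔ p.2 = 0 := by
    intro p hp
    obtain ⟨θ, h1, h2⟩ := hp 0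
    have e1 : p.1 = 0 ↔ formOf u Z θ = 0 := by
      rw [h1, mul_eq_zero, or_iff_right hpen]
      exact Subtype.ext_iff
    have e2 : p.2 = 0 ↔ Φ θ = 0 := by
      rw [h2, smul_eq_zero, or_iff_right (pow_ne_zero _ (X_ne_zero _))]
      constructor
      · intro h
        ext1 i
        exact congrArg Subtype.val (congrFun h i)
      · intro h
        ext1 i
        exact Subtype.ext (congrFun h i)
    rw [e1, e2, hker, formOf_apply]
  have h₁ : ∀ F, ∃ y, (F, y) ∈ Γ := by
    intro F
    obtain ⟨y, hy, hj⟩ := exists_splitting_of_form hd hu hZ hsmul hdeg hker (hlift k hk0) F.2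
    exact ⟨fun i => ⟨y i, hy i⟩, hj⟩
  have h₂ : ∀ y, ∃ F, (F, y) ∈ Γ := by
    intro y
    obtain ⟨F, hF, hj⟩ := exists_form_of_splitting hd hu hZ hsmul hdeg hker hk (hsurj k hk1)
      fun i => (y i).2
    exact ⟨⟨F, hF⟩, hj⟩
  calc Module.finrank K M = Module.finrank K (Π i, N i) :=
        finrank_eq_of_correspondence Γ h₁ h₂ hiff
    _ = ∑ i, Module.finrank K (N i) := Module.finrank_pi_fintype K
    _ = ∑ i, (m + 1 - a i) := Finset.sum_congr rfl fun i _ => by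
        rw [finrank_gradedPiece_top_one]
        omega

end Dimension
end UnexpectedHypersurfaces

namespace UnexpectedHypersurfaces

/-! ### Conditions imposed by finitely many points. -/

section Evaluation

variable {K : Type*} [Field K] {n : ℕ}

/-- Evaluation of polynomials at representatives of finitely many points. -/
noncomputable def evalAt (T : Finset (ℙ K (Vec K n))) : Poly K n →ₗ[K] (T → K) :=
  LinearMap.pi fun P => (aeval P.1.rep : Poly K n →ₐ[K] K).toLinearMap

theorem evalAt_apply (T : Finset (ℙ K (Vec K n))) (f : Poly K n) (P : T) :
    evalAt T f P = eval P.1.rep f := by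
  simp [evalAt]

theorem gradedPiece_inf_ker_evalAt (I : Ideal (Poly K n)) (T : Finset (ℙ K (Vec K n))) (d : ℕ) :
    gradedPiece I d ⊓ LinearMap.ker (evalAt T) =
      gradedPiece (projIdeal (T : Set (ℙ K (Vec K n))) ⊓ I) d := by
  ext f
  rw [Submodule.mem_inf, mem_gradedPiece_natCast, mem_gradedPiece_natCast, LinearMap.mem_ker]
  have h : f.IsHomogeneous d →
      (evalAt T f = 0 ↔ f ∈ projIdeal (T : Set (ℙ K (Vec K n)))) := by
    intro hf
    rw [mem_projIdeal_of_isHomogeneous hf]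
    constructor
    · intro h P hP
      rw [← evalAt_apply T f ⟨P, hP⟩, h, Pi.zero_apply]
    · intro h
      ext P
      rw [evalAt_apply]
      exact h P.1 P.2
  constructor
  · rintro ⟨⟨h1, h2⟩, h3⟩
    exact ⟨⟨(h h2).1 h3, h1⟩, h2⟩
  · rintro ⟨⟨h1, h2⟩, h3⟩
    exact ⟨⟨h2, h3⟩, (h h3).2 h1⟩

theorem quotDim_natCast_eq_finrank (I : Ideal (Poly K n)) (T : Finset (ℙ K (Vec K n))) (d : ℕ) :
    quotDim I (projIdeal (T : Set (ℙ K (Vec K n))) ⊓ I) d =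
      Module.finrank K ((gradedPiece I d).map (evalAt T)) := by
  have h1 := finrank_map_add_finrank_inf_ker (gradedPiece I (d : ℤ)) (evalAt T)
  rw [gradedPiece_inf_ker_evalAt] at h1
  have h2 := quotDim_add_hdim (I := I) (J := projIdeal (T : Set (ℙ K (Vec K n))) ⊓ I)
    inf_le_right (d : ℤ)
  rw [hdim, hdim] at h2
  omega

theorem quotDim_le_card (I : Ideal (Poly K n)) (T : Finset (ℙ K (Vec K n))) (d : ℤ) :
    quotDim I (projIdeal (T : Set (ℙ K (Vec K n))) ⊓ I) d ≤ T.card := by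
  rcases lt_or_ge d 0 with hd | hd
  · have h := quotDim_add_hdim (I := I) (J := projIdeal (T : Set (ℙ K (Vec K n))) ⊓ I)
      inf_le_right d
    rw [hdim, hdim, gradedPiece_of_neg _ hd, gradedPiece_of_neg _ hd] at h
    omega
  · obtain ⟨k, rfl⟩ := Int.eq_ofNat_of_zero_le hd
    rw [quotDim_natCast_eq_finrank]
    refine (Submodule.finrank_le _).trans ?_
    rw [Module.finrank_fintype_fun_eq_card, Fintype.card_coe]

theorem quotDim_eq_card {I : Ideal (Poly K n)} {T : Finset (ℙ K (Vec K n))} {d : ℕ}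
    (h : ∀ P ∈ T, ∃ f ∈ gradedPiece I d, eval P.rep f ≠ 0 ∧ ∀ Q ∈ T, Q ≠ P → eval Q.rep f = 0) :
    quotDim I (projIdeal (T : Set (ℙ K (Vec K n))) ⊓ I) d = T.card := by
  classical
  rw [quotDim_natCast_eq_finrank]
  have : (gradedPiece I (d : ℤ)).map (evalAt T) = ⊤ := by
    rw [eq_top_iff, ← (Pi.basisFun K T).span_eq, Submodule.span_le]
    rintro _ ⟨P, rfl⟩
    obtain ⟨f, hf, hfP, hfQ⟩ := h P.1 P.2
    refine ⟨(eval P.1.rep f)⁻¹ • f, Submodule.smul_mem _ _ hf, ?_⟩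
    ext Q
    rw [map_smul, Pi.smul_apply, evalAt_apply, smul_eq_mul, Pi.basisFun_apply]
    by_cases hQ : Q = P
    · rw [hQ, Pi.single_eq_same, inv_mul_cancel₀ hfP]
    · rw [Pi.single_eq_of_ne hQ, hfQ Q.1 Q.2 fun e => hQ (Subtype.ext e), mul_zero]
  rw [this, finrank_top, Module.finrank_fintype_fun_eq_card, Fintype.card_coe]

theorem quotDim_top_le_card (T : Finset (ℙ K (Vec K n))) (d : ℤ) :
    quotDim ⊤ (projIdeal (T : Set (ℙ K (Vec K n)))) d ≤ T.card := by
  have := quotDim_le_card ⊤ T d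
  rwa [inf_top_eq] at this

theorem quotDim_top_mono {T Z : Finset (ℙ K (Vec K n))} (h : T ⊆ Z) (d : ℤ) :
    quotDim ⊤ (projIdeal (T : Set (ℙ K (Vec K n)))) d ≤
      quotDim ⊤ (projIdeal (Z : Set (ℙ K (Vec K n)))) d := by
  have h1 := quotDim_add_hdim (I := ⊤) (J := projIdeal (T : Set (ℙ K (Vec K n)))) le_top d
  have h2 := quotDim_add_hdim (I := ⊤) (J := projIdeal (Z : Set (ℙ K (Vec K n)))) le_top d
  have h3 : hdim (projIdeal (Z : Set (ℙ K (Vec K n)))) d ≤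
      hdim (projIdeal (T : Set (ℙ K (Vec K n)))) d :=
    Submodule.finrank_mono (gradedPiece_mono (projIdeal_anti (Finset.coe_subset.2 h)) d)
  omega

/-- Points that are sparse on linear subspaces impose independent conditions on forms. -/
theorem quotDim_top_eq_card {T : Finset (ℙ K (Vec K n))} {d : ℕ} (hd : 0 < d)
    (h : ∀ A ⊆ T, A.Nonempty → A.card ≤
      d * (Module.finrank K (Submodule.span K (Projectivization.rep '' (A : Set (ℙ K (Vec K n))))) - 1)
        + 1) :
    quotDim ⊤ (projIdeal (T : Set (ℙ K (Vec K n)))) d = T.card := by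
  classical
  have key := quotDim_eq_card (I := ⊤) (T := T) (d := d) fun P hP => by
    obtain ⟨f, hf, hf'⟩ := exists_separating_forms hd T Projectivization.rep h hP P.rep_nonzero
    choose z hz using fun k => dual_eq_dotProduct (f k)
    refine ⟨∏ k, linForm (z k), mem_gradedPiece_natCast.2 ⟨trivial, ?_⟩, ?_, ?_⟩
    · have := IsHomogeneous.prod Finset.univ (fun k => linForm (z k)) (fun _ => 1)
        fun k _ => linForm_isHomogeneous (z k)
      simpa using this
    · rw [map_prod]
      refine Finset.prod_ne_zero_iff.2 fun k _ => ?_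
      rw [eval_linForm, ← hz]
      exact hf k
    · intro Q hQ hQP
      obtain ⟨k, hk⟩ := hf' Q hQ hQP
      rw [map_prod]
      refine Finset.prod_eq_zero (Finset.mem_univ k) ?_
      rw [eval_linForm, ← hz]
      exact hk
  rwa [inf_top_eq] at key

end Evaluation

/-! ### Large degree and the sum of the splitting type. -/

section LargeDegree

variable {K : Type*} [Field K] {n : ℕ} {u : Fin 2 → Vec K n} {Z : Finset (ℙ K (Vec K n))}

/-- By transversality the hyperplanes spanned by Q and the points of Z are distinct. For each P, the
product of those through the other points, padded by a pencil form nonzero at P up to degree m and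
by one coordinate nonzero at P, isolates P. -/
theorem quotDim_linIdeal_pow_eq_card [Infinite K] (hu : LinearIndependent K u)
    (hZ : IsTransverse Z u) {m : ℕ} (hm : Z.card ≤ m + 1) :
    quotDim (linIdeal (cutOut u) ^ m) (projIdeal (Z : Set (ℙ K (Vec K n))) ⊓ linIdeal (cutOut u) ^ m)
      ((m + 1 : ℕ) : ℤ) = Z.card := by
  classical
  refine quotDim_eq_card fun P hP => ?_
  obtain ⟨i, hi⟩ := Function.ne_iff.1 P.rep_nonzero
  obtain ⟨j, hj⟩ : ∃ j : Fin 2, eval ![u 1 ⬝ᵥ P.rep, -(u 0 ⬝ᵥ P.rep)] (X j) ≠ 0 := by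
    rcases hZ.1 P hP with h | h
    · exact ⟨1, by simpa using h⟩
    · exact ⟨0, by simpa using h⟩
  let h : Poly K 1 := (∏ Q ∈ Z.erase P, linForm ![u 0 ⬝ᵥ Q.rep, u 1 ⬝ᵥ Q.rep]) *
    X j ^ (m - (Z.erase P).card)
  have hcard : (Z.erase P).card ≤ m := by rw [Finset.card_erase_of_mem hP]; omega
  have hh : h.IsHomogeneous m := by
    have := (IsHomogeneous.prod (Z.erase P) (fun Q => linForm (n := 1) ![u 0 ⬝ᵥ Q.rep, u 1 ⬝ᵥ Q.rep])
      (fun _ => 1) fun Q _ => linForm_isHomogeneous _).mul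
      (isHomogeneous_X_pow (R := K) j (m - (Z.erase P).card))
    rwa [Finset.sum_const, smul_eq_mul, mul_one, Nat.add_sub_cancel' hcard] at this
  have hg : ∀ l, ((Pi.single i h : Fin (n + 1) → Poly K 1) l).IsHomogeneous m := by
    intro l
    by_cases hl : l = i
    · rw [hl, Pi.single_eq_same]; exact hh
    · rw [Pi.single_eq_of_ne hl]; exact isHomogeneous_zero _ _ _
  have heval : ∀ x, eval x (dualForm u (Pi.single i h)) =
      eval ![u 1 ⬝ᵥ x, -(u 0 ⬝ᵥ x)] h * x i := by
    intro x
    rw [eval_dualForm, Finset.sum_eq_single i (fun l _ hl => by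
      rw [Pi.single_eq_of_ne hl, map_zero, zero_mul]) (fun h => absurd (Finset.mem_univ i) h),
      Pi.single_eq_same]
  have hlin : ∀ (Q : ℙ K (Vec K n)) (x : Vec K n), eval ![u 1 ⬝ᵥ x, -(u 0 ⬝ᵥ x)]
      (linForm (n := 1) ![u 0 ⬝ᵥ Q.rep, u 1 ⬝ᵥ Q.rep]) =
        (u 0 ⬝ᵥ Q.rep) * (u 1 ⬝ᵥ x) - (u 1 ⬝ᵥ Q.rep) * (u 0 ⬝ᵥ x) := by
    intro Q x
    rw [eval_linForm]
    simp [dotProduct, Fin.sum_univ_two]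
    ring
  refine ⟨_, dualForm_mem_gradedPiece hu hg, ?_, ?_⟩
  · rw [heval, map_mul, map_prod, map_pow]
    refine mul_ne_zero (mul_ne_zero ?_ (pow_ne_zero _ hj)) hi
    refine Finset.prod_ne_zero_iff.2 fun Q hQ => ?_
    rw [hlin]
    exact hZ.2 Q (Finset.mem_of_mem_erase hQ) P hP (Finset.ne_of_mem_erase hQ)
  · intro Q hQ hQP
    rw [heval, map_mul, map_prod, Finset.prod_eq_zero (Finset.mem_erase.2 ⟨hQP, hQ⟩), zero_mul,
      zero_mul]
    rw [hlin]
    ring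

/-- The splitting type adds up to `|Z| - 1`. -/
theorem sum_splitting_add_one [IsAlgClosed K] (hu : LinearIndependent K u)
    (hZ : IsTransverse Z u) (hne : Z.Nonempty) {a : Fin n → ℕ}
    (hR : RestrictsTo Z a (Submodule.span K (Set.range u))) : ∑ i, a i + 1 = Z.card := by
  have : Infinite K := IsAlgClosed.instInfinite
  -- Large enough for Z to impose independent conditions and for every subtraction m + 1 - a i to be
  -- exact.
  let m := Z.card + ∑ i, a i
  have h1 := quotDim_linIdeal_pow_eq_card hu hZ (m := m) (by omega)
  have h2 := quotDim_add_hdim (I := linIdeal (cutOut u) ^ m)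
    (J := projIdeal (Z : Set (ℙ K (Vec K n))) ⊓ linIdeal (cutOut u) ^ m) inf_le_right
    ((m + 1 : ℕ) : ℤ)
  rw [h1, hdim_eq_sum_of_restrictsTo hu hZ hne hR m, hdim_linIdeal_pow hu] at h2
  have h3 : ∑ i, (m + 1 - a i) + ∑ i, a i = n * (m + 1) := by
    rw [← Finset.sum_add_distrib, Finset.sum_congr rfl (g := fun _ => m + 1)]
    · simp
    · intro i hi
      have := Finset.single_le_sum (f := a) (fun _ _ => Nat.zero_le _) hi
      omega
  omega

end LargeDegree
end UnexpectedHypersurfaces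

namespace UnexpectedHypersurfaces

/-! ### Irreducible subvarieties and the conditions they impose. -/

section Subvarieties

variable {K : Type*} [Field K] {n : ℕ}

theorem IsProjClosed.union {X Y : Set (ℙ K (Vec K n))} (hX : IsProjClosed X) (hY : IsProjClosed Y) :
    IsProjClosed (X ∪ Y) := by
  obtain ⟨F, hF, rfl⟩ := hX
  obtain ⟨G, hG, rfl⟩ := hY
  refine ⟨Set.image2 (· * ·) F G, ?_, ?_⟩
  · rintro _ ⟨f, hf, g, hg, rfl⟩
    obtain ⟨k, hk⟩ := hF f hf
    obtain ⟨l, hl⟩ := hG g hg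
    exact ⟨k + l, hk.mul hl⟩
  · ext P
    constructor
    · rintro (h | h)
      · rintro _ ⟨f, hf, g, hg, rfl⟩
        rw [map_mul, h f hf, zero_mul]
      · rintro _ ⟨f, hf, g, hg, rfl⟩
        rw [map_mul, h g hg, mul_zero]
    · intro h
      by_contra hn
      simp only [Set.mem_union, not_or, Set.mem_ofPred_eq, not_forall] at hn
      obtain ⟨⟨f, hf, hfP⟩, g, hg, hgP⟩ := hn
      have := h _ ⟨f, hf, g, hg, rfl⟩
      rw [map_mul] at this
      exact mul_ne_zero hfP hgP this

theorem isProjClosed_empty : IsProjClosed (∅ : Set (ℙ K (Vec K n))) := by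
  refine ⟨{1}, ?_, ?_⟩
  · rintro _ rfl
    exact ⟨0, isHomogeneous_one _ _⟩
  · ext P
    simp

theorem isProjClosed_univ : IsProjClosed (Set.univ : Set (ℙ K (Vec K n))) :=
  ⟨∅, by simp, by simp⟩

theorem mem_projSet {H : Submodule K (Vec K n)} {P : ℙ K (Vec K n)} :
    P ∈ projSet H ↔ P.rep ∈ H := by
  rw [projSet, Set.mem_ofPred_eq, Projectivization.submodule_eq, Submodule.span_singleton_le_iff_mem]

theorem isProjClosed_projSet [Infinite K] (H : Submodule K (Vec K n)) : IsProjClosed (projSet H) := by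
  refine ⟨{f | ∃ z, (∀ x ∈ H, z ⬝ᵥ x = 0) ∧ f = linForm z}, ?_, ?_⟩
  · rintro _ ⟨z, -, rfl⟩
    exact ⟨1, linForm_isHomogeneous z⟩
  · ext P
    rw [mem_projSet]
    constructor
    · rintro h _ ⟨z, hz, rfl⟩
      rw [eval_linForm, hz _ h]
    · intro h
      by_contra hP
      obtain ⟨z, hz, hzP⟩ := exists_orthogonal_avoiding H {P.rep} (by simpa using hP)
      refine hzP P.rep (Finset.mem_singleton_self _) ?_
      rw [← eval_linForm]
      exact h _ ⟨z, hz, rfl⟩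

theorem isProjClosed_biUnion_projSet [Infinite K] (s : Finset (Submodule K (Vec K n))) :
    IsProjClosed (⋃ p ∈ s, projSet p) := by
  classical
  induction s using Finset.induction_on with
  | empty => simpa using isProjClosed_empty
  | insert p s _ ih =>
    rw [Finset.set_biUnion_insert]
    exact (isProjClosed_projSet p).union ih

theorem IsIrredSubvariety.exists_subset_projSet [Infinite K] {X : Set (ℙ K (Vec K n))}
    (hX : IsIrredSubvariety X) {s : Finset (Submodule K (Vec K n))}
    (hs : X ⊆ ⋃ p ∈ s, projSet p) : ∃ p ∈ s, X ⊆ projSet p := by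
  classical
  induction s using Finset.induction_on with
  | empty =>
    obtain ⟨P, hP⟩ := hX.2.1
    simpa using hs hP
  | insert p s _ ih =>
    rw [Finset.set_biUnion_insert] at hs
    rcases hX.2.2 _ _ (isProjClosed_projSet p) (isProjClosed_biUnion_projSet s) hs with h | h
    · exact ⟨p, Finset.mem_insert_self p s, h⟩
    · obtain ⟨q, hq, h⟩ := ih h
      exact ⟨q, Finset.mem_insert_of_mem hq, h⟩

theorem cone_subset_iff {X : Set (ℙ K (Vec K n))} {H : Submodule K (Vec K n)} :
    cone X ⊆ H ↔ X ⊆ projSet H := by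
  constructor
  · intro h P hP
    exact mem_projSet.2 (h (rep_mem_cone hP))
  · intro h v hv
    obtain ⟨P, hP, c, -, rfl⟩ := mem_cone_iff.1 hv
    exact H.smul_mem c (mem_projSet.1 (h hP))

/-- Needed as the test variety X = ℙⁿ when passing from very unexpected to unexpected. -/
theorem isIrredSubvariety_univ [Infinite K] : IsIrredSubvariety (Set.univ : Set (ℙ K (Vec K n))) := by
  refine ⟨isProjClosed_univ, ⟨Projectivization.mk K (fun _ => 1)
    fun h => one_ne_zero (congrFun h 0), trivial⟩, ?_⟩
  rintro A B ⟨F, hF, rfl⟩ ⟨G, hG, rfl⟩ h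
  by_contra hn
  simp only [not_or, Set.univ_subset_iff, Set.eq_univ_iff_forall, Set.mem_ofPred_eq,
    not_forall] at hn
  obtain ⟨⟨P, f, hf, hfP⟩, Q, g, hg, hgQ⟩ := hn
  obtain ⟨k, hk⟩ := hF f hf
  obtain ⟨l, hl⟩ := hG g hg
  have h0 : f * g ∈ projIdeal (Set.univ : Set (ℙ K (Vec K n))) := by
    refine (mem_projIdeal_of_isHomogeneous (hk.mul hl)).2 fun R _ => ?_
    rw [map_mul]
    rcases h (Set.mem_univ R) with h | h
    · rw [h f hf, zero_mul]
    · rw [h g hg, mul_zero]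
  rw [projIdeal_univ, Ideal.mem_bot, mul_eq_zero] at h0
  rcases h0 with h0 | h0
  · exact hfP (by rw [h0, map_zero])
  · exact hgQ (by rw [h0, map_zero])

/-- An irreducible X covered by finitely many linear subspaces lies in one of them, which then
contains its span; this is the covering hypothesis of `genericRank_eq_of_not_covered`. -/
theorem IsIrredSubvariety.genericRank_cone [Infinite K] {X : Set (ℙ K (Vec K n))}
    (hX : IsIrredSubvariety X) (hr : 2 ≤ Module.finrank K (Submodule.span K (cone X))) (m : ℕ) :
    genericRank m (cone X) = genericRank m (Submodule.span K (cone X) : Set (Vec K n)) := by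
  refine genericRank_eq_of_not_covered m (cone X) _ hr Submodule.subset_span fun s hs => ?_
  have : X ⊆ ⋃ p ∈ s, projSet p := by
    intro P hP
    have := hs (rep_mem_cone hP)
    simp only [Set.mem_iUnion] at this ⊢
    obtain ⟨p, hp, h⟩ := this
    exact ⟨p, hp, mem_projSet.2 h⟩
  obtain ⟨p, hp, h⟩ := hX.exists_subset_projSet this
  exact ⟨p, hp, Submodule.span_le.2 (cone_subset_iff.2 h)⟩

theorem finrank_span_powVec_cone_pos {u : Fin 2 → Vec K n} {P : ℙ K (Vec K n)}
    (hu : u 0 ⬝ᵥ P.rep ≠ 0 ∨ u 1 ⬝ᵥ P.rep ≠ 0) {X : Set (ℙ K (Vec K n))} (hP : P ∈ X) (m : ℕ) :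
    0 < Module.finrank K (Submodule.span K (powVec m u '' cone X)) := by
  have hne : powVec m u P.rep ≠ 0 := by
    obtain ⟨i, hi⟩ := Function.ne_iff.1 P.rep_nonzero
    intro h0
    rcases hu with h | h
    · have := congrFun h0 (Fin.last m, i)
      simp only [powVec, Fin.val_last, tsub_self, pow_zero, mul_one, Pi.zero_apply] at this
      exact mul_ne_zero (pow_ne_zero _ h) hi this
    · have := congrFun h0 (0, i)
      simp only [powVec, Fin.val_zero, tsub_zero, pow_zero, one_mul, Pi.zero_apply] at this
      exact mul_ne_zero (pow_ne_zero _ h) hi this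
  have hmem : powVec m u P.rep ∈ Submodule.span K (powVec m u '' cone X) :=
    Submodule.subset_span ⟨_, rep_mem_cone hP, rfl⟩
  rw [Module.finrank_pos_iff_exists_ne_zero]
  exact ⟨⟨_, hmem⟩, fun h => hne (congrArg Subtype.val h)⟩

/-- A lower bound for the conditions that an irreducible subvariety imposes on the forms of degree
`m + 1` with multiplicity `m` along a general subspace of codimension two. -/
theorem IsIrredSubvariety.forGeneral_le_finrank [Infinite K] (hn : 0 < n) {X : Set (ℙ K (Vec K n))}
    (hX : IsIrredSubvariety X) (m : ℕ) :
    ForGeneral 2 fun u => (m + 1) * (Module.finrank K (Submodule.span K (cone X)) - 1) + 1 ≤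
      Module.finrank K (Submodule.span K (powVec m u '' cone X)) := by
  rcases lt_or_ge (Module.finrank K (Submodule.span K (cone X))) 2 with hr | hr
  · obtain ⟨P, hP⟩ := hX.2.1
    refine (forGeneral_isTransverse {P}).mono fun u _ hu => ?_
    have := finrank_span_powVec_cone_pos (hu.1 P (Finset.mem_singleton_self P)) hP m
    rw [show Module.finrank K (Submodule.span K (cone X)) - 1 = 0 by omega]
    omega
  · refine (forGeneral_finrank_span_powVec m (cone X)).mono fun u _ hu => ?_
    have h1 := genericRank_submodule hn m _ hr
    rw [hu, hX.genericRank_cone hr m]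
    obtain ⟨r, hr'⟩ := Nat.exists_eq_add_of_le hr
    rw [hr'] at h1 ⊢
    rw [show 2 + r - 1 = r + 1 by omega]
    nlinarith

end Subvarieties
end UnexpectedHypersurfaces

namespace UnexpectedHypersurfaces

/-! ### Choice of the subset T. -/

section Sparse

variable {K : Type*} [Field K] {n : ℕ}

theorem eq_of_rep_mem_of_finrank_le_one {H : Submodule K (Vec K n)} (hH : Module.finrank K H ≤ 1)
    {P Q : ℙ K (Vec K n)} (hP : P.rep ∈ H) (hQ : Q.rep ∈ H) : P = Q := by
  by_contra h
  refine not_linearIndependent_rep h ?_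
  have hle : Submodule.span K {P.rep} ≤ H := (Submodule.span_singleton_le_iff_mem _ _).2 hP
  rw [Submodule.eq_of_le_of_finrank_le hle (by rwa [finrank_span_singleton P.rep_nonzero])]
  exact hQ

theorem span_cone_eq (A : Set (ℙ K (Vec K n))) :
    Submodule.span K (cone A) = Submodule.span K (Projectivization.rep '' A) := by
  refine le_antisymm (Submodule.span_le.2 (cone_subset_iff.2 fun P hP => mem_projSet.2
    (Submodule.subset_span ⟨P, hP, rfl⟩))) (Submodule.span_mono ?_)
  rintro _ ⟨P, hP, rfl⟩
  exact rep_mem_cone hP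

/-- The conditions imposed by A are among those imposed by its span, which number (m + 1)(r - 1) + 1
if the span has dimension r ≥ 2. A span of dimension at most 1 contains at most one point. -/
theorem card_le_of_le_genericRank [Infinite K] (hn : 0 < n) {m : ℕ} {A : Finset (ℙ K (Vec K n))}
    (h : A.card ≤ genericRank m (cone (A : Set (ℙ K (Vec K n))))) : A.card ≤ (m + 1) *
      (Module.finrank K (Submodule.span K (Projectivization.rep '' (A : Set (ℙ K (Vec K n))))) - 1)
        + 1 := by
  set H := Submodule.span K (Projectivization.rep '' (A : Set (ℙ K (Vec K n))))
  have hmem : ∀ P ∈ A, P.rep ∈ H := fun P hP => Submodule.subset_span ⟨P, hP, rfl⟩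
  rcases lt_or_ge (Module.finrank K H) 2 with hr | hr
  · refine (Finset.card_le_one.2 fun P hP Q hQ => ?_).trans (Nat.le_add_left 1 _)
    exact eq_of_rep_mem_of_finrank_le_one (by omega) (hmem P hP) (hmem Q hQ)
  · have h1 := genericRank_submodule hn m H hr
    have h2 : genericRank m (cone (A : Set (ℙ K (Vec K n)))) ≤ genericRank m (H : Set (Vec K n)) :=
      genericRank_mono m (cone_subset_iff.2 fun P hP => mem_projSet.2 (hmem P hP))
    obtain ⟨r, hr'⟩ := Nat.exists_eq_add_of_le hr
    rw [hr'] at h1 ⊢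
    rw [show 2 + r - 1 = r + 1 by omega]
    nlinarith

open Classical in
/-- The balancing condition on linear subspaces, without denominators. -/
theorem mul_card_filter_sub_one_le (hn : 0 < n) {Z : Finset (ℙ K (Vec K n))}
    (hH : ∀ H : Submodule K (Vec K n), 2 ≤ Module.finrank K H →
      ((((Z : Set (ℙ K (Vec K n))) ∩ projSet H).ncard : ℚ) - 1) / ((Module.finrank K H : ℚ) - 1)
        ≤ ((Z.card : ℚ) - 1) / (n : ℚ))
    {A : Finset (ℙ K (Vec K n))} (hA : A ⊆ Z) (hne : A.Nonempty) :
    n * ({P ∈ Z | P.rep ∈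
        Submodule.span K (Projectivization.rep '' (A : Set (ℙ K (Vec K n))))}.card - 1) ≤
      (Module.finrank K (Submodule.span K (Projectivization.rep '' (A : Set (ℙ K (Vec K n))))) - 1) *
        (Z.card - 1) := by
  set H := Submodule.span K (Projectivization.rep '' (A : Set (ℙ K (Vec K n))))
  have hcard : ((Z : Set (ℙ K (Vec K n))) ∩ projSet H).ncard = {P ∈ Z | P.rep ∈ H}.card := by
    rw [← Set.ncard_coe_finset]
    congr 1
    ext P
    simp [mem_projSet]
  rcases lt_or_ge (Module.finrank K H) 2 with hr | hr
  · have : {P ∈ Z | P.rep ∈ H}.card ≤ 1 := Finset.card_le_one.2 fun P hP Q hQ =>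
      eq_of_rep_mem_of_finrank_le_one (by omega) (Finset.mem_filter.1 hP).2
        (Finset.mem_filter.1 hQ).2
    rw [Nat.sub_eq_zero_of_le this, mul_zero]
    exact Nat.zero_le _
  · obtain ⟨P, hP⟩ := hne
    have hc : 1 ≤ {P ∈ Z | P.rep ∈ H}.card := Finset.card_pos.2
      ⟨P, Finset.mem_filter.2 ⟨hA hP, Submodule.subset_span ⟨P, hP, rfl⟩⟩⟩
    have hz : 1 ≤ Z.card := Finset.card_pos.2 ⟨P, hA hP⟩
    have h := hH H hr
    have hr' : (2 : ℚ) ≤ Module.finrank K H := by exact_mod_cast hr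
    rw [hcard, div_le_div_iff₀ (by linarith) (by exact_mod_cast hn)] at h
    have h' : (n : ℚ) * (({P ∈ Z | P.rep ∈ H}.card - 1 : ℕ) : ℚ) ≤
        ((Module.finrank K H - 1 : ℕ) : ℚ) * ((Z.card - 1 : ℕ) : ℚ) := by
      rw [Nat.cast_sub hc, Nat.cast_sub (by omega), Nat.cast_sub hz]
      push_cast
      linarith
    exact_mod_cast h'

theorem exists_sparse_subset [Infinite K] (hn : 0 < n) {Z : Finset (ℙ K (Vec K n))}
    (hH : ∀ H : Submodule K (Vec K n), 2 ≤ Module.finrank K H →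
      ((((Z : Set (ℙ K (Vec K n))) ∩ projSet H).ncard : ℚ) - 1) / ((Module.finrank K H : ℚ) - 1)
        ≤ ((Z.card : ℚ) - 1) / (n : ℚ)) {m : ℕ}
    (hr : genericRank m (cone (Z : Set (ℙ K (Vec K n)))) ≤ n * (m + 1))
    (hrZ : genericRank m (cone (Z : Set (ℙ K (Vec K n)))) < Z.card) :
    ∃ T ⊆ Z, genericRank m (cone (T : Set (ℙ K (Vec K n)))) =
        genericRank m (cone (Z : Set (ℙ K (Vec K n)))) ∧
      genericRank m (cone (Z : Set (ℙ K (Vec K n)))) < T.card ∧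
      ∀ A ⊆ T, A.Nonempty → A.card ≤ (m + 1) * (Module.finrank K
        (Submodule.span K (Projectivization.rep '' (A : Set (ℙ K (Vec K n))))) - 1) + 1 := by
  classical
  have hflat := fun A hA hne => mul_card_filter_sub_one_le hn hH (A := A) hA hne
  rcases le_or_gt Z.card (n * (m + 1)) with hZ | hZ
  · refine ⟨Z, Finset.Subset.refl Z, rfl, hrZ, fun A hA hne => ?_⟩
    have h1 := hflat A hA hne
    set H := Submodule.span K (Projectivization.rep '' (A : Set (ℙ K (Vec K n))))
    have h2 : A.card ≤ {P ∈ Z | P.rep ∈ H}.card := Finset.card_le_card fun P hP =>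
      Finset.mem_filter.2 ⟨hA hP, Submodule.subset_span ⟨P, hP, rfl⟩⟩
    have h3 : n * ({P ∈ Z | P.rep ∈ H}.card - 1) ≤ n * ((m + 1) * (Module.finrank K H - 1)) := by
      -- If |Z| - 1 ≤ n (m + 1), the balancing hypothesis alone makes Z sparse, and T = Z.
      refine h1.trans ((Nat.mul_le_mul_left _ (show Z.card - 1 ≤ n * (m + 1) by omega)).trans ?_)
      exact le_of_eq (by ring)
    have h4 := Nat.le_of_mul_le_mul_left h3 hn
    omega
  · obtain ⟨u, -, hgen⟩ := (ForGeneral.forall_finset Z.powerset fun A _ =>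
      forGeneral_finrank_span_powVec m (cone (A : Set (ℙ K (Vec K n))))).exists hn
    obtain ⟨b, hbZ, -, hspan, hb⟩ := exists_linearIndepOn_extension
      (linearIndepOn_empty K fun P : ℙ K (Vec K n) => powVec m u P.rep)
      (Set.empty_subset (Z : Set (ℙ K (Vec K n))))
    obtain ⟨B, rfl⟩ := (Z.finite_toSet.subset hbZ).exists_finset_coe
    have hBZ : B ⊆ Z := Finset.coe_subset.1 hbZ
    have hrank : ∀ A ⊆ B, A.card = genericRank m (cone (A : Set (ℙ K (Vec K n)))) := by
      intro A hA
      rw [← hgen A (Finset.mem_powerset.2 (hA.trans hBZ)), span_powVec_cone]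
      have hli : LinearIndepOn K (fun P : ℙ K (Vec K n) => powVec m u P.rep) (A : Set _) :=
        hb.mono (Finset.coe_subset.2 hA)
      have := finrank_span_eq_card hli
      rw [Set.image_eq_range, this]
      simp
    have hBr : B.card = genericRank m (cone (Z : Set (ℙ K (Vec K n)))) := by
      rw [hrank B (Finset.Subset.refl B), ← hgen B (Finset.mem_powerset.2 hBZ),
        ← hgen Z (Finset.mem_powerset_self Z), span_powVec_cone, span_powVec_cone,
        le_antisymm (Submodule.span_mono (Set.image_mono hbZ)) (Submodule.span_le.2 hspan)]
    obtain ⟨p, hpZ, hpB, hp⟩ := exists_insert_sparse (Nat.succ_pos m) Z Projectivization.rep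
      (fun P _ => P.rep_nonzero) hZ (fun A hA hne => by convert hflat A hA hne) hBZ (hBr ▸ hr)
      fun A hA _ => card_le_of_le_genericRank hn (hrank A hA).le
    have hTZ : insert p B ⊆ Z := Finset.insert_subset hpZ hBZ
    refine ⟨insert p B, hTZ, le_antisymm ?_ ?_, ?_, fun A hA hne => hp A (by convert hA) hne⟩
    · exact genericRank_mono m (cone_mono (Finset.coe_subset.2 hTZ))
    · rw [← hBr, hrank B (Finset.Subset.refl B)]
      exact genericRank_mono m (cone_mono (Finset.coe_subset.2 (Finset.subset_insert p B)))
    · rw [Finset.card_insert_of_notMem hpB, hBr]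
      exact Nat.lt_succ_self _

end Sparse

/-! ### Very unexpected versus unexpected hypersurfaces. -/

section Unexpected

variable {K : Type*} [Field K] {n : ℕ} {Z : Finset (ℙ K (Vec K n))}

/-- Condition 2 for X = ℙⁿ gives |T| ≤ dim [I(Q)^m]_d, and by condition 3 the set T imposes fewer
conditions there than on all forms of degree d, hence fewer than |T|. So some nonzero form through T
remains, and more than the expected number, since Z imposes at least as many conditions on all forms
as T. -/
theorem AdmitsVeryUnexpected.admitsUnexpected [Infinite K] {d : ℤ} (h : AdmitsVeryUnexpected Z d) :
    AdmitsUnexpected Z d := by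
  obtain ⟨T, hTZ, h1, h2, h3⟩ := h
  refine ((h1.and (h2 _ isIrredSubvariety_univ)).and h3).mono ?_
  rintro u - ⟨⟨e1, e2⟩, e3⟩
  set m := (d - 1).toNat
  rw [Set.inter_univ, Set.ncard_coe_finset, projIdeal_univ, bot_inf_eq] at e2
  have e4 := quotDim_add_hdim (I := linIdeal (cutOut u) ^ m)
    (J := projIdeal (T : Set (ℙ K (Vec K n))) ⊓ linIdeal (cutOut u) ^ m) inf_le_right d
  have e5 := quotDim_add_hdim (I := linIdeal (cutOut u) ^ m) (J := ⊥) bot_le d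
  have e6 := quotDim_top_le_card T d
  have e7 := quotDim_top_mono hTZ d
  have e8 : hdim (projIdeal (Z : Set (ℙ K (Vec K n))) ⊓ linIdeal (cutOut u) ^ m) d =
      hdim (projIdeal (T : Set (ℙ K (Vec K n))) ⊓ linIdeal (cutOut u) ^ m) d := by
    rw [hdim, e1, hdim]
  rw [e8]
  omega

theorem hdim_inf_eq_zero_of_nonpos (hne : Z.Nonempty) (I : Ideal (Poly K n)) {d : ℤ} (hd : d ≤ 0) :
    hdim (projIdeal (Z : Set (ℙ K (Vec K n))) ⊓ I) d = 0 := by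
  rw [hdim]
  rcases hd.lt_or_eq with hd | rfl
  · rw [gradedPiece_of_neg _ hd, finrank_bot]
  · rw [Submodule.finrank_eq_zero, Submodule.eq_bot_iff]
    intro f hf
    obtain ⟨⟨h1, -⟩, h2⟩ := mem_gradedPiece_natCast (d := 0).1 hf
    obtain ⟨P, hP⟩ := hne
    have h3 := (mem_projIdeal_of_isHomogeneous h2).1 h1 P hP
    obtain ⟨c, rfl⟩ : ∃ c, f = C c :=
      ⟨_, totalDegree_eq_zero_iff_eq_C.1 (Nat.le_zero.1 h2.totalDegree_le)⟩
    rw [eval_C] at h3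
    rw [h3, C_0]

/-- T has the rank of Z, which gives condition 1 by inclusion and equal dimension. Sparsity of T ∩ X
and the lower bound for the conditions imposed by X give condition 2. For condition 3, sparsity
makes T independent on all forms of degree m + 1, while its rank on [I(Q)^m] is less than |T|. -/
theorem AdmitsVeryUnexpected.of_genericRank [Infinite K] (hn : 0 < n)
    (hH : ∀ H : Submodule K (Vec K n), 2 ≤ Module.finrank K H →
      ((((Z : Set (ℙ K (Vec K n))) ∩ projSet H).ncard : ℚ) - 1) / ((Module.finrank K H : ℚ) - 1)
        ≤ ((Z.card : ℚ) - 1) / (n : ℚ)) {m : ℕ}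
    (hr : genericRank m (cone (Z : Set (ℙ K (Vec K n)))) ≤ n * (m + 1))
    (hrZ : genericRank m (cone (Z : Set (ℙ K (Vec K n)))) < Z.card) :
    AdmitsVeryUnexpected Z ((m + 1 : ℕ) : ℤ) := by
  obtain ⟨T, hTZ, hTr, hTcard, hT⟩ := exists_sparse_subset hn hH hr hrZ
  have hm : (((m + 1 : ℕ) : ℤ) - 1).toNat = m := by omega
  rw [AdmitsVeryUnexpected, hm]
  have hgT := forGeneral_finrank_span_powVec m (cone (T : Set (ℙ K (Vec K n))))
  have hgZ := forGeneral_finrank_span_powVec m (cone (Z : Set (ℙ K (Vec K n))))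
  refine ⟨T, hTZ, (hgT.and hgZ).mono ?_, fun X hX => (hX.forGeneral_le_finrank hn m).mono ?_,
    hgT.mono ?_⟩
  · rintro u hu ⟨h1, h2⟩
    refine Submodule.eq_of_le_of_finrank_eq
      (gradedPiece_mono (inf_le_inf_right _ (projIdeal_anti (Finset.coe_subset.2 hTZ))) _) ?_
    have e1 := quotDim_add_hdim (I := linIdeal (cutOut u) ^ m)
      (J := projIdeal (T : Set (ℙ K (Vec K n))) ⊓ linIdeal (cutOut u) ^ m) inf_le_right
      ((m + 1 : ℕ) : ℤ)
    have e2 := quotDim_add_hdim (I := linIdeal (cutOut u) ^ m)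
      (J := projIdeal (Z : Set (ℙ K (Vec K n))) ⊓ linIdeal (cutOut u) ^ m) inf_le_right
      ((m + 1 : ℕ) : ℤ)
    rw [quotDim_linIdeal_pow hu, h1, hTr] at e1
    rw [quotDim_linIdeal_pow hu, h2] at e2
    rw [hdim, hdim] at e1 e2
    omega
  · intro u hu h
    classical
    rw [quotDim_linIdeal_pow hu]
    refine le_trans ?_ h
    have hA : (T : Set (ℙ K (Vec K n))) ∩ X = ((T.filter (· ∈ X) : Finset _) : Set _) := by
      ext P; simp
    rw [hA, Set.ncard_coe_finset]
    rcases (T.filter (· ∈ X)).eq_empty_or_nonempty with h0 | hne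
    · rw [h0, Finset.card_empty]; exact Nat.zero_le _
    · refine (hT _ (Finset.filter_subset _ _) hne).trans ?_
      refine Nat.add_le_add_right (Nat.mul_le_mul_left _ (Nat.sub_le_sub_right ?_ 1)) 1
      rw [← span_cone_eq]
      exact Submodule.finrank_mono (Submodule.span_mono (cone_mono fun P hP =>
        (Finset.mem_filter.1 hP).2))
  · intro u hu h
    rw [quotDim_linIdeal_pow hu, h, hTr, quotDim_top_eq_card (Nat.succ_pos m) hT]
    exact hTcard

theorem sum_tsub_add_sum {n : ℕ} (a : Fin n → ℕ) (d : ℕ) :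
    ∑ i, (d - a i) + ∑ i, a i = n * d + ∑ i, (a i - d) := by
  rw [← Finset.sum_add_distrib]
  have : n * d = ∑ _i : Fin n, d := by simp
  rw [this, ← Finset.sum_add_distrib]
  exact Finset.sum_congr rfl fun i _ => by omega

end Unexpected
end UnexpectedHypersurfaces

theorem theorem5p31 {K : Type*} [Field K] [IsAlgClosed K] (n : ℕ) (hn : 0 < n)
    (Z : Finset (ℙ K (Vec K n))) (hZ : Z.Nonempty)
    (a : Fin n → ℕ) (ha : IsSplittingType Z a)
    (hH : ∀ H : Submodule K (Vec K n), 2 ≤ Module.finrank K H →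
      ((((Z : Set (ℙ K (Vec K n))) ∩ projSet H).ncard : ℚ) - 1) / ((Module.finrank K H : ℚ) - 1)
        ≤ ((Z.card : ℚ) - 1) / (n : ℚ))
    (d : ℤ) :
    List.TFAE [
      AdmitsVeryUnexpected Z d,
      AdmitsUnexpected Z d,
      (a ⟨0, hn⟩ : ℤ) < d ∧ d < (a ⟨n - 1, Nat.sub_lt hn Nat.one_pos⟩ : ℤ)] := by
  have : Infinite K := IsAlgClosed.instInfinite
  obtain ⟨hmono, hgen⟩ := ha
  have hgood := hgen.and (forGeneral_isTransverse Z)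
  tfae_have 1 → 2 := AdmitsVeryUnexpected.admitsUnexpected
  tfae_have 2 → 3 := by
    intro h
    obtain ⟨u, hu, h, hR, hZu⟩ := (ForGeneral.and h hgood).exists hn
    rcases le_or_gt d 0 with hd | hd
    · rw [hdim_inf_eq_zero_of_nonpos hZ _ hd] at h
      omega
    · obtain ⟨m, rfl⟩ : ∃ m : ℕ, d = ((m + 1 : ℕ) : ℤ) := ⟨(d - 1).toNat, by omega⟩
      have hm : (((m + 1 : ℕ) : ℤ) - 1).toNat = m := by omega
      rw [hm, hdim_eq_sum_of_restrictsTo hu hZu hZ hR, hdim_linIdeal_pow hu] at h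
      have h1 := quotDim_top_le_card Z ((m + 1 : ℕ) : ℤ)
      have h2 := sum_splitting_add_one hu hZu hZ hR
      have h3 := sum_tsub_add_sum a (m + 1)
      -- With d = m + 1 and truncated differences, the actual dimension is Σ (d - a_i), whereas nd +
      -- 1 - |Z| = Σ (d - a_i) - Σ (a_i - d). Exceeding 0 makes the first sum positive, exceeding
      -- the expected value makes the second one positive.
      have h4 : ∑ i, (m + 1 - a i) ≠ 0 := by omega
      have h5 : ∑ i, (a i - (m + 1)) ≠ 0 := by omega
      obtain ⟨i, -, hi⟩ := Finset.exists_ne_zero_of_sum_ne_zero h4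
      obtain ⟨j, -, hj⟩ := Finset.exists_ne_zero_of_sum_ne_zero h5
      have hi' : a ⟨0, hn⟩ ≤ a i := hmono (Fin.mk_le_of_le_val (Nat.zero_le _))
      have hj' : a j ≤ a ⟨n - 1, Nat.sub_lt hn Nat.one_pos⟩ :=
        hmono (Fin.le_def.2 (Nat.le_sub_one_of_lt j.2))
      omega
  tfae_have 3 → 1 := by
    rintro ⟨h0, h1⟩
    obtain ⟨m, rfl⟩ : ∃ m : ℕ, d = ((m + 1 : ℕ) : ℤ) := ⟨(d - 1).toNat, by omega⟩
    obtain ⟨u, hu, ⟨hR, hZu⟩, hr⟩ := (hgood.and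
      (forGeneral_finrank_span_powVec m (cone (Z : Set (ℙ K (Vec K n)))))).exists hn
    have e1 := quotDim_add_hdim (I := linIdeal (cutOut u) ^ m)
      (J := projIdeal (Z : Set (ℙ K (Vec K n))) ⊓ linIdeal (cutOut u) ^ m) inf_le_right
      ((m + 1 : ℕ) : ℤ)
    rw [quotDim_linIdeal_pow hu, hr, hdim_eq_sum_of_restrictsTo hu hZu hZ hR,
      hdim_linIdeal_pow hu] at e1
    have e2 := sum_splitting_add_one hu hZu hZ hR
    have e3 := sum_tsub_add_sum a (m + 1)
    have e4 := Finset.single_le_sum (f := fun i => m + 1 - a i) (fun _ _ => Nat.zero_le _)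
      (Finset.mem_univ ⟨0, hn⟩)
    have e5 := Finset.single_le_sum (f := fun i => a i - (m + 1)) (fun _ _ => Nat.zero_le _)
      (Finset.mem_univ ⟨n - 1, Nat.sub_lt hn Nat.one_pos⟩)
    -- The rank of Z equals nd + 1 - Σ (d - a_i), and also |Z| - Σ (a_i - d). The terms for a_1 and
    -- a_n make both truncated sums positive, so the rank is at most nd and less than |Z|.
    exact AdmitsVeryUnexpected.of_genericRank hn hH (by omega) (by omega)
  tfae_finish
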